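/- Let $V=\bigoplus_{i\in\mathbb N}V_i$ be a vertex operator algebra of CFT type over $\mathbb C$ (so $\dim V_i<\infty$, $\dim V_0=1$), with vacuum $\mathbf 1$, conformal vector $\omega$ and modes $a_{(m)}$. *Enveloping algebra.* Let $\mathfrak L(V)=V\otimes\mathbb C[t,t^{-1}]/\operatorname{Im}(L_{-1}\otimes\mathrm{id}+\mathrm{id}\otimes\frac{d}{dt})$, write $a_{[i]}$ for the class of $a\otimes t^i$ (of degree $\deg a-i-1$), with the Lie bracket $[a_{[i]},b_{[j]}]=\sum_{k\ge 0}\binom ik(a_{(k)}b)_{[i+j-k]}$, and let $U$ be its universal enveloping algebra, graded by $U=\bigoplus_d U_d$. Put $N_L^nU_p=\sum_{j\le -n}U_{p-j}U_j$ and $N_R^nU_p=\sum_{i\ge n}U_iU_{p-i}=N_L^{n-p}U_p$, and let $\widehat U=\bigoplus_d\widehat U_d$ with $\widehat U_d=\varprojlim_n U_d/N_L^nU_d$. Let $\mathscr U=\widehat U/\overline J$, where $\overline J$ is the degreewise closure of the two-sided ideal $J$ generated by the vacuum relation $\mathbf 1_{[-1]}=1$ and the Jacobi relations $$\sum_{i\ge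 0}(-1)^i\binom{\ell}{i}\bigl(a_{[m+\ell-i]}b_{[n+i]}-(-1)^{\ell}b_{[n+\ell-i]}a_{[m+i]}\bigr)=\sum_{i\ge 0}\binom mi(a_{(\ell+i)}b)_{[m+n-i]}\qquad(a,b\in V,\ \ell,m,n\in\mathbb Z).$$ Let $\mathscr U_p$, $N_L^n\mathscr U_p$, $N_R^n\mathscr U_p$ be the images in $\mathscr U$ of $\widehat U_p$ and of the closures of $N_L^nU_p$, $N_R^nU_p$. *Mode transition algebra.* Let $\mathsf A=\mathscr U_0/N_L^1\mathscr U_0$ be the Zhu algebra of $V$. For a left $\mathsf A$-module $M$ put $\Phi^{\mathsf L}(M)_d=(\mathscr U_d/N_L^1\mathscr U_d)\otimes_{\mathscr U_0}M$, and let $$\mathfrak A_{p,q}=(\mathscr U_p/N_L^1\mathscr U_p)\otimes_{\mathscr U_0}\mathsf A\otimes_{\mathscr U_0}(\mathscr U_q/N_R^1\mathscr U_q)\qquad(p,q\in\mathbb Z),$$ with the left and right multiplications by homogeneous elements of $\mathscr U$, hence by homogeneous elements of $\mathfrak L(V)$. For $\alpha\in\mathscr U_{-m}$ and $\beta\in\mathscr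 U_m$ let $\alpha\circledast\beta=[\alpha\beta]\in\mathsf A$. The operations $$\star\colon\mathfrak A_{n,-m}\times\Phi^{\mathsf L}(M)_m\to\Phi^{\mathsf L}(M)_n,\quad (u\otimes a\otimes u')\star(\beta\otimes w)=u\otimes a(u'\circledast\beta)w,$$ $$\star\colon\mathfrak A_{n,-m}\times\mathfrak A_{m,q}\to\mathfrak A_{n,q},\quad (u\otimes a\otimes u')\star(\beta\otimes b\otimes\beta')=u\otimes a(u'\circledast\beta)b\otimes\beta'$$ make $\mathfrak A_d:=\mathfrak A_{d,-d}$ a ring (the $d$-th mode transition algebra), which acts on $\Phi^{\mathsf L}(M)_d$. *Statement.* Assume that for every $d\in\mathbb N$ the ring $\mathfrak A_d$ is unital, with unity $\mathscr I_d\in\mathfrak A_d$. Then the following are equivalent: 1. for all $d,n,m\in\mathbb N$, all $u\in\mathfrak L(V)_d$ and all $\mathfrak a\in\mathfrak A_{n,-m}$ one has $(u\cdot\mathscr I_n)\star\mathfrak a=u\cdot\mathfrak a$ and $\mathfrak a\star(\mathscr I_m\cdot u)=\mathfrak a\cdot u$; 2. for all $n,m\in\mathbb N$ and all $\mathfrak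 a\in\mathfrak A_{n,-m}$ one has $\mathscr I_n\star\mathfrak a=\mathfrak a=\mathfrak a\star\mathscr I_m$; 3. for every $d\in\mathbb N$ the homomorphism $\mathfrak A_d\to\operatorname{End}(\Phi^{\mathsf L}(\mathsf A)_d)$ is unital, i.e. sends $\mathscr I_d$ to the identity; 4. for every $d\in\mathbb N$ the homomorphism $\mathfrak A_d\to\operatorname{End}(\Phi^{\mathsf L}(\mathsf A)_d)$ is unital and injective; 5. for every $d\in\mathbb N$ and every left $\mathsf A$-module $M$ the homomorphism $\mathfrak A_d\to\operatorname{End}(\Phi^{\mathsf L}(M)_d)$ is unital. -/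

import Mathlib

open scoped TensorProduct

universe u

noncomputable section

/-! ## Vertex operator algebras of CFT type -/

/-- A vertex operator algebra of CFT type over `ℂ`.  The axiom that vertex operators are fields
(`a_(m) b = 0` for `m ≫ 0`) is built into `VertexOperator`, and `VertexOperator.ncoeff (Y a) m`
is the mode `a_(m)`, so that `Y(a, z) = ∑ a_(m) z^(-m-1)`. -/
class VertexOperatorAlgebra (V : Type u) [AddCommGroup V] [Module ℂ V] where
  /-- the homogeneous pieces `V_i` -/
  piece : ℕ → Submodule ℂ V
  isInternal : DirectSum.IsInternal piece
  finiteDimensional : ∀ i, FiniteDimensional ℂ (piece i)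
  finrank_piece_zero : Module.finrank ℂ (piece 0) = 1
  /-- the vacuum vector -/
  vac : V
  vac_mem : vac ∈ piece 0
  /-- the conformal vector -/
  omega : V
  omega_mem : omega ∈ piece 2
  /-- the state-field correspondence -/
  Y : V →ₗ[ℂ] VertexOperator ℂ V
  vac_mode : ∀ m : ℤ, VertexOperator.ncoeff (Y vac) m = if m = -1 then LinearMap.id else 0
  mode_neg_one_vac : ∀ a : V, VertexOperator.ncoeff (Y a) (-1) vac = a
  mode_nonneg_vac : ∀ (a : V) (m : ℤ), 0 ≤ m → VertexOperator.ncoeff (Y a) m vac = 0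
  /-- `(z₁ - z₂)^N [Y(a, z₁), Y(b, z₂)] = 0`, coefficient by coefficient -/
  weak_commutativity : ∀ a b : V, ∃ N : ℕ, ∀ m n : ℤ,
    ∑ j ∈ Finset.range (N + 1), ((-1 : ℂ) ^ j * (N.choose j : ℂ)) •
      ⁅VertexOperator.ncoeff (Y a) (m + N - j), VertexOperator.ncoeff (Y b) (n + j)⁆ = 0
  /-- the central charge -/
  centralCharge : ℂ
  virasoro : ∀ p q : ℤ,
    ⁅VertexOperator.ncoeff (Y omega) (p + 1), VertexOperator.ncoeff (Y omega) (q + 1)⁆ =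
      ((p : ℂ) - q) • VertexOperator.ncoeff (Y omega) (p + q + 1) +
        (if p + q = 0 then centralCharge / 12 * ((p : ℂ) ^ 3 - p) else 0) • LinearMap.id
  L_zero : ∀ (i : ℕ) (v : V), v ∈ piece i → VertexOperator.ncoeff (Y omega) 1 v = (i : ℂ) • v
  /-- `Y(L_{-1} a, z) = d/dz Y(a, z)`, coefficient by coefficient -/
  translation : ∀ (a : V) (m : ℤ),
    VertexOperator.ncoeff (Y (VertexOperator.ncoeff (Y omega) 0 a)) m =
      (-(m : ℂ)) • VertexOperator.ncoeff (Y a) (m - 1)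

namespace VertexOperatorAlgebra

section Enveloping

variable (V : Type u) [AddCommGroup V] [Module ℂ V] [VertexOperatorAlgebra V]

variable {V} in
/-- The mode `a_(m)`. -/
def mode (a : V) (m : ℤ) : Module.End ℂ V := VertexOperator.ncoeff (Y a) m

variable {V} in
/-- `L_{-1} = ω_(0)`. -/
def Lneg : V →ₗ[ℂ] V := mode (omega : V) 0

/-! ## The finite ancillary Lie algebra and its enveloping algebra -/

/-- The operator `∇ = L_{-1} ⊗ id + id ⊗ d/dt` on `V ⊗ ℂ[t, t⁻¹]`, the latter being realized as
the space `ℤ →₀ V` of Laurent polynomials with coefficients in `V`. -/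
def nabla : (ℤ →₀ V) →ₗ[ℂ] (ℤ →₀ V) :=
  Finsupp.lsum ℂ fun i : ℤ =>
    Finsupp.lsingle i ∘ₗ Lneg + (i : ℂ) • Finsupp.lsingle (i - 1)

/-- The space underlying the finite ancillary Lie algebra `𝔏(V)^f = V ⊗ ℂ[t, t⁻¹] / im ∇`. -/
abbrev FinLie : Type u := (ℤ →₀ V) ⧸ LinearMap.range (nabla V)

variable {V} in
/-- `a_[i]`, the class of `a ⊗ t^i`. -/
def lieMode (a : V) (i : ℤ) : FinLie V := Submodule.Quotient.mk (Finsupp.single i a)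

/-- The piece of degree `d`: it is spanned by the `a_[i]` with `a` homogeneous and
`deg a - i - 1 = d`. -/
def finLiePiece (d : ℤ) : Submodule ℂ (FinLie V) :=
  Submodule.span ℂ {x | ∃ (k : ℕ) (a : V) (i : ℤ), a ∈ piece k ∧ (k : ℤ) - i - 1 = d ∧
    x = lieMode a i}

/-- The relations `x ⊗ y - y ⊗ x = [x, y]` of the universal enveloping algebra, for the Lie bracket
`[a_[i], b_[j]] = ∑_{k ≥ 0} (i choose k) (a_(k) b)_[i + j - k]`; the sum is finite. -/
inductive EnvRel : TensorAlgebra ℂ (FinLie V) → TensorAlgebra ℂ (FinLie V) → Prop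
  | bracket (a b : V) (i j : ℤ) :
      EnvRel
        (TensorAlgebra.ι ℂ (lieMode a i) * TensorAlgebra.ι ℂ (lieMode b j) -
          TensorAlgebra.ι ℂ (lieMode b j) * TensorAlgebra.ι ℂ (lieMode a i))
        (TensorAlgebra.ι ℂ
          (∑ᶠ k : ℕ, (Ring.choose i k : ℂ) • lieMode (mode a k b) (i + j - k)))

/-- `U`, the universal enveloping algebra of `𝔏(V)^f`. -/
def Env : Type u := RingQuot (EnvRel V)

instance : Ring (Env V) := inferInstanceAs (Ring (RingQuot (EnvRel V)))
instance : Algebra ℂ (Env V) := inferInstanceAs (Algebra ℂ (RingQuot (EnvRel V)))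

/-- The canonical map `𝔏(V)^f → U`. -/
def envι : FinLie V →ₗ[ℂ] Env V :=
  (RingQuot.mkAlgHom ℂ (EnvRel V)).toLinearMap ∘ₗ TensorAlgebra.ι ℂ

/-- `IsMonomial d x`: `x` is a product of homogeneous elements `a_[i]` (possibly the empty product)
whose degrees add up to `d`. -/
inductive IsMonomial : ℤ → Env V → Prop
  | one : IsMonomial 0 1
  | mul (k : ℕ) (a : V) (i d : ℤ) (x : Env V) : a ∈ piece k → IsMonomial d x →
      IsMonomial ((k : ℤ) - i - 1 + d) (envι V (lieMode a i) * x)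

/-- `U_d`. -/
def envPiece (d : ℤ) : Submodule ℂ (Env V) := Submodule.span ℂ {x | IsMonomial V d x}

/-- The left ideal `N_L^n U = U U_{≤ -n}`. -/
def envNL (n : ℤ) : Submodule ℂ (Env V) := ⊤ * ⨆ (j : ℤ) (_ : j ≤ -n), envPiece V j

/-- `N_L^n U_p = ∑_{j ≤ -n} U_{p-j} U_j`. -/
def envNLPiece (n p : ℤ) : Submodule ℂ (Env V) :=
  ⨆ (j : ℤ) (_ : j ≤ -n), envPiece V (p - j) * envPiece V j

/-- `N_R^n U_p = ∑_{i ≥ n} U_i U_{p-i}`. -/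
def envNRPiece (n p : ℤ) : Submodule ℂ (Env V) :=
  ⨆ (i : ℤ) (_ : n ≤ i), envPiece V i * envPiece V (p - i)

/-- The left and right neighborhoods agree up to a shift. -/
theorem envNRPiece_eq (n p : ℤ) : envNRPiece V n p = envNLPiece V (n - p) p := by
  apply le_antisymm
  · refine iSup₂_le fun i hi => ?_
    refine le_trans ?_ (le_iSup₂ (p - i) (by lia))
    rw [show p - (p - i) = i by ring]
  · refine iSup₂_le fun j hj => ?_
    refine le_trans ?_ (le_iSup₂ (p - j) (by lia))
    rw [show p - (p - j) = j by ring]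

variable {V}

theorem IsMonomial.mul_mono {d e : ℤ} {x y : Env V} (hx : IsMonomial V d x)
    (hy : IsMonomial V e y) : IsMonomial V (d + e) (x * y) := by
  induction hx with
  | one => simpa using hy
  | mul k a i d x ha _ ih =>
    rw [mul_assoc, add_assoc]
    exact IsMonomial.mul k a i _ _ ha ih

theorem envPiece_mul_le (d e : ℤ) : envPiece V d * envPiece V e ≤ envPiece V (d + e) := by
  rw [envPiece, envPiece, Submodule.span_mul_span]
  refine Submodule.span_mono ?_
  rintro _ ⟨x, hx, y, hy, rfl⟩
  exact hx.mul_mono hy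

theorem mul_mem_envPiece {d e : ℤ} {x y : Env V} (hx : x ∈ envPiece V d)
    (hy : y ∈ envPiece V e) : x * y ∈ envPiece V (d + e) :=
  envPiece_mul_le d e (Submodule.mul_mem_mul hx hy)

theorem one_mem_envPiece : (1 : Env V) ∈ envPiece V 0 := Submodule.subset_span IsMonomial.one

theorem envι_lieMode_mem {k : ℕ} {a : V} (ha : a ∈ piece k) (i : ℤ) :
    envι V (lieMode a i) ∈ envPiece V ((k : ℤ) - i - 1) := by
  have := IsMonomial.mul k a i 0 1 ha IsMonomial.one
  exact Submodule.subset_span (by simpa using this)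

theorem envι_mem {d : ℤ} {x : FinLie V} (hx : x ∈ finLiePiece V d) :
    envι V x ∈ envPiece V d := by
  induction hx using Submodule.span_induction with
  | mem x hx => obtain ⟨k, a, i, ha, rfl, rfl⟩ := hx; exact envι_lieMode_mem ha i
  | zero => simp
  | add x y _ _ hx hy => rw [map_add]; exact add_mem hx hy
  | smul c x _ hx => rw [map_smul]; exact Submodule.smul_mem _ _ hx

variable (V) in
theorem iSup_envPiece : (⨆ d : ℤ, envPiece V d) = ⊤ := by
  set S : Submodule ℂ (Env V) := ⨆ d : ℤ, envPiece V d with hS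
  have hle : ∀ d, envPiece V d ≤ S := fun d => le_iSup (envPiece V) d
  have hmul : ∀ x ∈ S, ∀ y ∈ S, x * y ∈ S := by
    intro x hx y hy
    have h : S * S ≤ S := by
      rw [hS, Submodule.iSup_mul]
      refine iSup_le fun d => ?_
      rw [Submodule.mul_iSup]
      exact iSup_le fun e => (envPiece_mul_le d e).trans (hle _)
    exact h (Submodule.mul_mem_mul hx hy)
  have hι : ∀ l : FinLie V, envι V l ∈ S := by
    intro l
    obtain ⟨f, rfl⟩ := Submodule.Quotient.mk_surjective _ l
    induction f using Finsupp.induction_linear with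
    | zero => simp
    | add f g hf hg => rw [Submodule.Quotient.mk_add, map_add]; exact add_mem hf hg
    | single i a =>
      have ha : a ∈ ⨆ k, piece (V := V) k := by
        rw [(isInternal (V := V)).submodule_iSup_eq_top]; trivial
      induction ha using Submodule.iSup_induction' with
      | mem k a ha => exact hle _ (envι_lieMode_mem ha i)
      | zero => simp
      | add a b _ _ ha hb =>
        rw [Finsupp.single_add, Submodule.Quotient.mk_add, map_add]; exact add_mem ha hb
  rw [eq_top_iff]
  rintro x -
  obtain ⟨t, rfl⟩ := RingQuot.mkAlgHom_surjective ℂ (EnvRel V) x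
  induction t using TensorAlgebra.induction with
  | algebraMap r =>
    have : (RingQuot.mkAlgHom ℂ (EnvRel V)) (algebraMap ℂ _ r) = r • (1 : Env V) := by
      rw [AlgHom.commutes, Algebra.algebraMap_eq_smul_one]; rfl
    rw [this]
    exact S.smul_mem _ (hle 0 one_mem_envPiece)
  | ι l => exact hι l
  | mul a b ha hb => rw [map_mul]; exact hmul _ ha _ hb
  | add a b ha hb => rw [map_add]; exact add_mem ha hb

theorem mul_mem_envNL (n : ℤ) (x : Env V) {y : Env V} (hy : y ∈ envNL V n) :
    x * y ∈ envNL V n := by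
  have h : (⊤ : Submodule ℂ (Env V)) * envNL V n ≤ envNL V n := by
    rw [envNL, ← mul_assoc]
    exact mul_le_mul' le_top le_rfl
  exact h (Submodule.mul_mem_mul trivial hy)

theorem envNL_anti {m n : ℤ} (h : m ≤ n) : envNL V n ≤ envNL V m :=
  mul_le_mul' le_rfl (iSup₂_le fun j hj => le_iSup₂_of_le j (by lia) le_rfl)

theorem envNL_mul_mem {n q : ℤ} {x y : Env V} (hx : x ∈ envNL V n) (hy : y ∈ envPiece V q) :
    x * y ∈ envNL V (n - q) := by
  have h : envNL V n * envPiece V q ≤ envNL V (n - q) := by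
    rw [envNL, envNL, mul_assoc]
    refine mul_le_mul' le_rfl ?_
    simp only [Submodule.iSup_mul]
    refine iSup₂_le fun j hj => ?_
    exact (envPiece_mul_le j q).trans (le_iSup₂_of_le (j + q) (by lia) le_rfl)
  exact h (Submodule.mul_mem_mul hx hy)

variable (V) in
theorem envNL_basis : RingSubgroupsBasis fun n : ℤ => (envNL V n).toAddSubgroup where
  inter i j := ⟨max i j, le_inf (envNL_anti (le_max_left i j)) (envNL_anti (le_max_right i j))⟩
  mul i := ⟨i, by rintro _ ⟨x, -, y, hy, rfl⟩; exact mul_mem_envNL i x hy⟩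
  leftMul x i := ⟨i, fun y hy => mul_mem_envNL i x hy⟩
  rightMul x i := by
    have hx : x ∈ ⨆ d : ℤ, envPiece V d := by rw [iSup_envPiece]; trivial
    induction hx using Submodule.iSup_induction' with
    | mem q x hx =>
      refine ⟨i + q, fun y hy => ?_⟩
      have := envNL_mul_mem (n := i + q) hy hx
      rw [add_sub_cancel_right] at this
      exact this
    | zero =>
      refine ⟨i, fun y _ => ?_⟩
      show y * 0 ∈ envNL V i
      rw [mul_zero]; exact zero_mem _
    | add x y _ _ hx hy =>
      obtain ⟨j, hj⟩ := hx
      obtain ⟨k, hk⟩ := hy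
      refine ⟨max j k, fun z hz => ?_⟩
      show z * (x + y) ∈ envNL V i
      rw [mul_add]
      exact add_mem (hj (envNL_anti (le_max_left j k) hz)) (hk (envNL_anti (le_max_right j k) hz))

variable (V)

/-! ## Completion -/

/-- The topology on `U` in which the `N_L^n U` form a basis of neighborhoods of `0`. -/
instance : TopologicalSpace (Env V) := (envNL_basis V).topology
instance : NonarchimedeanRing (Env V) := (envNL_basis V).nonarchimedean
instance : UniformSpace (Env V) := IsTopologicalAddGroup.rightUniformSpace (Env V)
instance : IsUniformAddGroup (Env V) := isUniformAddGroup_of_addCommGroup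

/-- The separated completion of `U`. It serves as the ambient ring of the graded completion. -/
abbrev EnvCompl : Type u := UniformSpace.Completion (Env V)

/-- The closure in `EnvCompl V` of the image of a subspace of `U`. -/
def closureImage (M : Submodule ℂ (Env V)) : AddSubgroup (EnvCompl V) :=
  (M.toAddSubgroup.map
    (UniformSpace.Completion.coeRingHom : Env V →+* EnvCompl V).toAddMonoidHom).topologicalClosure

/-- `Û_d = lim_n U_d / N_L^n U_d`, the completion of `U_d`. -/
def hatPiece (d : ℤ) : AddSubgroup (EnvCompl V) := closureImage V (envPiece V d)

/-- `N_L^n Û_p`, the closure of `N_L^n U_p`. -/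
def hatNL (n p : ℤ) : AddSubgroup (EnvCompl V) := closureImage V (envNLPiece V n p)

variable {V}

theorem mul_mem_closure_of {s t w : Set (EnvCompl V)} (h : ∀ x ∈ s, ∀ y ∈ t, x * y ∈ closure w)
    {x y : EnvCompl V} (hx : x ∈ closure s) (hy : y ∈ closure t) : x * y ∈ closure w := by
  have := map_mem_closure₂ (s := s) (t := t) (u := closure w)
    (f := fun a b : EnvCompl V => a * b) continuous_mul hx hy h
  rwa [closure_closure] at this

theorem mul_mem_closureImage {M N P : Submodule ℂ (Env V)} (h : M * N ≤ P) {x y : EnvCompl V}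
    (hx : x ∈ closureImage V M) (hy : y ∈ closureImage V N) : x * y ∈ closureImage V P := by
  refine mul_mem_closure_of (V := V) ?_ hx hy
  rintro _ ⟨a, ha, rfl⟩ _ ⟨b, hb, rfl⟩
  exact subset_closure ⟨a * b, h (Submodule.mul_mem_mul ha hb), UniformSpace.Completion.coe_mul a b⟩

theorem coe_mem_closureImage {M : Submodule ℂ (Env V)} {x : Env V} (hx : x ∈ M) :
    (x : EnvCompl V) ∈ closureImage V M :=
  subset_closure ⟨x, hx, rfl⟩

theorem closureImage_mono {M N : Submodule ℂ (Env V)} (h : M ≤ N) :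
    closureImage V M ≤ closureImage V N :=
  AddSubgroup.topologicalClosure_mono (AddSubgroup.map_mono h)

theorem hatPiece_mul {p q : ℤ} {x y : EnvCompl V} (hx : x ∈ hatPiece V p)
    (hy : y ∈ hatPiece V q) : x * y ∈ hatPiece V (p + q) :=
  mul_mem_closureImage (envPiece_mul_le p q) hx hy

theorem one_mem_hatPiece : (1 : EnvCompl V) ∈ hatPiece V 0 :=
  coe_mem_closureImage one_mem_envPiece

theorem hatNL_le (n p : ℤ) : hatNL V n p ≤ hatPiece V p := by
  refine closureImage_mono (iSup₂_le fun j _ => ?_)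
  have := envPiece_mul_le (V := V) (p - j) j
  rwa [sub_add_cancel] at this

theorem hatNL_mul {n p q : ℤ} {x y : EnvCompl V} (hx : x ∈ hatNL V n p)
    (hy : y ∈ hatPiece V q) : x * y ∈ hatNL V (n - q) (p + q) := by
  refine mul_mem_closureImage ?_ hx hy
  simp only [envNLPiece, Submodule.iSup_mul]
  refine iSup₂_le fun j hj => ?_
  refine le_trans ?_ (le_iSup₂ (j + q) (by lia))
  rw [show p + q - (j + q) = p - j by ring, mul_assoc]
  exact mul_le_mul' le_rfl (envPiece_mul_le j q)

theorem mul_hatNL {n p q : ℤ} {x y : EnvCompl V} (hx : x ∈ hatPiece V p)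
    (hy : y ∈ hatNL V n q) : x * y ∈ hatNL V n (p + q) := by
  refine mul_mem_closureImage ?_ hx hy
  simp only [envNLPiece, Submodule.mul_iSup]
  refine iSup₂_le fun j hj => ?_
  refine le_trans ?_ (le_iSup₂ j hj)
  rw [show p + q - j = p + (q - j) by ring, ← mul_assoc]
  exact mul_le_mul' (envPiece_mul_le p (q - j)) le_rfl

theorem iSup_mul_mem {ι : Type} {P Q S : ι → AddSubgroup (EnvCompl V)}
    (h : ∀ i j, ∀ x ∈ P i, ∀ y ∈ Q j, x * y ∈ ⨆ k, S k)
    {x y : EnvCompl V} (hx : x ∈ ⨆ i, P i) (hy : y ∈ ⨆ i, Q i) : x * y ∈ ⨆ k, S k := by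
  refine AddSubgroup.iSup_induction P (C := fun x => x * y ∈ ⨆ k, S k) hx
    (fun i x hx => ?_) ?_ ?_
  · refine AddSubgroup.iSup_induction Q (C := fun y => x * y ∈ ⨆ k, S k) hy
      (fun j y hy => h i j x hx y hy) ?_ ?_
    · rw [mul_zero]; exact zero_mem _
    · intro y z hy hz; rw [mul_add]; exact add_mem hy hz
  · rw [zero_mul]; exact zero_mem _
  · intro x z hx hz; rw [add_mul]; exact add_mem hx hz

variable (V)

/-- The graded completion `Û = ⨁_d Û_d` of `U`. -/
def Hat : Subring (EnvCompl V) where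
  __ := ⨆ d : ℤ, hatPiece V d
  mul_mem' hx hy := iSup_mul_mem (fun i j _ hx _ hy =>
    AddSubgroup.mem_iSup_of_mem (i + j) (hatPiece_mul hx hy)) hx hy
  one_mem' := AddSubgroup.mem_iSup_of_mem 0 one_mem_hatPiece

variable {V}

/-! ## The universal enveloping algebra of `V` -/

/-- The Jacobi relation
`∑_{i ≥ 0} (-1)^i (l choose i) (a_[m+l-i] b_[n+i] - (-1)^l b_[n+l-i] a_[m+i])
  - ∑_{i ≥ 0} (m choose i) (a_(l+i) b)_[m+n-i]`. -/
def jacobiTerm (a b : V) (l m n : ℤ) (i : ℕ) : Env V :=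
  ((-1 : ℂ) ^ i * (Ring.choose l i : ℂ)) •
      (envι V (lieMode a (m + l - i)) * envι V (lieMode b (n + i)) -
        ((-1 : ℂ) ^ l) • (envι V (lieMode b (n + l - i)) * envι V (lieMode a (m + i)))) -
    (Ring.choose m i : ℂ) • envι V (lieMode (mode a (l + i) b) (m + n - i))

/-- The (convergent) sum of the terms of the Jacobi relation. -/
def jacobi (a b : V) (l m n : ℤ) : EnvCompl V :=
  ∑' i : ℕ, (jacobiTerm a b l m n i : EnvCompl V)

theorem mode_eventually_zero (a b : V) (l : ℤ) :
    ∃ K : ℕ, ∀ i : ℕ, K ≤ i → mode a (l + i) b = 0 := by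
  set o := HahnSeries.order ((HahnModule.of ℂ).symm (Y a b)) with ho
  refine ⟨(1 - o - l).toNat, fun i hi => ?_⟩
  exact VertexOperator.ncoeff_eq_zero_of_lt_order (Y a) (l + i) b (by lia)

/-- The sum defining a Jacobi relation converges. -/
theorem summable_jacobiTerm {i j : ℕ} {a b : V} (ha : a ∈ piece i) (hb : b ∈ piece j)
    (l m n : ℤ) : Summable fun k : ℕ => (jacobiTerm a b l m n k : EnvCompl V) := by
  refine NonarchimedeanAddGroup.summable_of_tendsto_cofinite_zero ?_
  have h : Filter.Tendsto (jacobiTerm a b l m n) Filter.cofinite (nhds 0) := by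
    rw [Nat.cofinite_eq_atTop, ((envNL_basis V).hasBasis_nhds_zero).tendsto_right_iff]
    rintro N -
    obtain ⟨K, hK⟩ := mode_eventually_zero a b l
    filter_upwards [Filter.eventually_ge_atTop
      (max K ((max (j - n - 1) (i - m - 1) : ℤ) + N).toNat)] with k hk
    have hK' : mode a (l + k) b = 0 := hK k (le_trans (le_max_left _ _) hk)
    have hmem : ∀ (x : Env V) {y : Env V} {e : ℤ}, y ∈ envPiece V e → e ≤ -N →
        x * y ∈ envNL V N := fun x y e hy he =>
      Submodule.mul_mem_mul trivial (Submodule.mem_iSup_of_mem e (Submodule.mem_iSup_of_mem he hy))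
    have h1 : envι V (lieMode (mode a (l + k) b) (m + n - k)) = 0 := by
      rw [hK', lieMode, Finsupp.single_zero, Submodule.Quotient.mk_zero, map_zero]
    show jacobiTerm a b l m n k ∈ envNL V N
    rw [jacobiTerm, h1, smul_zero, sub_zero]
    refine Submodule.smul_mem _ _ (sub_mem (hmem _ (envι_lieMode_mem hb _) ?_)
      (Submodule.smul_mem _ _ (hmem _ (envι_lieMode_mem ha _) ?_)))
    · lia
    · lia
  have := (UniformSpace.Completion.continuous_coe (Env V)).tendsto 0 |>.comp h
  rwa [UniformSpace.Completion.coe_zero] at this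

variable (V)

/-- The homogeneous defining relations of degree `q`: the Jacobi relations for homogeneous `a`
and `b` (of degree `deg a + deg b - l - m - n - 2`), and the vacuum relation `1_[-1] = 1`
(of degree `0`), which makes the image of `1_[-1]` the identity. -/
inductive IsRelation : ℤ → EnvCompl V → Prop
  | jacobi (i j : ℕ) (a b : V) (l m n : ℤ) : a ∈ piece i → b ∈ piece j →
      IsRelation ((i : ℤ) + j - l - m - n - 2) (jacobi a b l m n)
  | vacuum : IsRelation 0 ((envι V (lieMode vac (-1)) - 1 : Env V) : EnvCompl V)

/-- The piece of degree `p` of the two-sided ideal `J` of `Û` generated by the relations. -/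
def relPiece (p : ℤ) : AddSubgroup (EnvCompl V) :=
  AddSubgroup.closure {z | ∃ (s q t : ℤ) (x r y : EnvCompl V), s + q + t = p ∧
    x ∈ hatPiece V s ∧ IsRelation V q r ∧ y ∈ hatPiece V t ∧ z = x * r * y}

/-- The piece of degree `p` of the closure of `J`. -/
def relClosurePiece (p : ℤ) : AddSubgroup (EnvCompl V) := (relPiece V p).topologicalClosure

variable {V}

theorem mul_relClosurePiece {p q : ℤ} {x y : EnvCompl V} (hx : x ∈ hatPiece V p)
    (hy : y ∈ relClosurePiece V q) : x * y ∈ relClosurePiece V (p + q) := by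
  have key : ∀ y ∈ relPiece V q, x * y ∈ relPiece V (p + q) := by
    intro y hy
    induction hy using AddSubgroup.closure_induction with
    | mem y hy =>
      obtain ⟨s, q, t, x', r, y', rfl, hx', hr, hy', rfl⟩ := hy
      exact AddSubgroup.subset_closure ⟨p + s, q, t, x * x', r, y', by ring,
        hatPiece_mul hx hx', hr, hy', by simp only [mul_assoc]⟩
    | zero => rw [mul_zero]; exact zero_mem _
    | add y z _ _ hy hz => rw [mul_add]; exact add_mem hy hz
    | neg y _ hy => rw [mul_neg]; exact neg_mem hy
  refine mul_mem_closure_of (V := V) (s := {x}) ?_ (subset_closure rfl) hy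
  rintro _ rfl y hy
  exact subset_closure (key y hy)

theorem relClosurePiece_mul {p q : ℤ} {x y : EnvCompl V} (hx : x ∈ relClosurePiece V p)
    (hy : y ∈ hatPiece V q) : x * y ∈ relClosurePiece V (p + q) := by
  have key : ∀ x ∈ relPiece V p, x * y ∈ relPiece V (p + q) := by
    intro x hx
    induction hx using AddSubgroup.closure_induction with
    | mem x hx =>
      obtain ⟨s, p, t, x', r, y', rfl, hx', hr, hy', rfl⟩ := hx
      exact AddSubgroup.subset_closure ⟨s, p, t + q, x', r, y' * y, by ring,
        hx', hr, hatPiece_mul hy' hy, by simp only [mul_assoc]⟩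
    | zero => rw [zero_mul]; exact zero_mem _
    | add x z _ _ hx hz => rw [add_mul]; exact add_mem hx hz
    | neg x _ hx => rw [neg_mul]; exact neg_mem hx
  refine mul_mem_closure_of (V := V) (t := {y}) ?_ hx (subset_closure rfl)
  rintro x hx _ rfl
  exact subset_closure (key x hx)

variable (V)

/-- The closure `J̄ = ⨁_p J̄_p` of `J`, a two-sided ideal of `Û`. -/
def relIdeal : Ideal (Hat V) where
  carrier := {x | (x : EnvCompl V) ∈ ⨆ p : ℤ, relClosurePiece V p}
  add_mem' hx hy := (⨆ p : ℤ, relClosurePiece V p).add_mem hx hy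
  zero_mem' := zero_mem (⨆ p : ℤ, relClosurePiece V p)
  smul_mem' c _ hx := iSup_mul_mem (fun i j _ hx _ hy =>
    AddSubgroup.mem_iSup_of_mem (i + j) (mul_relClosurePiece hx hy)) c.2 hx

instance : (relIdeal V).IsTwoSided where
  mul_mem_of_left {x} c hx := by
    have : (x : EnvCompl V) * c ∈ ⨆ p : ℤ, relClosurePiece V p := iSup_mul_mem
      (fun i j _ hx _ hy => AddSubgroup.mem_iSup_of_mem (i + j) (relClosurePiece_mul hx hy)) hx c.2
    exact this

/-- `𝒰 = Û / J̄`, the (finite) universal enveloping algebra of `V`. -/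
abbrev UnivEnv : Type u := Hat V ⧸ relIdeal V

/-- The image in `𝒰` of a subgroup of `Û`. -/
def imageInUnivEnv (K : AddSubgroup (EnvCompl V)) : AddSubgroup (UnivEnv V) :=
  (K.comap (Hat V).subtype.toAddMonoidHom).map (Ideal.Quotient.mk (relIdeal V)).toAddMonoidHom

variable {V} in
theorem mul_mem_imageInUnivEnv {K L M : AddSubgroup (EnvCompl V)}
    (h : ∀ x ∈ K, ∀ y ∈ L, x * y ∈ M) {x y : UnivEnv V} (hx : x ∈ imageInUnivEnv V K)
    (hy : y ∈ imageInUnivEnv V L) : x * y ∈ imageInUnivEnv V M := by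
  obtain ⟨x, hx, rfl⟩ := hx
  obtain ⟨y, hy, rfl⟩ := hy
  exact ⟨x * y, h _ hx _ hy, map_mul (Ideal.Quotient.mk (relIdeal V)) x y⟩

end Enveloping

end VertexOperatorAlgebra

/-! ## Graded seminormed rings, Zhu algebra, induced modules, mode transition algebra -/

/-- A family of homogeneous pieces `R_p` of a ring `R` together with a family of left neighborhoods
`N_L^n R_p` of `0` in these, which are compatible with the multiplication. -/
structure SeminormedGrading (R : Type u) [Ring R] where
  /-- `R_p` -/
  piece : ℤ → AddSubgroup R
  /-- `N_L^n R_p` -/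
  NL : ℤ → ℤ → AddSubgroup R
  NL_le : ∀ n p, NL n p ≤ piece p
  one_mem : (1 : R) ∈ piece 0
  mul_mem : ∀ {p q : ℤ} {x y : R}, x ∈ piece p → y ∈ piece q → x * y ∈ piece (p + q)
  NL_mul : ∀ {n p q : ℤ} {x y : R}, x ∈ NL n p → y ∈ piece q → x * y ∈ NL (n - q) (p + q)
  mul_NL : ∀ {n p q : ℤ} {x y : R}, x ∈ piece p → y ∈ NL n q → x * y ∈ NL n (p + q)

/-- The tensor product over `S` of `X` (on which `s : S` acts on the right through `ρ s`)
and `M` (on which `s : S` acts on the left through `lam s`): the quotient of `X ⊗_ℤ M` by the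
subgroup generated by the elements `x s ⊗ m - x ⊗ s m`. -/
def BalTensor {S X M : Type u} [AddCommGroup X] [AddCommGroup M]
    (ρ : S → X →+ X) (lam : S → M →+ M) : Type u :=
  (X ⊗[ℤ] M) ⧸ AddSubgroup.closure {t : X ⊗[ℤ] M | ∃ (s : S) (x : X) (m : M),
    t = ρ s x ⊗ₜ[ℤ] m - x ⊗ₜ[ℤ] lam s m}

namespace BalTensor

variable {S X M P : Type u} [AddCommGroup X] [AddCommGroup M] [AddCommGroup P]
  {ρ : S → X →+ X} {lam : S → M →+ M}

instance : AddCommGroup (BalTensor ρ lam) :=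
  inferInstanceAs (AddCommGroup ((X ⊗[ℤ] M) ⧸ AddSubgroup.closure _))

variable (ρ lam) in
/-- The class of `x ⊗ m`. -/
def tmul : X →+ M →+ BalTensor ρ lam :=
  AddMonoidHom.mk' (fun x => AddMonoidHom.mk'
      (fun m => (QuotientAddGroup.mk (x ⊗ₜ[ℤ] m) : (X ⊗[ℤ] M) ⧸ AddSubgroup.closure _))
      fun m m' => by rw [TensorProduct.tmul_add]; rfl)
    fun x x' => by ext m; exact congrArg _ (TensorProduct.add_tmul x x' m)

theorem tmul_balanced (s : S) (x : X) (m : M) :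
    tmul ρ lam (ρ s x) m = tmul ρ lam x (lam s m) := by
  refine (QuotientAddGroup.eq_iff_sub_mem).2 (AddSubgroup.subset_closure ⟨s, x, m, rfl⟩)

/-- The map on the tensor product induced by a balanced biadditive map. -/
def lift (f : X →+ M →+ P) (hf : ∀ s x m, f (ρ s x) m = f x (lam s m)) : BalTensor ρ lam →+ P :=
  QuotientAddGroup.lift _
    (TensorProduct.liftAddHom (R := ℤ) f fun r x m => by simp) (by
      rw [AddSubgroup.closure_le]
      rintro _ ⟨s, x, m, rfl⟩
      simp [hf])

@[simp]
theorem lift_tmul (f : X →+ M →+ P) (hf : ∀ s x m, f (ρ s x) m = f x (lam s m)) (x : X) (m : M) :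
    lift f hf (tmul ρ lam x m) = f x m := rfl

@[ext]
theorem hom_ext {f g : BalTensor ρ lam →+ P}
    (h : ∀ x m, f (tmul ρ lam x m) = g (tmul ρ lam x m)) : f = g := by
  refine QuotientAddGroup.addMonoidHom_ext _ ?_
  ext t
  induction t using TensorProduct.induction_on with
  | zero => simp
  | tmul x m => exact h x m
  | add t t' ht ht' => rw [map_add, map_add, ht, ht']

end BalTensor

namespace SeminormedGrading

variable {R : Type u} [Ring R] (G : SeminormedGrading R)

/-- `N_R^n R_p`, which agrees with `N_L^{n-p} R_p`. -/
def NR (n p : ℤ) : AddSubgroup R := G.NL (n - p) p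

/-- The subring `R_0`. -/
def zeroRing : Subring R where
  __ := G.piece 0
  mul_mem' hx hy := by simpa using G.mul_mem hx hy
  one_mem' := G.one_mem

/-- The two-sided ideal `N^1 R_0` of `R_0`. -/
def zhuIdeal : Ideal G.zeroRing where
  carrier := {x | (x : R) ∈ G.NL 1 0}
  add_mem' hx hy := add_mem (S := AddSubgroup R) hx hy
  zero_mem' := zero_mem (G.NL 1 0)
  smul_mem' c x hx := by simpa using G.mul_NL c.2 hx

instance : G.zhuIdeal.IsTwoSided where
  mul_mem_of_left {x} c hx := by
    have := G.NL_mul (q := 0) (y := (c : R)) hx c.2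
    rw [sub_zero, add_zero] at this
    exact this

/-- The Zhu algebra `A = R_0 / N^1 R_0`. -/
abbrev Zhu : Type u := G.zeroRing ⧸ G.zhuIdeal

/-- `R_0 → A`. -/
def toZhu : G.zeroRing →+* G.Zhu := Ideal.Quotient.mk G.zhuIdeal

/-- `(R / N_L^1 R)_p = R_p / N_L^1 R_p`. -/
abbrev LQ (p : ℤ) : Type u := G.piece p ⧸ (G.NL 1 p).addSubgroupOf (G.piece p)

/-- `(R / N_R^1 R)_p = R_p / N_R^1 R_p`. -/
abbrev RQ (p : ℤ) : Type u := G.piece p ⧸ (G.NR 1 p).addSubgroupOf (G.piece p)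

/-- Multiplication `R_p × R_q → R_k` for `k = p + q`. -/
def mulHom {p q k : ℤ} (h : p + q = k) : G.piece p →+ G.piece q →+ G.piece k :=
  AddMonoidHom.mk' (fun x => AddMonoidHom.mk'
      (fun y => ⟨x * y, h ▸ G.mul_mem x.2 y.2⟩)
      fun y y' => Subtype.ext (mul_add (x : R) y y'))
    fun x x' => by ext y; exact add_mul (x : R) x' y

/-- Left multiplication by `u ∈ R_p` on `R / N_L^1 R`. -/
def lmulLQ {p : ℤ} (u : G.piece p) (q : ℤ) : G.LQ q →+ G.LQ (p + q) :=
  QuotientAddGroup.map _ _ (G.mulHom rfl u) fun _ hx => G.mul_NL u.2 hx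

/-- Right multiplication by `r ∈ R_0` on `(R / N_L^1 R)_q`. -/
def rmulLQ (q : ℤ) (r : G.zeroRing) : G.LQ q →+ G.LQ q :=
  QuotientAddGroup.map _ _ ((G.mulHom (add_zero q)).flip r) fun x hx => by
    have := G.NL_mul (q := 0) (y := (r : R)) hx r.2
    rw [sub_zero, add_zero] at this
    exact this

/-- Right multiplication by `u ∈ R_p` on `R / N_R^1 R`. -/
def rmulRQ {p : ℤ} (u : G.piece p) (q : ℤ) : G.RQ q →+ G.RQ (q + p) :=
  QuotientAddGroup.map _ _ ((G.mulHom rfl).flip u) fun x hx => by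
    have := G.NL_mul (q := p) (y := (u : R)) hx u.2
    rw [sub_sub] at this
    exact this

/-- Left multiplication by `r ∈ R_0` on `(R / N_R^1 R)_q`. -/
def lmulRQ (q : ℤ) (r : G.zeroRing) : G.RQ q →+ G.RQ q :=
  QuotientAddGroup.map _ _ (G.mulHom (zero_add q) r) fun x hx => by
    have := G.mul_NL (p := 0) (x := (r : R)) r.2 hx
    rw [zero_add] at this
    exact this

/-- The pairing `(R / N_R^1 R)_{-p} × (R / N_L^1 R)_p → A`, `(α, β) ↦ α ⊛ β = [α β]`. -/
def pairing (p : ℤ) : G.RQ (-p) →+ G.LQ p →+ G.Zhu :=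
  QuotientAddGroup.lift _
    (AddMonoidHom.mk' (fun α => QuotientAddGroup.lift _
        (G.toZhu.toAddMonoidHom.comp (G.mulHom (neg_add_cancel p) α) : G.piece p →+ G.Zhu)
        (by
          intro β hβ
          refine Ideal.Quotient.eq_zero_iff_mem.2 ?_
          have := G.mul_NL (p := -p) α.2 hβ
          rw [neg_add_cancel] at this
          exact this))
      fun α α' => by
        ext β
        exact congrArg G.toZhu (Subtype.ext (add_mul (α : R) α' β)))
    (by
      intro α hα
      ext β
      refine Ideal.Quotient.eq_zero_iff_mem.2 ?_
      have := G.NL_mul (q := p) hα β.2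
      rw [neg_add_cancel, sub_neg_eq_add, add_sub_cancel_right] at this
      exact this)

/-- The degree `q` piece `Φ^L(W)_q = (R / N_L^1 R)_q ⊗_{R_0} W` of the left generalized Verma module
of a left `A`-module `W`. -/
abbrev VermaL (W : Type u) [AddCommGroup W] [Module G.Zhu W] (q : ℤ) : Type u :=
  BalTensor (G.rmulLQ q) fun r => DistribSMul.toAddMonoidHom W (G.toZhu r)

/-- The degree `q` piece `Φ^R(A)_q = A ⊗_{R_0} (R / N_R^1 R)_q` of the right generalized Verma
module of `A`. -/
abbrev VermaR (q : ℤ) : Type u :=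
  BalTensor (fun r : G.zeroRing => AddMonoidHom.mulRight (G.toZhu r)) (G.lmulRQ q)

/-- Left multiplication by `a ∈ A` on `Φ^R(A)`. -/
def zhuMul (q : ℤ) (a : G.Zhu) : G.VermaR q →+ G.VermaR q :=
  BalTensor.lift ((BalTensor.tmul _ _).comp (AddMonoidHom.mulLeft a)) fun s x m => by
    show BalTensor.tmul _ _ (a * (x * G.toZhu s)) m = BalTensor.tmul _ _ (a * x) (G.lmulRQ q s m)
    rw [← mul_assoc]
    exact BalTensor.tmul_balanced s (a * x) m

/-- The left `A`-module structure of `Φ^R(A)_q`. -/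
instance (q : ℤ) : Module G.Zhu (G.VermaR q) where
  smul a t := G.zhuMul q a t
  one_smul t := by
    have : G.zhuMul q 1 = AddMonoidHom.id _ := by ext x m; simp [zhuMul]
    exact congrArg (fun f => f t) this
  mul_smul a b t := by
    have : G.zhuMul q (a * b) = (G.zhuMul q a).comp (G.zhuMul q b) := by
      ext x m; simp [zhuMul, mul_assoc]
    exact congrArg (fun f => f t) this
  smul_zero a := map_zero _
  smul_add a := map_add _
  add_smul a b t := by
    have : G.zhuMul q (a + b) = G.zhuMul q a + G.zhuMul q b := by
      ext x m; simp [zhuMul, add_mul]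
    exact congrArg (fun f => f t) this
  zero_smul t := by
    have : G.zhuMul q 0 = 0 := by ext x m; simp [zhuMul]
    exact congrArg (fun f => f t) this

theorem smul_tmul (q : ℤ) (a b : G.Zhu) (y : G.RQ q) :
    a • (BalTensor.tmul _ _ b y : G.VermaR q) = BalTensor.tmul _ _ (a * b) y := rfl

/-- The piece `𝔄_{p,q} = (R / N_L^1 R)_p ⊗_{R_0} A ⊗_{R_0} (R / N_R^1 R)_q = Φ^L(Φ^R(A)_q)_p`
of bidegree `(p, q)` of the mode transition algebra. -/
abbrev MTA (p q : ℤ) : Type u := G.VermaL (G.VermaR q) p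

section Actions

variable {W : Type u} [AddCommGroup W] [Module G.Zhu W]

/-- The left action of `u ∈ R_p` on `Φ^L(W)`, `u · (β ⊗ w) = u β ⊗ w`. In particular, this is the
left action of `R` on `𝔄 = Φ^L(Φ^R(A))`. -/
def lact {p : ℤ} (u : G.piece p) (q : ℤ) : G.VermaL W q →+ G.VermaL W (p + q) :=
  BalTensor.lift ((BalTensor.tmul _ _).comp (G.lmulLQ u q)) fun s x m => by
    have h : G.lmulLQ u q (G.rmulLQ q s x) = G.rmulLQ (p + q) s (G.lmulLQ u q x) := by
      induction x using QuotientAddGroup.induction_on with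
      | H x =>
        refine congrArg QuotientAddGroup.mk (Subtype.ext ?_)
        exact (mul_assoc (u : R) x s).symm
    rw [AddMonoidHom.comp_apply, AddMonoidHom.comp_apply, h]
    exact BalTensor.tmul_balanced s _ m

/-- The right action of `u ∈ R_p` on `Φ^R(A)`, `(a ⊗ β) · u = a ⊗ β u`. -/
def ractVermaR {p : ℤ} (u : G.piece p) (q : ℤ) : G.VermaR q →+ G.VermaR (q + p) :=
  BalTensor.lift ((BalTensor.tmul _ _).compl₂ (G.rmulRQ u q))
    fun s x m => by
      have h : G.rmulRQ u q (G.lmulRQ q s m) = G.lmulRQ (q + p) s (G.rmulRQ u q m) := by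
        induction m using QuotientAddGroup.induction_on with
        | H x =>
          refine congrArg QuotientAddGroup.mk (Subtype.ext ?_)
          exact mul_assoc (s : R) x u
      simp only [AddMonoidHom.compl₂_apply]
      rw [h]
      exact BalTensor.tmul_balanced s x _

theorem ractVermaR_smul {p : ℤ} (u : G.piece p) (q : ℤ) (a : G.Zhu) (t : G.VermaR q) :
    G.ractVermaR u q (a • t) = a • G.ractVermaR u q t := by
  have : (G.ractVermaR u q).comp (G.zhuMul q a) = (G.zhuMul (q + p) a).comp (G.ractVermaR u q) := by
    ext x m; rfl
  exact congrArg (fun f => f t) this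

/-- The right action of `u ∈ R_p` on `𝔄`, `(x ⊗ a ⊗ β) · u = x ⊗ a ⊗ β u`. -/
def ract {p : ℤ} (u : G.piece p) (n q : ℤ) : G.MTA n q →+ G.MTA n (q + p) :=
  BalTensor.lift ((BalTensor.tmul _ _).compl₂ (G.ractVermaR u q)) fun s x t => by
    simp only [AddMonoidHom.compl₂_apply, DistribSMul.toAddMonoidHom_apply, ractVermaR_smul]
    exact BalTensor.tmul_balanced s x _

/-- The map `β ⊗ w ↦ a (y ⊛ β) w`, for fixed `a` and `y`. -/
def contractAux (m : ℤ) (a : G.Zhu) (y : G.RQ (-m)) : G.VermaL W m →+ W :=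
  BalTensor.lift
    (AddMonoidHom.mk' (fun β => DistribSMul.toAddMonoidHom W (a * G.pairing m y β))
      fun β β' => by ext w; simp [mul_add, add_smul])
    fun s β w => by
      have h : G.pairing m y (G.rmulLQ m s β) = G.pairing m y β * G.toZhu s := by
        induction β using QuotientAddGroup.induction_on with
        | H β =>
          induction y using QuotientAddGroup.induction_on with
          | H y => exact congrArg G.toZhu (Subtype.ext (mul_assoc (y : R) β s).symm)
      simp [h, mul_smul]

/-- The pairing `Φ^R(A)_{-m} × Φ^L(W)_m → W`, `(a ⊗ α', β ⊗ w) ↦ a (α' ⊛ β) w`. -/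
def contract (m : ℤ) : G.VermaR (-m) →+ G.VermaL W m →+ W :=
  BalTensor.lift
    (AddMonoidHom.mk' (fun a => AddMonoidHom.mk' (fun y => G.contractAux m a y)
        fun y y' => by ext β w; simp [contractAux, mul_add, add_smul])
      fun a a' => by ext y β w; simp [contractAux, add_mul, add_smul])
    fun s a y => by
      ext β w
      have h : G.pairing m (G.lmulRQ (-m) s y) β = G.toZhu s * G.pairing m y β := by
        induction β using QuotientAddGroup.induction_on with
        | H β =>
          induction y using QuotientAddGroup.induction_on with
          | H y => exact congrArg G.toZhu (Subtype.ext (mul_assoc (s : R) y β))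
      simp [contractAux, h, mul_assoc]

theorem contract_smul (m : ℤ) (a : G.Zhu) (t : G.VermaR (-m)) (z : G.VermaL W m) :
    G.contract m (a • t) z = a • G.contract m t z := by
  have : (G.contract (W := W) m).comp (G.zhuMul (-m) a) =
      (G.contract m).compr₂ (DistribSMul.toAddMonoidHom W a) := by
    ext b y β w
    simp [contract, contractAux, zhuMul, mul_assoc, mul_smul]
  exact congrArg (fun f => f t z) this

/-- The operation `⋆ : 𝔄_{n,-m} × Φ^L(W)_m → Φ^L(W)_n`,
`(x ⊗ a ⊗ α') ⋆ (β ⊗ w) = x ⊗ a (α' ⊛ β) w`. For `W = Φ^R(A)_q` this is the multiplication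
`⋆ : 𝔄_{n,-m} × 𝔄_{m,q} → 𝔄_{n,q}` of the mode transition algebra. -/
def star {n m : ℤ} : G.MTA n (-m) →+ G.VermaL W m →+ G.VermaL W n :=
  BalTensor.lift
    (AddMonoidHom.mk' (fun x => AddMonoidHom.mk'
        (fun t => (BalTensor.tmul _ _ x).comp (G.contract m t))
        fun t t' => by ext β w; simp)
      fun x x' => by ext t; simp)
    fun s x t => by
      ext z
      simp only [AddMonoidHom.mk'_apply, AddMonoidHom.comp_apply,
        DistribSMul.toAddMonoidHom_apply, contract_smul]
      exact BalTensor.tmul_balanced s x _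

end Actions

end SeminormedGrading

namespace VertexOperatorAlgebra

variable (V : Type u) [AddCommGroup V] [Module ℂ V] [VertexOperatorAlgebra V]

/-- The grading `𝒰_p` of `𝒰`, with the neighborhoods `N_L^n 𝒰_p`, the images of `N_L^n Û_p`. -/
def univGrading : SeminormedGrading (UnivEnv V) where
  piece p := imageInUnivEnv V (hatPiece V p)
  NL n p := imageInUnivEnv V (hatNL V n p)
  NL_le n p := AddSubgroup.map_mono (AddSubgroup.comap_mono (hatNL_le n p))
  one_mem := ⟨1, one_mem_hatPiece, map_one (Ideal.Quotient.mk (relIdeal V))⟩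
  mul_mem := mul_mem_imageInUnivEnv fun _ hx _ hy => hatPiece_mul hx hy
  NL_mul := mul_mem_imageInUnivEnv fun _ hx _ hy => hatNL_mul hx hy
  mul_NL := mul_mem_imageInUnivEnv fun _ hx _ hy => mul_hatNL hx hy

theorem coe_mem_Hat (x : Env V) : (x : EnvCompl V) ∈ Hat V := by
  have hx : x ∈ ⨆ d : ℤ, envPiece V d := by rw [iSup_envPiece]; trivial
  induction hx using Submodule.iSup_induction' with
  | mem d x hx => exact AddSubgroup.mem_iSup_of_mem d (coe_mem_closureImage hx)
  | zero => exact zero_mem (Hat V)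
  | add x y _ _ hx hy => rw [UniformSpace.Completion.coe_add]; exact add_mem hx hy

/-- The canonical map `U → 𝒰`. -/
def envToUnivEnv : Env V →+* UnivEnv V :=
  (Ideal.Quotient.mk (relIdeal V)).comp
    ((UniformSpace.Completion.coeRingHom : Env V →+* EnvCompl V).codRestrict (Hat V)
      (coe_mem_Hat V))

variable {V} in
/-- The image in `𝒰_d` of an element of `𝔏(V)_d`. -/
def ofLie {d : ℤ} (x : finLiePiece V d) : (univGrading V).piece d :=
  ⟨envToUnivEnv V (envι V x), ⟨⟨(envι V x : Env V), coe_mem_Hat V (envι V x)⟩,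
    coe_mem_closureImage (envι_mem x.2), rfl⟩⟩

/-- The Zhu algebra `A = A(V)`. -/
abbrev ZhuAlgebra : Type u := (univGrading V).Zhu

/-- The piece `𝔄_{p,q}` of the mode transition algebra of `V`; it vanishes unless `p ≥ 0 ≥ q`.
The `d`-th mode transition algebra `𝔄_d` is `𝔄_{d,-d}`. -/
abbrev ModeTransition (p q : ℤ) : Type u := (univGrading V).MTA p q

/-- `Φ^L(M)_q`. -/
abbrev Verma (M : Type u) [AddCommGroup M] [Module (ZhuAlgebra V) M] (q : ℤ) : Type u :=
  (univGrading V).VermaL M q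

variable {V}

/-- The multiplication `⋆ : 𝔄_{n,-m} × 𝔄_{m,q} → 𝔄_{n,q}`. -/
def star {n m q : ℤ} (a : ModeTransition V n (-m)) (b : ModeTransition V m q) :
    ModeTransition V n q :=
  (univGrading V).star (W := (univGrading V).VermaR q) a b

/-- The homomorphism `𝔄_d → End(Φ^L(M)_d)`. -/
def starEnd (M : Type u) [AddCommGroup M] [Module (ZhuAlgebra V) M] (d : ℤ) :
    ModeTransition V d (-d) →+ AddMonoid.End (Verma V M d) :=
  (univGrading V).star

/-- `u · 𝔞` for `u ∈ 𝔏(V)_d` and `𝔞 ∈ 𝔄_{n,q}`. -/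
def lieSmul {d n q : ℤ} (x : finLiePiece V d) (a : ModeTransition V n q) :
    ModeTransition V (d + n) q :=
  (univGrading V).lact (W := (univGrading V).VermaR q) (ofLie x) n a

/-- `𝔞 · u` for `u ∈ 𝔏(V)_d` and `𝔞 ∈ 𝔄_{n,q}`. -/
def smulLie {d n q : ℤ} (a : ModeTransition V n q) (x : finLiePiece V d) :
    ModeTransition V n (q + d) :=
  (univGrading V).ract (ofLie x) n q a

/-- `e` is a (two-sided) unity of the ring `𝔄_d = 𝔄_{d,-d}`. -/
def IsUnity {d : ℤ} (e : ModeTransition V d (-d)) : Prop :=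
  ∀ a : ModeTransition V d (-d), star e a = a ∧ star a e = a

end VertexOperatorAlgebra

end

/-! Everything except the right-hand identity in 3 → 2 is formal. The operation ⋆ is natural in the
`A`-module `W` (`star_mapVerma`), and every `w ∈ W` is the image of `1` under `A → W`; so an element
acting as the identity on `Φ^L(A)` does so on every `Φ^L(W)`, in particular on `𝔄_{n,-m} =
Φ^L(Φ^R(A)_{-m})_n`. Conversely `A` is a retract of `Φ^R(A)_0`. Injectivity in 4 comes from the
right unity, and 1 ↔ 2 from the compatibility of ⋆ with both actions together with `1_[-1] = 1`.

The hard point is that `I_m` is also a right identity on `Φ^R(A)_{-m}`. If it is not, some `x ∈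
𝒰_{-m}` outside `N_R^1` satisfies `x 𝒰_m ⊆ N_L^1 𝒰_0` (`contract_eq_self`). This is refuted in
`Orth.mem_NR`, with all congruences taken modulo `N_R^1`:

(a) Because `𝔄_n` has a right unity, `𝒰_{-n} 𝒰_n` kills every such element of degree `-n`
(`mul_mul_mem_NR`).

(b) Applied to `[L_m, L_{-m}]`, this makes `x` an eigenvector of `L_0`. For `k > m` the element `x
L_k` is again orthogonal, and `x L_k L_{-k}` is a known multiple of `x`; so `𝒰_{-m-k} 𝒰_{m+k}` kills
`x` whenever that multiple is nonzero. Comparing the resulting eigenvalues of `L_0` gives central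
charge `0` (`centralCharge_eq_zero`), and then `𝒰_{-n} 𝒰_n` kills `x` for all `n > 2m`.

(c) The commutators of `L_n` with modes of `a`, for two consecutive large `n`, show that all zero
modes of positive weight kill `x` (`zero_mode_mul_mem`). They kill the vacuum as well, so each `r ∈
𝒰_0` acts on `x` and on the vacuum by one and the same scalar (`sameScalar_piece_zero`).

(d) Hence `𝒰_{-n} 𝒰_n` kills the vacuum for `n = 2m + 1`. As `I_n` acts as the identity on
`Φ^L(A)_n`, every `p ∈ 𝒰_n` is a sum of elements of `𝒰_n 𝒰_{-n} p` modulo `N_L^1`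
(`mk_mem_closure`), so `𝒰_n` kills the vacuum. Then `L_{-n} 1 = 0`, whence `ω = 0` and `L_0 = 0`,
contradicting `[L_0, x] = -m x`.

Steps (c) and (d) need the action of `𝒰` on `V`, hence the full Borcherds identity. It is derived
from weak commutativity and translation by Dong's lemma and Goddard's uniqueness argument
(`borcherds_identity`). -/

noncomputable section

/-! ## Functions of three integer variables and their shifts -/

namespace TriShift

variable {V : Type u} [AddCommGroup V] [Module ℂ V]

/-- Shift of the first variable. -/
def sh1 : Module.End ℂ (ℤ → ℤ → ℤ → V) where
  toFun f := fun m n p => f (m + 1) n p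
  map_add' _ _ := rfl
  map_smul' _ _ := rfl

/-- Shift of the second variable. -/
def sh2 : Module.End ℂ (ℤ → ℤ → ℤ → V) where
  toFun f := fun m n p => f m (n + 1) p
  map_add' _ _ := rfl
  map_smul' _ _ := rfl

/-- Shift of the third variable. -/
def sh3 : Module.End ℂ (ℤ → ℤ → ℤ → V) where
  toFun f := fun m n p => f m n (p + 1)
  map_add' _ _ := rfl
  map_smul' _ _ := rfl

/-- Exchange of the first two variables. -/
def swap : Module.End ℂ (ℤ → ℤ → ℤ → V) where
  toFun f := fun m n p => f n m p
  map_add' _ _ := rfl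
  map_smul' _ _ := rfl

/-- Multiplication by `z₁ - z₂`. -/
def d12 : Module.End ℂ (ℤ → ℤ → ℤ → V) := sh1 - sh2

/-- Multiplication by `z₁ - z₃`. -/
def d13 : Module.End ℂ (ℤ → ℤ → ℤ → V) := sh1 - sh3

/-- Multiplication by `z₂ - z₃`. -/
def d23 : Module.End ℂ (ℤ → ℤ → ℤ → V) := sh2 - sh3

theorem commute_d13_d23 : Commute (d13 (V := V)) d23 := by
  have h12 : Commute (sh1 (V := V)) sh2 := rfl
  have h13 : Commute (sh1 (V := V)) sh3 := rfl
  have h23 : Commute (sh2 (V := V)) sh3 := rfl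
  exact (h12.sub_right h13).sub_left (h23.symm.sub_right (Commute.refl _))

theorem commute_d13_d12 : Commute (d13 (V := V)) d12 := by
  have h12 : Commute (sh1 (V := V)) sh2 := rfl
  have h13 : Commute (sh1 (V := V)) sh3 := rfl
  have h23 : Commute (sh2 (V := V)) sh3 := rfl
  exact ((Commute.refl _).sub_right h12).sub_left (h13.symm.sub_right h23.symm)

theorem commute_d23_d12 : Commute (d23 (V := V)) d12 := by
  have h12 : Commute (sh1 (V := V)) sh2 := rfl
  have h13 : Commute (sh1 (V := V)) sh3 := rfl
  have h23 : Commute (sh2 (V := V)) sh3 := rfl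
  exact (h12.symm.sub_right (Commute.refl _)).sub_left (h13.symm.sub_right h23.symm)

/-- The function vanishes for large values of the second variable, uniformly in the first. -/
def Trunc (f : ℤ → ℤ → ℤ → V) : Prop := ∀ p, ∃ n₀ : ℤ, ∀ m n, n₀ ≤ n → f m n p = 0

theorem Trunc.sub {V : Type u} [AddCommGroup V] {f g : ℤ → ℤ → ℤ → V} (hf : Trunc f) (hg : Trunc g) : Trunc (f - g) := by
  intro p
  obtain ⟨a, ha⟩ := hf p
  obtain ⟨b, hb⟩ := hg p
  refine ⟨max a b, fun m n h => ?_⟩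
  simp [ha m n (le_trans (le_max_left _ _) h), hb m n (le_trans (le_max_right _ _) h)]

theorem Trunc.sh1 {f : ℤ → ℤ → ℤ → V} (hf : Trunc f) : Trunc (TriShift.sh1 f) := fun p => by
  obtain ⟨a, ha⟩ := hf p
  exact ⟨a, fun m n h => ha _ _ h⟩

theorem Trunc.sh2 {f : ℤ → ℤ → ℤ → V} (hf : Trunc f) : Trunc (TriShift.sh2 f) := fun p => by
  obtain ⟨a, ha⟩ := hf p
  exact ⟨a, fun m n h => ha _ _ (by lia)⟩

theorem Trunc.sh3 {f : ℤ → ℤ → ℤ → V} (hf : Trunc f) : Trunc (TriShift.sh3 f) := fun p => by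
  obtain ⟨a, ha⟩ := hf (p + 1)
  exact ⟨a, fun m n h => ha _ _ h⟩

/-! ### Expansion of powers of `z₁ - z₂` and its compatibility with shifts -/

/-- The coefficients of `(z - w)^l f(z, w)`, expanded for `|z| > |w|`. -/
def conv (l : ℤ) (f : ℤ → ℤ → ℤ → V) : ℤ → ℤ → ℤ → V := fun m n p =>
  ∑ᶠ i : ℕ, ((-1 : ℂ) ^ i * Ring.choose (l : ℂ) i) • f (m + l - i) (n + i) p

theorem conv_eq_sum (l : ℤ) {f : ℤ → ℤ → ℤ → V} {p n₀ : ℤ} (h : ∀ m n, n₀ ≤ n → f m n p = 0)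
    (m n : ℤ) (K : ℕ) (hK : n₀ ≤ n + K) :
    conv l f m n p = ∑ i ∈ Finset.range K,
      ((-1 : ℂ) ^ i * Ring.choose (l : ℂ) i) • f (m + l - i) (n + i) p := by
  refine finsum_eq_sum_of_support_subset _ fun i hi => ?_
  rw [Finset.coe_range, Set.mem_Iio]
  by_contra! hlt
  exact hi (by simp only [h _ _ (show n₀ ≤ n + (i : ℤ) by lia), smul_zero])

theorem conv_sub (l : ℤ) {f g : ℤ → ℤ → ℤ → V} (hf : Trunc f) (hg : Trunc g) :
    conv l (f - g) = conv l f - conv l g := by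
  funext m n p
  obtain ⟨a, ha⟩ := hf p
  obtain ⟨b, hb⟩ := hg p
  have ha' : ∀ m n, max a b ≤ n → f m n p = 0 := fun m n h => ha m n (by lia)
  have hb' : ∀ m n, max a b ≤ n → g m n p = 0 := fun m n h => hb m n (by lia)
  have hK : max a b ≤ n + ((max a b - n).toNat : ℤ) := by lia
  simp only [Pi.sub_apply]
  rw [conv_eq_sum l ha' m n _ hK, conv_eq_sum l hb' m n _ hK,
    conv_eq_sum l (f := f - g) (n₀ := max a b) (fun m n h => by simp [ha' m n h, hb' m n h])
      m n _ hK, ← Finset.sum_sub_distrib]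
  exact Finset.sum_congr rfl fun i _ => by simp [smul_sub]

theorem conv_zero (f : ℤ → ℤ → ℤ → V) : conv 0 f = f := by
  funext m n p
  rw [conv, finsum_eq_single _ 0]
  · simp
  · intro i hi
    obtain ⟨j, rfl⟩ := Nat.exists_eq_succ_of_ne_zero hi
    rw [Int.cast_zero, Nat.succ_eq_add_one, Ring.choose_zero_succ, mul_zero, zero_smul]

/-- Pascal's rule for the binomial series. Truncation makes the `finsum` a genuine finite sum;
without it the value could be the junk value `0`. -/
theorem conv_add_one (l : ℤ) {f : ℤ → ℤ → ℤ → V} (hf : Trunc f) :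
    conv (l + 1) f = d12 (conv l f) := by
  funext m n p
  obtain ⟨a, ha⟩ := hf p
  set K := (a - n).toNat with hK
  have hcomm : ∀ x y z : V, x + y - z = x - z + y := fun x y z => add_sub_right_comm x y z
  show conv (l + 1) f m n p = conv l f (m + 1) n p - conv l f m (n + 1) p
  -- The third sum starts at `n + 1` and is one term shorter: once `i = 0` is split off from the
  -- other two, all three ranges agree.
  rw [conv_eq_sum (l + 1) ha m n (K + 1) (by lia), conv_eq_sum l ha (m + 1) n (K + 1) (by lia),
    conv_eq_sum l ha m (n + 1) K (by lia), Finset.sum_range_succ', Finset.sum_range_succ' _ K,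
    hcomm, ← Finset.sum_sub_distrib]
  congr 1
  · refine Finset.sum_congr rfl fun i _ => ?_
    rw [show m + (l + 1) - ((i + 1 : ℕ) : ℤ) = m + l - i by push_cast; ring,
      show m + 1 + l - ((i + 1 : ℕ) : ℤ) = m + l - i by push_cast; ring,
      show n + ((i + 1 : ℕ) : ℤ) = n + 1 + i by push_cast; ring, ← sub_smul, Int.cast_add,
      Int.cast_one, Ring.choose_succ_succ]
    congr 1
    ring
  · simp only [Ring.choose_zero_right]
    rw [show m + (l + 1) = m + 1 + l by ring]

/-- Multiplication by `z₁ - z₃` and `z₂ - z₃` is built from shifts, which commute with the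
expansion. Truncation is carried through the induction because additivity of `conv` depends on it.
-/
theorem conv_shift_pow (l : ℤ) {f : ℤ → ℤ → ℤ → V} (hf : Trunc f) (s t : ℕ) :
    Trunc ((d13 ^ s) ((d23 ^ t) f)) ∧
    conv l ((d13 ^ s) ((d23 ^ t) f)) =
      (d13 ^ s) ((d23 ^ t) (conv l f)) := by
  induction s with
  | zero =>
    induction t with
    | zero => exact ⟨hf, rfl⟩
    | succ t ih =>
      simp only [pow_zero, Module.End.one_apply] at ih ⊢
      rw [pow_succ', Module.End.mul_apply, Module.End.mul_apply]
      refine ⟨ih.1.sh2.sub ih.1.sh3, ?_⟩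
      rw [← ih.2]
      nth_rw 1 [d23]
      nth_rw 2 [d23]
      rw [LinearMap.sub_apply, conv_sub l ih.1.sh2 ih.1.sh3, LinearMap.sub_apply]
      congr 1
      funext m n p
      refine finsum_congr fun i => ?_
      rw [show n + 1 + (i : ℤ) = n + i + 1 by ring]
      rfl
  | succ s ih =>
    rw [pow_succ', Module.End.mul_apply, Module.End.mul_apply]
    refine ⟨ih.1.sh1.sub ih.1.sh3, ?_⟩
    rw [← ih.2]
    nth_rw 1 [d13]
    nth_rw 2 [d13]
    rw [LinearMap.sub_apply, conv_sub l ih.1.sh1 ih.1.sh3, LinearMap.sub_apply]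
    congr 1
    funext m n p
    refine finsum_congr fun i => ?_
    rw [show m + 1 + l - (i : ℤ) = m + l - i + 1 by ring]
    rfl

theorem swap_pow (s t : ℕ) (f : ℤ → ℤ → ℤ → V) :
    swap ((d13 ^ s) ((d23 ^ t) f)) =
      (d23 ^ s) ((d13 ^ t) (swap f)) := by
  have h1 : swap * d13 = d23 * swap (V := V) := rfl
  have h2 : swap * d23 = d13 * swap (V := V) := rfl
  have h1' : SemiconjBy (swap (V := V)) d13 d23 := h1
  have h2' : SemiconjBy (swap (V := V)) d23 d13 := h2
  have := ((h1'.pow_right s).mul_right (h2'.pow_right t)).eq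
  exact congrArg (fun T => T f) this

theorem commute_pow (s t : ℕ) (f : ℤ → ℤ → ℤ → V) :
    (d23 ^ s) ((d13 ^ t) f) = (d13 ^ t) ((d23 ^ s) f) := by
  have h : Commute (d23 (V := V)) d13 := commute_d13_d23.symm
  exact congrArg (fun T => T f) (h.pow_pow s t).eq

/-- If `f` is killed by `(z₁ - z₃)^s (z₂ - z₃)^t` and by `(z₁ - z₂)^k`, then it is killed by a
power of `z₂ - z₃`. -/
theorem pow_kill {s t k : ℕ} {f : ℤ → ℤ → ℤ → V}
    (h1 : (d13 ^ s) ((d23 ^ t) f) = 0) (h2 : (d12 ^ k) f = 0) :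
    (d23 ^ (s + k + t)) f = 0 := by
  have hc : Commute (d13 (V := V)) (-d12) :=
    Commute.neg_right (commute_d13_d12 (V := V))
  have hd : Commute (d13 (V := V)) d12 := commute_d13_d12
  have he : Commute (d23 (V := V)) d12 := commute_d23_d12
  -- Expand `(z₂ - z₃)^(s+k)` by `z₂ - z₃ = (z₁ - z₃) - (z₁ - z₂)`. A term with at least `s` factors
  -- `z₁ - z₃` dies by `h1`, completed by the reserved `(z₂ - z₃)^t`; every other term contains `(z₁
  -- - z₂)^k`.
  have hsum : (d23 (V := V)) = d13 + -d12 := by unfold d12 d13 d23; abel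
  rw [pow_add, Module.End.mul_apply]
  conv_lhs => enter [1]; rw [hsum, hc.add_pow]
  rw [LinearMap.sum_apply]
  refine Finset.sum_eq_zero fun j hj => ?_
  rw [Finset.mem_range] at hj
  rw [(Nat.cast_commute _ _).eq.symm, Module.End.mul_apply]
  suffices h : (d13 ^ j * (-d12) ^ (s + k - j) : Module.End ℂ (ℤ → ℤ → ℤ → V)) ((d23 ^ t) f) = 0 by
    rw [h, map_zero]
  by_cases hjs : s ≤ j
  · rw [((hc.pow_pow j (s + k - j))).eq, Module.End.mul_apply, ← Nat.sub_add_cancel hjs, pow_add,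
      Module.End.mul_apply, h1, map_zero, map_zero]
  · have h3 : (d12 ^ (s + k - j)) ((d23 ^ t) f) = 0 := by
      have := congrArg (fun T => T f) (he.pow_pow t (s + k - j)).eq
      simp only [Module.End.mul_apply] at this
      rw [← this, show s + k - j = (s - j) + k by lia, pow_add, Module.End.mul_apply, h2, map_zero,
        map_zero]
    rw [Module.End.mul_apply, neg_pow (d12 (V := V)), Module.End.mul_apply, h3, map_zero, map_zero]

/-- The coefficient of `(z₂ - z₃)^M f` at `z₃^0` if `f` has no negative powers of `z₃`. -/
theorem pow_apply_neg_one {f : ℤ → ℤ → ℤ → V} (hf : ∀ m n p, 0 ≤ p → f m n p = 0) (M : ℕ) :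
    (∀ m n, (d23 ^ M) f m n (-1) = f m (n + M) (-1)) ∧
      ∀ m n p, 0 ≤ p → (d23 ^ M) f m n p = 0 := by
  induction M with
  | zero => exact ⟨fun m n => by simp, hf⟩
  | succ M ih =>
    simp only [pow_succ', Module.End.mul_apply]
    refine ⟨fun m n => ?_, fun m n p hp => ?_⟩
    · show (d23 ^ M) f m (n + 1) (-1) - (d23 ^ M) f m n (-1 + 1) = _
      rw [ih.1, ih.2 _ _ _ (by lia), sub_zero]
      congr 1
      push_cast
      ring
    · show (d23 ^ M) f m (n + 1) p - (d23 ^ M) f m n (p + 1) = _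
      rw [ih.2 _ _ _ hp, ih.2 _ _ _ (by lia), sub_zero]

theorem pow12_apply (N : ℕ) (f : ℤ → ℤ → ℤ → V) (m n p : ℤ) :
    (d12 ^ N) f m n p = ∑ j ∈ Finset.range (N + 1),
      ((-1 : ℂ) ^ j * (N.choose j : ℂ)) • f (m + N - j) (n + j) p := by
  induction N generalizing m n with
  | zero => simp
  | succ N ih =>
    rw [pow_succ', Module.End.mul_apply]
    show (d12 ^ N) f (m + 1) n p - (d12 ^ N) f m (n + 1) p = _
    have hx : ∀ m n, ∑ j ∈ Finset.range (N + 1),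
        ((-1 : ℂ) ^ j * (N.choose j : ℂ)) • f (m + N - j) (n + j) p =
        ∑ j ∈ Finset.range (N + 2),
        ((-1 : ℂ) ^ j * (N.choose j : ℂ)) • f (m + N - j) (n + j) p := by
      intro m n
      rw [Finset.sum_range_succ _ (N + 1), Nat.choose_succ_self, Nat.cast_zero, mul_zero, zero_smul,
        add_zero]
    rw [ih, ih, hx (m + 1), Finset.sum_range_succ' _ (N + 1), Finset.sum_range_succ' _ (N + 1),
      add_sub_right_comm, ← Finset.sum_sub_distrib]
    congr 1
    · refine Finset.sum_congr rfl fun i _ => ?_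
      rw [show m + ((N + 1 : ℕ) : ℤ) - ((i + 1 : ℕ) : ℤ) = m + N - i by push_cast; ring,
        show m + 1 + (N : ℤ) - ((i + 1 : ℕ) : ℤ) = m + N - i by push_cast; ring,
        show n + ((i + 1 : ℕ) : ℤ) = n + 1 + i by push_cast; ring, ← sub_smul,
        Nat.choose_succ_succ]
      congr 1
      push_cast
      ring
    · simp only [Nat.choose_zero_right]
      rw [show m + ((N + 1 : ℕ) : ℤ) = m + 1 + N by push_cast; ring]

theorem pow13_apply (N : ℕ) (f : ℤ → ℤ → ℤ → V) (m n p : ℤ) :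
    (d13 ^ N) f m n p = ∑ j ∈ Finset.range (N + 1),
      ((-1 : ℂ) ^ j * (N.choose j : ℂ)) • f (m + N - j) n (p + j) := by
  let τ : Module.End ℂ (ℤ → ℤ → ℤ → V) :=
    { toFun := fun f m n p => f m p n, map_add' := fun _ _ => rfl, map_smul' := fun _ _ => rfl }
  have h : SemiconjBy τ d13 d12 := rfl
  have := congrArg (fun T => T f m p n) (h.pow_right N).eq
  exact this.trans (pow12_apply N _ m p n)

theorem pow23_apply (N : ℕ) (f : ℤ → ℤ → ℤ → V) (m n p : ℤ) :
    (d23 ^ N) f m n p = ∑ j ∈ Finset.range (N + 1),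
      ((-1 : ℂ) ^ j * (N.choose j : ℂ)) • f m (n + N - j) (p + j) := by
  have h : SemiconjBy (swap (V := V)) d23 d13 := rfl
  have := congrArg (fun T => T f n m p) (h.pow_right N).eq
  exact this.trans (pow13_apply N _ n m p)

end TriShift

namespace VertexOperatorAlgebra

open TriShift

variable {V : Type u} [AddCommGroup V] [Module ℂ V] [VertexOperatorAlgebra V]

/-! ## The Borcherds identity for `V` -/

theorem mode_truncated (a b : V) : ∃ n₀ : ℤ, ∀ n, n₀ ≤ n → mode a n b = 0 := by
  refine ⟨-HahnSeries.order ((HahnModule.of ℂ).symm (Y a b)), fun n hn => ?_⟩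
  exact VertexOperator.ncoeff_eq_zero_of_lt_order (Y a) n b (by lia)

theorem mode_add (a b : V) (n : ℤ) : mode (a + b) n = mode a n + mode b n := by
  simp [mode]

theorem mode_smul (c : ℂ) (a : V) (n : ℤ) : mode (c • a) n = c • mode a n := by
  simp [mode]

theorem mode_zero (n : ℤ) : mode (0 : V) n = 0 := by
  simp [mode]

theorem mode_Lneg (a : V) (n : ℤ) : mode (Lneg a) n = (-(n : ℂ)) • mode a (n - 1) :=
  translation a n

theorem mode_vac_nonneg (a : V) {n : ℤ} (hn : 0 ≤ n) : mode a n (vac : V) = 0 :=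
  mode_nonneg_vac a n hn

theorem mode_vac_neg_one (a : V) : mode a (-1) (vac : V) = a := mode_neg_one_vac a

theorem Lneg_vac : Lneg (vac : V) = 0 := mode_vac_nonneg _ le_rfl

/-- The function `a_(m) b_(n) w_p` of `m`, `n`, `p`. -/
def modeMode (a b : V) (w : ℤ → V) : ℤ → ℤ → ℤ → V := fun m n p => mode a m (mode b n (w p))

theorem trunc_modeMode (a b : V) (w : ℤ → V) : Trunc (modeMode a b w) := fun p => by
  obtain ⟨n₀, h⟩ := mode_truncated b (w p)
  exact ⟨n₀, fun m n hn => by rw [modeMode, h n hn, map_zero]⟩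

/-- The left hand side of the Borcherds identity, applied to `w_p`. -/
def borcherds (a b : V) (l : ℤ) (w : ℤ → V) : ℤ → ℤ → ℤ → V :=
  conv l (modeMode a b w) - ((-1 : ℂ) ^ l) • swap (conv l (modeMode b a w))

/-- Exchanging the variables turns `z₁ - z₂` into its negative; the factor `(-1)^l` absorbs this
sign. -/
theorem borcherds_add_one (a b : V) (l : ℤ) (w : ℤ → V) :
    borcherds a b (l + 1) w = d12 (borcherds a b l w) := by
  have h : ∀ f : ℤ → ℤ → ℤ → V, swap (d12 f) = -d12 (swap f) := fun f => by
    funext m n p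
    exact (neg_sub _ _).symm
  rw [borcherds, borcherds, conv_add_one l (trunc_modeMode a b w),
    conv_add_one l (trunc_modeMode b a w), map_sub, map_smul, h,
    zpow_add_one₀ (neg_ne_zero.2 one_ne_zero), mul_neg_one, neg_smul_neg]

theorem borcherds_natCast (a b : V) (N : ℕ) (w : ℤ → V) :
    borcherds a b N w = (d12 ^ N) (modeMode a b w - swap (modeMode b a w)) := by
  induction N with
  | zero => simp [borcherds, conv_zero]
  | succ N ih => rw [Nat.cast_succ, borcherds_add_one, ih, pow_succ', Module.End.mul_apply]

/-- Weak commutativity is the case `l = N`, and larger `l` only multiplies by further powers of `z₁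
- z₂`. The bound does not depend on `w`, so it serves both a constant vector and the family `c_(p)
v`. -/
theorem exists_borcherds_eq_zero (a b : V) :
    ∃ N : ℕ, ∀ (l : ℤ) (w : ℤ → V), (N : ℤ) ≤ l → borcherds a b l w = 0 := by
  obtain ⟨N, hN⟩ := weak_commutativity a b
  refine ⟨N, fun l w hl => ?_⟩
  induction l, hl using Int.leInduction with
  | base =>
    rw [borcherds_natCast]
    funext m n p
    rw [pow12_apply]
    have := congrArg (fun T : Module.End ℂ V => T (w p)) (hN m n)
    simp only [LinearMap.sum_apply, Ring.lie_def] at this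
    exact this
  | succ l _ ih => rw [borcherds_add_one, ih, map_zero]

theorem modeMode_comm_pow (a c : V) : ∃ N : ℕ, ∀ w : V, ∀ m n : ℤ,
    ∑ j ∈ Finset.range (N + 1), ((-1 : ℂ) ^ j * (N.choose j : ℂ)) •
      (mode a (m + N - j) (mode c (n + j) w) - mode c (n + j) (mode a (m + N - j) w)) = 0 := by
  obtain ⟨N, hN⟩ := weak_commutativity a c
  refine ⟨N, fun w m n => ?_⟩
  have := congrArg (fun T : Module.End ℂ V => T w) (hN m n)
  simp only [LinearMap.sum_apply, Ring.lie_def] at this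
  exact this

/-- The commutator of `a_(m) b_(n)` with `c_(p)` is killed by a power of `z₁ - z₃` times a power of
`z₂ - z₃`. -/
theorem exists_pow_commutator (a b c : V) : ∃ s t : ℕ, ∀ v : V,
    (d13 ^ s) ((d23 ^ t) (modeMode a b (fun p => mode c p v) -
      fun m n p => mode c p (mode a m (mode b n v)))) = 0 := by
  obtain ⟨s, hs⟩ := modeMode_comm_pow a c
  obtain ⟨t, ht⟩ := modeMode_comm_pow b c
  refine ⟨s, t, fun v => ?_⟩
  -- `[ab, c] = a[b, c] + [a, c]b`: the first summand is killed by `(z₂ - z₃)^t`, the second by `(z₁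
  -- - z₃)^s`.
  have hsplit : (modeMode a b (fun p => mode c p v) - fun m n p => mode c p (mode a m (mode b n v)))
      = (fun m n p => mode a m (mode b n (mode c p v) - mode c p (mode b n v))) +
        fun m n p => mode a m (mode c p (mode b n v)) - mode c p (mode a m (mode b n v)) := by
    funext m n p
    simp [modeMode]
  have h1 : (d23 ^ t) (fun m n p => mode a m (mode b n (mode c p v) - mode c p (mode b n v))) =
      0 := by
    funext m n p
    rw [pow23_apply]
    simp only [← map_smul]
    rw [← map_sum, ht v n p, map_zero]
    rfl
  have h2 : (d13 ^ s) (fun m n p => mode a m (mode c p (mode b n v)) -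
      mode c p (mode a m (mode b n v))) = 0 := by
    funext m n p
    rw [pow13_apply]
    exact hs (mode b n v) m p
  rw [hsplit, map_add, map_add, h1, map_zero, zero_add, ← commute_pow, h2, map_zero]

/-- Dong's lemma: the left hand side of the Borcherds identity is local with every field. -/
theorem exists_pow_borcherds (a b c : V) (l : ℤ) : ∃ M : ℕ, ∀ v : V,
    (d23 ^ M) (borcherds a b l (fun p => mode c p v) -
      fun m n p => mode c p (borcherds a b l (fun _ => v) m n 0)) = 0 := by
  obtain ⟨s, t, hst⟩ := exists_pow_commutator a b c
  obtain ⟨s', t', hst'⟩ := exists_pow_commutator b a c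
  obtain ⟨N, hN⟩ := exists_borcherds_eq_zero a b
  -- These are the exponents of `pow_kill`: `s + t'` for `z₁ - z₃` and `t + s'` for `z₂ - z₃`, the
  -- primed ones crossing over because the second product enters with its variables exchanged. The
  -- factor `(z₁ - z₂)^(N-l)` raises `l` to at least `N`.
  refine ⟨(s + t') + (N - l).toNat + (t + s'), fun v => ?_⟩
  set f : ℤ → ℤ → ℤ → V := borcherds a b l (fun p => mode c p v) -
      fun m n p => mode c p (borcherds a b l (fun _ => v) m n 0) with hf
  have htr : ∀ a b : V, Trunc (fun m n p => mode c p (mode a m (mode b n v))) := fun a b p => by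
    obtain ⟨n₀, h⟩ := mode_truncated b v
    exact ⟨n₀, fun m n hn => by simp only [h n hn, map_zero]⟩
  have hconv : ∀ a b : V, (fun m n p => mode c p (conv l (modeMode a b (fun _ => v)) m n 0)) =
      conv l (fun m n p => mode c p (mode a m (mode b n v))) := fun a b => by
    obtain ⟨n₀, h⟩ := mode_truncated b v
    funext m n p
    rw [conv_eq_sum l (n₀ := n₀) (fun m n hn => by rw [modeMode, h n hn, map_zero]) m n
      (n₀ - n).toNat (by lia), conv_eq_sum l (n₀ := n₀) (fun m n hn => by
        simp only [h n hn, map_zero]) m n (n₀ - n).toNat (by lia), map_sum]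
    exact Finset.sum_congr rfl fun i _ => by rw [map_smul]; rfl
  have hf' : f = conv l (modeMode a b (fun p => mode c p v) -
        fun m n p => mode c p (mode a m (mode b n v))) -
      ((-1 : ℂ) ^ l) • swap (conv l (modeMode b a (fun p => mode c p v) -
        fun m n p => mode c p (mode b m (mode a n v)))) := by
    rw [conv_sub l (trunc_modeMode _ _ _) (htr _ _), conv_sub l (trunc_modeMode _ _ _) (htr _ _),
      ← hconv, ← hconv, hf]
    funext m n p
    simp only [borcherds, Pi.sub_apply, Pi.smul_apply, map_sub, map_smul]
    simp only [swap, LinearMap.coe_mk, AddHom.coe_mk, smul_sub]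
    abel
  have hA : (d13 ^ s) ((d23 ^ t) (conv l (modeMode a b (fun p => mode c p v) -
        fun m n p => mode c p (mode a m (mode b n v))))) = 0 := by
    rw [← (conv_shift_pow l ((trunc_modeMode _ _ _).sub (htr _ _)) s t).2, hst]
    funext m n p
    simp [conv]
  have hB : (d13 ^ t') ((d23 ^ s') (swap (conv l (modeMode b a (fun p => mode c p v) -
        fun m n p => mode c p (mode b m (mode a n v)))))) = 0 := by
    rw [← commute_pow, ← swap_pow,
      ← (conv_shift_pow l ((trunc_modeMode _ _ _).sub (htr _ _)) s' t').2, hst']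
    have : conv l (0 : ℤ → ℤ → ℤ → V) = 0 := by
      funext m n p
      simp [conv]
    rw [this, map_zero]
  refine pow_kill ?_ ?_
  · rw [hf', map_sub, map_sub, map_smul, map_smul]
    have e1 : ∀ g : ℤ → ℤ → ℤ → V, (d13 ^ (s + t')) ((d23 ^ (t + s')) g) =
        (d13 ^ t') ((d23 ^ s') ((d13 ^ s) ((d23 ^ t) g))) := fun g => by
      rw [commute_pow, ← Module.End.mul_apply, ← Module.End.mul_apply, ← Module.End.mul_apply,
        ← Module.End.mul_apply, ← pow_add, mul_assoc, ← pow_add, add_comm t',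
        add_comm s']
    have e2 : ∀ g : ℤ → ℤ → ℤ → V, (d13 ^ (s + t')) ((d23 ^ (t + s')) g) =
        (d13 ^ s) ((d23 ^ t) ((d13 ^ t') ((d23 ^ s') g))) := fun g => by
      rw [commute_pow, ← Module.End.mul_apply, ← Module.End.mul_apply, ← Module.End.mul_apply,
        ← Module.End.mul_apply, ← pow_add, mul_assoc, ← pow_add]
    rw [e1, hA, e2, hB]
    simp
  · have hl : ∀ (k : ℕ) (w : ℤ → V), (d12 ^ k) (borcherds a b l w) = borcherds a b (l + k) w := by
      intro k w
      induction k with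
      | zero => simp
      | succ k ih =>
        rw [pow_succ', Module.End.mul_apply, ih, Nat.cast_succ, ← add_assoc, borcherds_add_one]
    have hk : (N : ℤ) ≤ l + ((N - l).toNat : ℤ) := by lia
    let T : (ℤ → ℤ → ℤ → V) →ₗ[ℂ] (ℤ → ℤ → ℤ → V) :=
      { toFun := fun g m n p => mode c p (g m n 0)
        map_add' := fun g h => by funext m n p; simp
        map_smul' := fun r h => by funext m n p; simp }
    have hT : SemiconjBy T d12 d12 := by
      refine LinearMap.ext fun g => ?_
      funext m n p
      exact map_sub (mode c p) _ _
    have hT' := congrArg (fun S => S (borcherds a b l fun _ => v)) (hT.pow_right (N - l).toNat).eq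
    have : f = borcherds a b l (fun p => mode c p v) - T (borcherds a b l fun _ => v) := rfl
    rw [this, map_sub, hl, hN _ _ hk, zero_sub, neg_eq_zero]
    refine hT'.symm.trans ?_
    show T ((d12 ^ (N - l).toNat) (borcherds a b l fun _ => v)) = 0
    rw [hl, hN _ _ hk, map_zero]

/-- The field `n ↦ B(l, 0, n) - (a_(l) b)_(n)`, which vanishes by the Borcherds identity. -/
def defect (a b : V) (l n : ℤ) (v : V) : V :=
  borcherds a b l (fun _ => v) 0 n 0 - mode (mode a l b) n v

/-- Goddard's uniqueness argument. -/
theorem defect_eq_zero {a b : V} {l : ℤ} (h : ∀ n, defect a b l n (vac : V) = 0) (n : ℤ) (v : V) :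
    defect a b l n v = 0 := by
  obtain ⟨M, hM⟩ := exists_pow_borcherds a b v l
  obtain ⟨N, hN⟩ := modeMode_comm_pow (mode a l b) v
  set f : ℤ → ℤ → ℤ → V := fun m n p =>
    borcherds a b l (fun p => mode v p (vac : V)) m n p -
      mode v p (borcherds a b l (fun _ => (vac : V)) m n 0) with hf
  set g : ℤ → ℤ → ℤ → V := fun _ n p => mode (mode a l b) n (mode v p (vac : V)) -
      mode v p (mode (mode a l b) n (vac : V)) with hg
  have hfM : (d23 ^ M) f = 0 := hM vac
  have hgN : (d23 ^ N) g = 0 := by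
    funext m n p
    rw [pow23_apply]
    exact hN vac n p
  have hφ : (d23 ^ (M + N)) (f - g) = 0 := by
    rw [map_sub]
    conv_lhs => enter [1]; rw [add_comm]
    rw [pow_add, pow_add, Module.End.mul_apply, Module.End.mul_apply, hfM, hgN]
    simp
  -- At `m = 0` the terms with `v_(p)` on the left cancel because the defect vanishes on the vacuum;
  -- what remains is the defect evaluated on `v_(p) 1`.
  have hval : ∀ n p, (f - g) 0 n p = defect a b l n (mode v p (vac : V)) := by
    intro n p
    have h0 := h n
    rw [defect, sub_eq_zero] at h0
    show (borcherds a b l (fun p => mode v p (vac : V)) 0 n p -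
      mode v p (borcherds a b l (fun _ => (vac : V)) 0 n 0)) -
      (mode (mode a l b) n (mode v p (vac : V)) - mode v p (mode (mode a l b) n (vac : V))) = _
    rw [h0, sub_sub_sub_cancel_right]
    rfl
  have hpos : ∀ m n p, 0 ≤ p → (fun _ n p => (f - g) 0 n p : ℤ → ℤ → ℤ → V) m n p = 0 := by
    intro m n p hp
    show (f - g) 0 n p = 0
    rw [hval, mode_vac_nonneg v hp]
    simp [defect, borcherds, conv, modeMode, swap]
  -- Since `v_(p) 1 = 0` for `p ≥ 0`, multiplication by `(z₂ - z₃)^(M+N)` merely shifts `n` in the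
  -- coefficient `p = -1`. Locality makes that coefficient zero, and `v_(-1) 1 = v` recovers the
  -- defect on `v`.
  have key := (pow_apply_neg_one hpos (M + N)).1 0 (n - ((M + N : ℕ) : ℤ))
  have hc : (d23 ^ (M + N)) (fun _ n p => (f - g) 0 n p : ℤ → ℤ → ℤ → V) = 0 := by
    funext m n p
    have := congrArg (fun F : ℤ → ℤ → ℤ → V => F 0 n p) hφ
    simp only [pow23_apply] at this ⊢
    exact this
  rw [hc, sub_add_cancel] at key
  have := key.symm
  rw [hval, mode_vac_neg_one] at this
  exact this

/-! ### The translation operator and the Borcherds identity on the vacuum -/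

theorem mode_vac_succ (b : V) (k : ℕ) :
    ((k : ℂ) + 1) • mode b (-1 - (k + 1 : ℕ)) (vac : V) = mode (Lneg b) (-1 - k) (vac : V) := by
  rw [mode_Lneg, LinearMap.smul_apply]
  congr 3
  · push_cast; ring
  · push_cast; ring

/-- The base case is `b_(-1) 1 = b`. Translation gives `(k+1) b_(-2-k) 1 = (L_{-1} b)_(-1-k) 1`, so
`k` can be lowered at the cost of replacing `b` by `L_{-1} b`; hence the induction over all `b`. -/
theorem Lneg_mode_vac (b : V) (k : ℕ) :
    Lneg (mode b (-1 - k) (vac : V)) = mode (Lneg b) (-1 - k) (vac : V) := by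
  induction k generalizing b with
  | zero => simp [mode_vac_neg_one]
  | succ k ih =>
    have hk : ((k : ℂ) + 1) ≠ 0 := Nat.cast_add_one_ne_zero k
    refine smul_right_injective V hk ?_
    show ((k : ℂ) + 1) • Lneg (mode b (-1 - (k + 1 : ℕ)) (vac : V)) =
      ((k : ℂ) + 1) • mode (Lneg b) (-1 - (k + 1 : ℕ)) (vac : V)
    rw [← map_smul, mode_vac_succ, mode_vac_succ, ih]

theorem borcherds_zero (a b : V) (m n : ℤ) (v : V) :
    borcherds a b 0 (fun _ => v) m n 0 = mode a m (mode b n v) - mode b n (mode a m v) := by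
  simp [borcherds, conv_zero, modeMode, swap]

/-- This is the case `a = ω`, `l = 0` of the uniqueness argument, which reduces it to the vacuum. -/
theorem Lneg_commutator (b : V) (n : ℤ) (v : V) :
    Lneg (mode b n v) = mode b n (Lneg v) + mode (Lneg b) n v := by
  have h := defect_eq_zero (a := omega) (b := b) (l := 0) (fun n => ?_) n v
  · rw [defect, borcherds_zero, sub_sub, sub_eq_zero] at h
    exact h
  · rw [defect, borcherds_zero]
    show Lneg (mode b n vac) - mode b n (Lneg vac) - mode (Lneg b) n vac = 0
    rw [Lneg_vac, map_zero, sub_zero]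
    rcases le_or_gt 0 n with hn | hn
    · rw [mode_vac_nonneg _ hn, mode_vac_nonneg _ hn, map_zero, sub_zero]
    · obtain ⟨k, hk⟩ : ∃ k : ℕ, n = -1 - k := ⟨(-1 - n).toNat, by lia⟩
      rw [hk, Lneg_mode_vac, sub_self]

theorem borcherds_vac_nonneg (a b : V) (l : ℤ) {n : ℤ} (hn : 0 ≤ n) :
    borcherds a b l (fun _ => (vac : V)) 0 n 0 = 0 := by
  have h1 : ∀ i : ℕ, mode b (n + i) (vac : V) = 0 := fun i => mode_vac_nonneg _ (by lia)
  have h2 : ∀ i : ℕ, mode a i (vac : V) = 0 := fun i => mode_vac_nonneg _ (by lia)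
  simp [borcherds, conv, modeMode, swap, h1, h2]

/-- The sum `∑_i (-1)^i (l choose i) a_(l-i) b_(-1-k+i) 1`. -/
theorem borcherds_vac_neg (a b : V) (l : ℤ) (k : ℕ) :
    borcherds a b l (fun _ => (vac : V)) 0 (-1 - k) 0 = ∑ i ∈ Finset.range (k + 1),
      ((-1 : ℂ) ^ i * Ring.choose (l : ℂ) i) • mode a (l - i) (mode b (-1 - k + i) vac) := by
  have h2 : ∀ i : ℕ, mode a (0 + i) (vac : V) = 0 := fun i => mode_vac_nonneg _ (by lia)
  have hR : swap (conv l (modeMode b a fun _ => (vac : V))) 0 (-1 - k) 0 = 0 := by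
    simp only [swap, conv, modeMode, LinearMap.coe_mk, AddHom.coe_mk, h2, map_zero, smul_zero,
      finsum_zero]
  rw [borcherds, Pi.sub_apply, Pi.sub_apply, Pi.sub_apply, Pi.smul_apply, Pi.smul_apply,
    Pi.smul_apply, hR, smul_zero, sub_zero, conv_eq_sum l (n₀ := 0) (fun m n hn => by
      rw [modeMode, mode_vac_nonneg b hn, map_zero]) 0 (-1 - k) (k + 1) (by push_cast; lia)]
  simp only [modeMode, zero_add]

theorem choose_succ_mul (l : ℂ) (i : ℕ) :
    ((i : ℂ) + 1) * Ring.choose l (i + 1) = (l - i) * Ring.choose l i := by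
  have h := Ring.choose_smul_choose l (n := i + 1) (k := i) (Nat.le_succ i)
  rw [Nat.choose_succ_self_right, Nat.add_sub_cancel_left, Ring.choose_one_right,
    nsmul_eq_mul] at h
  rw [mul_comm (l - i), ← h]
  push_cast
  ring

/-- For `n ≥ 0` both sides vanish. For `n = -1-k`, apply `L_{-1}` to the identity for `k`: by
translation the right-hand side becomes `k + 1` times the next one, and the derivation rule does the
same on the left, the two contributions to the `i`-th term carrying the factors `i` and `k + 1 - i`.
-/
theorem defect_vac_eq_zero (a b : V) (l n : ℤ) : defect a b l n (vac : V) = 0 := by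
  rw [defect, sub_eq_zero]
  rcases le_or_gt 0 n with hn | hn
  · rw [borcherds_vac_nonneg _ _ _ hn, mode_vac_nonneg _ hn]
  obtain ⟨k, rfl⟩ : ∃ k : ℕ, n = -1 - k := ⟨(-1 - n).toNat, by lia⟩
  clear hn
  induction k with
  | zero =>
    rw [borcherds_vac_neg]
    simp [mode_vac_neg_one]
  | succ k ih =>
    have hk : ((k : ℂ) + 1) ≠ 0 := Nat.cast_add_one_ne_zero k
    refine smul_right_injective V hk ?_
    show ((k : ℂ) + 1) • borcherds a b l (fun _ => (vac : V)) 0 (-1 - (k + 1 : ℕ)) 0 =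
      ((k : ℂ) + 1) • mode (mode a l b) (-1 - (k + 1 : ℕ)) vac
    rw [mode_vac_succ, ← Lneg_mode_vac, ← ih, borcherds_vac_neg, borcherds_vac_neg, map_sum,
      Finset.smul_sum]
    have hterm : ∀ i ∈ Finset.range (k + 1),
        Lneg (((-1 : ℂ) ^ i * Ring.choose (l : ℂ) i) •
          mode a (l - i) (mode b (-1 - k + i) (vac : V))) =
        (((i + 1 : ℕ) : ℂ) * ((-1 : ℂ) ^ (i + 1) * Ring.choose (l : ℂ) (i + 1))) •
          mode a (l - (i + 1 : ℕ)) (mode b (-1 - (k + 1 : ℕ) + (i + 1 : ℕ)) (vac : V)) +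
        (((k : ℂ) + 1 - i) * ((-1 : ℂ) ^ i * Ring.choose (l : ℂ) i)) •
          mode a (l - i) (mode b (-1 - (k + 1 : ℕ) + i) (vac : V)) := by
      intro i _
      rw [map_smul, Lneg_commutator, Lneg_commutator, Lneg_vac, map_zero, zero_add, mode_Lneg,
        mode_Lneg, LinearMap.smul_apply, LinearMap.smul_apply, map_smul, smul_add, smul_smul,
        smul_smul, add_comm]
      rw [show (l : ℤ) - ((i + 1 : ℕ) : ℤ) = l - i - 1 by push_cast; ring,
        show (-1 : ℤ) - ((k + 1 : ℕ) : ℤ) + ((i + 1 : ℕ) : ℤ) = -1 - k + i by push_cast; ring,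
        show (-1 : ℤ) - ((k + 1 : ℕ) : ℤ) + (i : ℤ) = -1 - k + i - 1 by push_cast; ring]
      congr 2
      · rw [mul_left_comm, Nat.cast_add, Nat.cast_one, choose_succ_mul]
        push_cast
        ring
      · push_cast
        ring
    rw [Finset.sum_congr rfl hterm, Finset.sum_add_distrib]
    -- The missing end terms, `i = 0` in one sum and `i = k + 1` in the other, have coefficient
    -- zero, so both sums extend to the same range.
    have h1 := Finset.sum_range_succ' (fun i : ℕ => ((i : ℂ) * ((-1 : ℂ) ^ i *
      Ring.choose (l : ℂ) i)) • mode a (l - i) (mode b (-1 - (k + 1 : ℕ) + i) (vac : V))) (k + 1)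
    have h2 := Finset.sum_range_succ (fun i : ℕ => (((k : ℂ) + 1 - i) * ((-1 : ℂ) ^ i *
      Ring.choose (l : ℂ) i)) • mode a (l - i) (mode b (-1 - (k + 1 : ℕ) + i) (vac : V))) (k + 1)
    rw [Nat.cast_zero, zero_mul, zero_smul, add_zero] at h1
    rw [show ((k : ℂ) + 1 - ((k + 1 : ℕ) : ℂ)) = 0 by push_cast; ring, zero_mul, zero_smul,
      add_zero] at h2
    rw [← h1, ← h2, ← Finset.sum_add_distrib]
    refine Finset.sum_congr rfl fun i _ => ?_
    rw [smul_smul, ← add_smul]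
    congr 1
    ring

/-! ### Recursion in `m` and the full Borcherds identity -/

/-- The right hand side of the Borcherds identity. -/
def borcherdsRHS (a b : V) (l m n : ℤ) (v : V) : V :=
  ∑ᶠ i : ℕ, Ring.choose (m : ℂ) i • mode (mode a (l + i) b) (m + n - i) v

theorem borcherdsRHS_eq_sum (a b : V) {l N : ℤ} (hN : ∀ n, N ≤ n → mode a n b = 0) (m n : ℤ) (v : V)
    (K : ℕ) (hK : N ≤ l + K) : borcherdsRHS a b l m n v =
      ∑ i ∈ Finset.range K, Ring.choose (m : ℂ) i • mode (mode a (l + i) b) (m + n - i) v := by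
  refine finsum_eq_sum_of_support_subset _ fun i hi => ?_
  rw [Finset.coe_range, Set.mem_Iio]
  by_contra! hlt
  refine hi ?_
  simp only [hN _ (show N ≤ l + (i : ℤ) by lia), mode_zero, LinearMap.zero_apply, smul_zero]

/-- Pascal's rule in `m`. The left-hand side obeys the same recursion (`borcherds_rec`), so the
identity spreads from `m = 0`. -/
theorem borcherdsRHS_add_one (a b : V) (l m n : ℤ) (v : V) :
    borcherdsRHS a b l (m + 1) n v =
      borcherdsRHS a b l m (n + 1) v + borcherdsRHS a b (l + 1) m n v := by
  obtain ⟨N, hN⟩ := mode_truncated a b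
  set K := (N - l).toNat with hK
  have hcomm : ∀ x y z : V, x + y + z = x + z + y := fun x y z => add_right_comm x y z
  rw [borcherdsRHS_eq_sum a b hN _ _ _ (K + 1) (by lia),
    borcherdsRHS_eq_sum a b hN _ _ _ (K + 1) (by lia),
    borcherdsRHS_eq_sum a b hN _ _ _ K (by lia), Finset.sum_range_succ', Finset.sum_range_succ' _ K,
    hcomm, ← Finset.sum_add_distrib]
  congr 1
  · refine Finset.sum_congr rfl fun i _ => ?_
    rw [show l + ((i + 1 : ℕ) : ℤ) = l + 1 + i by push_cast; ring,
      show m + (n + 1) - ((i + 1 : ℕ) : ℤ) = m + n - i by push_cast; ring,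
      show m + 1 + n - ((i + 1 : ℕ) : ℤ) = m + n - i by push_cast; ring, ← add_smul,
      Int.cast_add, Int.cast_one, Ring.choose_succ_succ, add_comm]
  · simp only [Ring.choose_zero_right]
    rw [show m + (n + 1) = m + 1 + n by ring]

theorem borcherdsRHS_zero (a b : V) (l n : ℤ) (v : V) :
    borcherdsRHS a b l 0 n v = mode (mode a l b) n v := by
  rw [borcherdsRHS, finsum_eq_single _ 0]
  · simp
  · intro i hi
    obtain ⟨j, rfl⟩ := Nat.exists_eq_succ_of_ne_zero hi
    rw [Int.cast_zero, Nat.succ_eq_add_one, Ring.choose_zero_succ, zero_smul]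

theorem borcherds_rec (a b : V) (l m n : ℤ) (v : V) :
    borcherds a b (l + 1) (fun _ => v) m n 0 =
      borcherds a b l (fun _ => v) (m + 1) n 0 - borcherds a b l (fun _ => v) m (n + 1) 0 := by
  rw [borcherds_add_one]
  rfl

/-- The Borcherds identity. -/
theorem borcherds_identity (a b : V) (l m n : ℤ) (v : V) :
    borcherds a b l (fun _ => v) m n 0 = borcherdsRHS a b l m n v := by
  have h0 : ∀ l n, borcherds a b l (fun _ => v) 0 n 0 = borcherdsRHS a b l 0 n v := by
    intro l n
    have := defect_eq_zero (defect_vac_eq_zero a b l) n v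
    rw [borcherdsRHS_zero]
    exact sub_eq_zero.1 this
  have hpos : ∀ (k : ℕ) l n, borcherds a b l (fun _ => v) k n 0 = borcherdsRHS a b l k n v := by
    intro k
    induction k with
    | zero => exact h0
    | succ k ih =>
      intro l n
      rw [Nat.cast_succ, borcherdsRHS_add_one, ← ih, ← ih, borcherds_rec]
      abel
  have hneg : ∀ (k : ℕ) l n, borcherds a b l (fun _ => v) (-k) n 0 =
      borcherdsRHS a b l (-k) n v := by
    intro k
    induction k with
    | zero => simpa using h0
    | succ k ih =>
      obtain ⟨N₁, hN₁⟩ := exists_borcherds_eq_zero a b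
      obtain ⟨N₂, hN₂⟩ := mode_truncated a b
      -- Lowering `m` by one calls for the identity at the same new `m` with `l + 1`. This is a
      -- descending induction on `l`, starting where locality and truncation make both sides zero;
      -- `s` measures the distance to that range.
      have hd : ∀ (s : ℕ) (l n : ℤ), max (N₁ : ℤ) N₂ ≤ l + s →
          borcherds a b l (fun _ => v) (-(k + 1 : ℕ)) n 0 =
            borcherdsRHS a b l (-(k + 1 : ℕ)) n v := by
        intro s
        induction s with
        | zero =>
          intro l n hl
          rw [hN₁ l _ (by push_cast at hl; lia), borcherdsRHS_eq_sum a b hN₂ _ _ _ 0 (by lia)]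
          simp
        | succ s ihs =>
          intro l n hl
          have e : (-((k + 1 : ℕ) : ℤ)) + 1 = -k := by push_cast; ring
          have h1 := borcherds_rec a b l (-((k + 1 : ℕ) : ℤ)) (n - 1) v
          have h2 := borcherdsRHS_add_one a b l (-((k + 1 : ℕ) : ℤ)) (n - 1) v
          rw [e, sub_add_cancel] at h1 h2
          rw [ihs (l + 1) (n - 1) (by push_cast at hl ⊢; lia), ih, h2] at h1
          have := sub_eq_iff_eq_add.1 h1.symm
          rw [add_comm] at this
          exact (add_left_cancel this).symm
      exact fun l n => hd (max (N₁ : ℤ) N₂ - l).toNat l n (by lia)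
  rcases le_total 0 m with hm | hm
  · obtain ⟨k, rfl⟩ := Int.eq_ofNat_of_zero_le hm
    exact hpos k l n
  · obtain ⟨k, rfl⟩ := Int.exists_eq_neg_ofNat hm
    exact hneg k l n

end VertexOperatorAlgebra

namespace VertexOperatorAlgebra

open TriShift

variable {V : Type u} [AddCommGroup V] [Module ℂ V] [VertexOperatorAlgebra V]

/-! ## Degrees of modes and the Virasoro operators -/

/-- The commutator formula. -/
theorem mode_commutator (a b : V) (m n : ℤ) (v : V) :
    mode a m (mode b n v) - mode b n (mode a m v) =
      ∑ᶠ i : ℕ, Ring.choose (m : ℂ) i • mode (mode a i b) (m + n - i) v := by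
  rw [← borcherds_zero, borcherds_identity, borcherdsRHS]
  simp only [zero_add]

theorem choose_natCast_eq_zero {m i : ℕ} (h : m < i) : Ring.choose ((m : ℤ) : ℂ) i = 0 := by
  rw [Int.cast_natCast, Ring.choose_natCast, Nat.choose_eq_zero_of_lt h, Nat.cast_zero]

theorem finsum_choose_natCast {X : Type*} [AddCommGroup X] [Module ℂ X] (m : ℕ) (f : ℕ → X) :
    ∑ᶠ i : ℕ, Ring.choose ((m : ℤ) : ℂ) i • f i =
      ∑ i ∈ Finset.range (m + 1), (m.choose i : ℂ) • f i := by
  rw [finsum_eq_sum_of_support_subset (s := Finset.range (m + 1))]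
  · exact Finset.sum_congr rfl fun i _ => by rw [Int.cast_natCast, Ring.choose_natCast]
  · intro i hi
    rw [Finset.coe_range, Set.mem_Iio]
    by_contra! hlt
    exact hi (by simp only [choose_natCast_eq_zero (show m < i by lia), zero_smul])

/-- In the commutator with `ω_(1)` only `i = 0` and `i = 1` survive; they give `L_{-1} a` and `L_0
a`. -/
theorem L_zero_mode {k : ℕ} {a : V} (ha : a ∈ piece k) (n : ℤ) (v : V) :
    mode omega 1 (mode a n v) = mode a n (mode omega 1 v) + ((k : ℂ) - n - 1) • mode a n v := by
  have h := mode_commutator omega a ((1 : ℕ) : ℤ) n v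
  rw [finsum_choose_natCast, Finset.sum_range_succ, Finset.sum_range_one] at h
  have h0 : mode omega ((0 : ℕ) : ℤ) a = Lneg a := rfl
  have h1 : mode omega ((1 : ℕ) : ℤ) a = (k : ℂ) • a := L_zero k a ha
  rw [h0, h1, mode_Lneg, mode_smul, sub_eq_iff_eq_add] at h
  rw [Nat.cast_one] at h
  rw [h, add_comm]
  congr 1
  simp only [Nat.choose_self, Nat.choose_zero_right, LinearMap.smul_apply, Nat.cast_one,
    Nat.cast_zero, sub_zero, smul_smul, ← add_smul]
  rw [show (1 : ℤ) + n - 1 = n by ring]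
  congr 1
  push_cast
  ring

/-- The homogeneous piece `V_d` for an integer `d`. -/
def pieceInt (V : Type u) [AddCommGroup V] [Module ℂ V] [VertexOperatorAlgebra V] (d : ℤ) :
    Submodule ℂ V := Module.End.eigenspace (mode (omega : V) 1) (d : ℂ)

theorem mem_pieceInt {d : ℤ} {v : V} : v ∈ pieceInt V d ↔ mode omega 1 v = (d : ℂ) • v :=
  Module.End.mem_eigenspace_iff

theorem piece_le_pieceInt (k : ℕ) : piece (V := V) k ≤ pieceInt V k := fun v hv => by
  rw [mem_pieceInt, Int.cast_natCast]
  exact L_zero k v hv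

theorem pieceInt_natCast (k : ℕ) : pieceInt V k = piece k := by
  refine le_antisymm (fun v hv => ?_) (piece_le_pieceInt k)
  have htop : v ∈ piece (V := V) k ⊔ ⨆ i ≠ k, piece i := by
    have : (⨆ i, piece (V := V) i) ≤ piece k ⊔ ⨆ i ≠ k, piece i := iSup_le fun i => by
      by_cases h : i = k
      · rw [h]; exact le_sup_left
      · exact le_sup_of_le_right (le_iSup₂_of_le i h le_rfl)
    rw [(isInternal (V := V)).submodule_iSup_eq_top] at this
    exact this trivial
  obtain ⟨x, hx, y, hy, rfl⟩ := Submodule.mem_sup.1 htop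
  have hy' : y ∈ pieceInt V k := by
    have := sub_mem hv (piece_le_pieceInt k hx)
    rwa [add_sub_cancel_left] at this
  have hle : (⨆ i ≠ k, piece (V := V) i) ≤
      ⨆ (μ : ℂ) (_ : μ ≠ ((k : ℤ) : ℂ)), Module.End.eigenspace (mode (omega : V) 1) μ :=
    iSup₂_le fun i hi => le_iSup₂_of_le (((i : ℤ)) : ℂ) (by exact_mod_cast hi)
      (piece_le_pieceInt i)
  have := (Module.End.eigenspaces_iSupIndep (mode (omega : V) 1) ((k : ℤ) : ℂ)).le_bot ⟨hy', hle hy⟩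
  rw [Submodule.mem_bot] at this
  rwa [this, add_zero]

theorem pieceInt_neg {d : ℤ} (hd : d < 0) : pieceInt V d = ⊥ := by
  have hle : (⊤ : Submodule ℂ V) ≤
      ⨆ (μ : ℂ) (_ : μ ≠ (d : ℂ)), Module.End.eigenspace (mode (omega : V) 1) μ := by
    rw [← (isInternal (V := V)).submodule_iSup_eq_top]
    refine iSup_le fun i => le_iSup₂_of_le (((i : ℤ)) : ℂ) ?_ (piece_le_pieceInt i)
    intro h
    have : (i : ℤ) = d := by exact_mod_cast h
    lia
  rw [eq_bot_iff]
  exact fun v hv => (Module.End.eigenspaces_iSupIndep (mode (omega : V) 1) (d : ℂ)).le_bot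
    ⟨hv, hle trivial⟩

theorem mode_mem_pieceInt {k : ℕ} {a : V} (ha : a ∈ piece k) (n : ℤ) {j : ℤ} {v : V}
    (hv : v ∈ pieceInt V j) : mode a n v ∈ pieceInt V (k - n - 1 + j) := by
  rw [mem_pieceInt] at hv ⊢
  rw [L_zero_mode ha, hv, map_smul, ← add_smul]
  congr 1
  push_cast
  ring

theorem vac_mem_pieceInt : (vac : V) ∈ pieceInt V 0 := piece_le_pieceInt 0 vac_mem

theorem exists_eq_smul_vac {v : V} (hv : v ∈ pieceInt V 0) : ∃ μ : ℂ, v = μ • vac := by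
  have hv' : v ∈ piece (V := V) 0 := by rwa [← pieceInt_natCast]
  -- If the vacuum were zero, `a = a_(-1) 1` would make `V` zero, against `dim V_0 = 1`.
  have hne : (⟨vac, vac_mem⟩ : piece (V := V) 0) ≠ 0 := by
    intro h
    have h0 : (vac : V) = 0 := congrArg Subtype.val h
    have hall : ∀ a : V, a = 0 := fun a => by rw [← mode_vac_neg_one a, h0, map_zero]
    have : Subsingleton (piece (V := V) 0) := ⟨fun a b => Subtype.ext ((hall _).trans (hall _).symm)⟩
    have h1 := finrank_piece_zero (V := V)
    rw [Module.finrank_zero_of_subsingleton] at h1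
    exact zero_ne_one h1
  obtain ⟨μ, hμ⟩ := (finrank_eq_one_iff_of_nonzero' _ hne).1 finrank_piece_zero ⟨v, hv'⟩
  exact ⟨μ, (congrArg Subtype.val hμ).symm⟩

/-- `[L_p, L_q] v`. -/
theorem virasoro_apply (p q : ℤ) (v : V) :
    mode omega (p + 1) (mode omega (q + 1) v) - mode omega (q + 1) (mode omega (p + 1) v) =
      ((p : ℂ) - q) • mode omega (p + q + 1) v +
        (if p + q = 0 then centralCharge V / 12 * ((p : ℂ) ^ 3 - p) else 0) • v :=
  congrArg (fun T : Module.End ℂ V => T v) (virasoro p q)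

/-- Apply `[L_p, L_{-2}]` to the vacuum: `ω = L_{-2} 1`, and `L_p 1 = 0` for `p ≥ -1`. The central
term occurs only at `p = 2`, where `c (8 - 2) / 12 = c / 2`. -/
theorem omega_mode_omega {p : ℤ} (hp : -1 ≤ p) : mode omega (p + 1) (omega : V) =
    ((p : ℂ) + 2) • mode omega (p - 1) vac +
      (if p = 2 then centralCharge V / 2 else 0) • (vac : V) := by
  have h := virasoro_apply p (-2) (vac : V)
  rw [show (-2 : ℤ) + 1 = -1 by ring, mode_vac_neg_one, mode_vac_nonneg _ (by lia : 0 ≤ p + 1),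
    map_zero, sub_zero, show p + -2 + 1 = p - 1 by ring] at h
  rw [h]
  congr 2
  · push_cast; ring
  · by_cases h2 : p = 2
    · subst h2
      norm_num
      ring
    · rw [if_neg h2, if_neg (by lia)]

theorem omega_mode_one_omega : mode omega 1 (omega : V) = (2 : ℂ) • omega := by
  have := omega_mode_omega (V := V) (p := 0) (by lia)
  simpa [mode_vac_neg_one] using this

theorem omega_mode_three_omega : mode omega 3 (omega : V) = (centralCharge V / 2) • vac := by
  have := omega_mode_omega (V := V) (p := 2) (by lia)
  simpa [mode_vac_nonneg] using this

theorem omega_mode_omega_eq_zero {i : ℤ} (h2 : 2 ≤ i) (h3 : i ≠ 3) :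
    mode omega i (omega : V) = 0 := by
  have := omega_mode_omega (V := V) (p := i - 1) (by lia)
  rw [sub_add_cancel, mode_vac_nonneg _ (by lia), if_neg (by lia)] at this
  simpa using this

/-- If some `L_{-n} 1` with `n ≥ 3` vanishes, then so does the conformal vector. -/
theorem omega_eq_zero_of_mode_vac {n : ℕ} (hn : 3 ≤ n) (h : mode omega (1 - n) (vac : V) = 0) :
    (omega : V) = 0 := by
  -- `[L_{n-2}, L_{-n}] 1 = (2n - 2) L_{-2} 1`, without central term because the indices add up to
  -- `-2`.
  have h1 := virasoro_apply ((n : ℤ) - 2) (-n) (vac : V)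
  rw [show -(n : ℤ) + 1 = 1 - n by ring, h, map_zero, mode_vac_nonneg _ (by lia), map_zero,
    sub_zero, show (n : ℤ) - 2 + -n + 1 = -1 by ring, mode_vac_neg_one, if_neg (by lia), zero_smul,
    add_zero] at h1
  refine (smul_eq_zero.1 h1.symm).resolve_left ?_
  push_cast
  rw [show (n : ℂ) - 2 - -n = ((2 * (n - 1) : ℤ) : ℂ) by push_cast; ring]
  exact_mod_cast (by lia : 2 * ((n : ℤ) - 1) ≠ 0)

end VertexOperatorAlgebra

namespace VertexOperatorAlgebra

open TriShift

variable {V : Type u} [AddCommGroup V] [Module ℂ V] [VertexOperatorAlgebra V]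

/-! ## The action of `𝒰` on `V` -/

/-- The mode `a_(i)` as a linear function of `a`. -/
def modeLin (i : ℤ) : V →ₗ[ℂ] Module.End ℂ V where
  toFun a := mode a i
  map_add' a b := mode_add a b i
  map_smul' c a := mode_smul c a i

variable (V) in
/-- The action of `𝔏(V)^f` on `V`. -/
def actLie : FinLie V →ₗ[ℂ] Module.End ℂ V :=
  Submodule.liftQ _ (Finsupp.lsum ℂ fun i : ℤ => modeLin i) (by
    rw [LinearMap.range_le_ker_iff]
    refine Finsupp.lhom_ext fun i a => ?_
    rw [LinearMap.comp_apply, nabla, Finsupp.lsum_single, LinearMap.add_apply, map_add,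
      LinearMap.comp_apply, LinearMap.smul_apply, map_smul, Finsupp.lsingle_apply,
      Finsupp.lsingle_apply, Finsupp.lsum_single, Finsupp.lsum_single]
    show mode (Lneg a) i + (i : ℂ) • mode a (i - 1) = 0
    rw [mode_Lneg, ← add_smul, neg_add_cancel, zero_smul])

theorem actLie_lieMode (a : V) (i : ℤ) : actLie V (lieMode a i) = mode a i := by
  rw [actLie, lieMode, Submodule.liftQ_apply, Finsupp.lsum_single]
  rfl

theorem finite_support_commutator (a b : V) (i j : ℤ) :
    (Function.support fun k : ℕ =>
      (Ring.choose (i : ℂ) k) • lieMode (mode a k b) (i + j - k)).Finite := by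
  obtain ⟨K, hK⟩ := mode_eventually_zero a b 0
  refine (Finset.range K).finite_toSet.subset fun k hk => ?_
  rw [Finset.coe_range, Set.mem_Iio]
  by_contra! hlt
  refine hk ?_
  have := hK k hlt
  rw [zero_add] at this
  simp only [this, lieMode, Finsupp.single_zero, Submodule.Quotient.mk_zero, smul_zero]

variable (V) in
/-- The action of `U` on `V`. -/
def actEnv : Env V →ₐ[ℂ] Module.End ℂ V :=
  RingQuot.liftAlgHom ℂ ⟨TensorAlgebra.lift ℂ (actLie V), by
    rintro _ _ ⟨a, b, i, j⟩
    rw [map_sub, map_mul, map_mul, TensorAlgebra.lift_ι_apply, TensorAlgebra.lift_ι_apply,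
      TensorAlgebra.lift_ι_apply, actLie_lieMode, actLie_lieMode]
    refine LinearMap.ext fun v => ?_
    have hs := finite_support_commutator a b i j
    rw [LinearMap.sub_apply, Module.End.mul_apply, Module.End.mul_apply, mode_commutator]
    have h1 := ((LinearMap.applyₗ v).comp (actLie V)).toAddMonoidHom.map_finsum hs
    refine Eq.trans (finsum_congr fun k => ?_) h1.symm
    simp [actLie_lieMode]⟩

theorem actEnv_envι (x : FinLie V) : actEnv V (envι V x) = actLie V x := by
  show RingQuot.liftAlgHom ℂ _ (RingQuot.mkAlgHom ℂ (EnvRel V) (TensorAlgebra.ι ℂ x)) = _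
  rw [RingQuot.liftAlgHom_mkAlgHom_apply, TensorAlgebra.lift_ι_apply]

theorem actEnv_mem {d : ℤ} {x : Env V} (hx : x ∈ envPiece V d) {j : ℤ} {v : V}
    (hv : v ∈ pieceInt V j) : actEnv V x v ∈ pieceInt V (d + j) := by
  induction hx using Submodule.span_induction with
  | mem x hx =>
    induction hx with
    | one => simpa using hv
    | mul k a i d x ha _ ih =>
      rw [map_mul, actEnv_envι, actLie_lieMode, Module.End.mul_apply, add_assoc]
      exact mode_mem_pieceInt ha i ih
  | zero => rw [map_zero]; exact zero_mem _
  | add x y _ _ hx hy => rw [map_add]; exact add_mem hx hy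
  | smul c x _ hx => rw [map_smul]; exact Submodule.smul_mem _ _ hx

theorem actEnv_envPiece_eq_zero {d j : ℤ} (h : d + j < 0) {x : Env V} (hx : x ∈ envPiece V d)
    {v : V} (hv : v ∈ pieceInt V j) : actEnv V x v = 0 := by
  have := actEnv_mem hx hv
  rwa [pieceInt_neg h, Submodule.mem_bot] at this

theorem actEnv_envNL_eq_zero {n j : ℤ} (h : j < n) {x : Env V} (hx : x ∈ envNL V n) {v : V}
    (hv : v ∈ pieceInt V j) : actEnv V x v = 0 := by
  let S : Submodule ℂ (Env V) := LinearMap.ker ((LinearMap.applyₗ v).comp (actEnv V).toLinearMap)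
  suffices h : envNL V n ≤ S from h hx
  rw [envNL, Submodule.mul_le]
  intro y _ z hz
  have hz' : z ∈ S := by
    refine (iSup₂_le fun e he => ?_ : (⨆ (j : ℤ) (_ : j ≤ -n), envPiece V j) ≤ S) hz
    exact fun w hw => actEnv_envPiece_eq_zero (by lia) hw hv
  have hz'' : actEnv V z v = 0 := hz'
  show actEnv V (y * z) v = 0
  rw [map_mul, Module.End.mul_apply, hz'', map_zero]

/-- This is continuity of the action on a fixed vector when `V` is discrete: operators of
sufficiently negative degree kill each homogeneous component of `v`. -/
theorem exists_envNL_act_eq_zero (v : V) : ∃ n : ℤ, ∀ x ∈ envNL V n, actEnv V x v = 0 := by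
  have hv : v ∈ ⨆ i, piece (V := V) i := by
    rw [(isInternal (V := V)).submodule_iSup_eq_top]; trivial
  induction hv using Submodule.iSup_induction' with
  | mem k v hv =>
    exact ⟨k + 1, fun x hx => actEnv_envNL_eq_zero (lt_add_one _) hx (piece_le_pieceInt k hv)⟩
  | zero => exact ⟨0, fun x _ => map_zero _⟩
  | add v w _ _ hv hw =>
    obtain ⟨m, hm⟩ := hv
    obtain ⟨n, hn⟩ := hw
    refine ⟨max m n, fun x hx => ?_⟩
    rw [map_add, hm x (envNL_anti (le_max_left _ _) hx), hn x (envNL_anti (le_max_right _ _) hx),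
      add_zero]

/-- The action of `U` on a fixed vector. -/
def actAt (v : V) : Env V →+ V := ((LinearMap.applyₗ v).comp (actEnv V).toLinearMap).toAddMonoidHom

/-! ### Extension of the action to the completion, with `V` discrete -/

section Discrete

/-- The discrete uniform structure of `V`. -/
local instance discreteUniformSpace : UniformSpace V := ⊥

local instance : DiscreteUniformity V := ⟨rfl⟩

theorem continuous_actAt (v : V) : Continuous (actAt v) := by
  refine continuous_of_continuousAt_zero _ ?_
  obtain ⟨n, hn⟩ := exists_envNL_act_eq_zero v
  refine Filter.Tendsto.congr' (f₁ := fun _ => actAt v 0) ?_ tendsto_const_nhds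
  filter_upwards [((envNL_basis V).hasBasis_nhds_zero).mem_of_mem (i := n) trivial] with x hx
  rw [map_zero]
  exact (hn x hx).symm

/-- The action of the completion of `U` on a fixed vector. -/
def actComplAt (v : V) : EnvCompl V →+ V := (actAt v).extension (continuous_actAt v)

theorem continuous_actComplAt (v : V) : Continuous (actComplAt v) :=
  AddMonoidHom.continuous_extension _ _

theorem actComplAt_coe (v : V) (x : Env V) : actComplAt v (x : EnvCompl V) = actEnv V x v :=
  AddMonoidHom.extension_coe _ _ _

theorem actComplAt_add (v w : V) (z : EnvCompl V) :
    actComplAt (v + w) z = actComplAt v z + actComplAt w z := by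
  induction z using UniformSpace.Completion.induction_on with
  | hp =>
    exact isClosed_eq (continuous_actComplAt (V := V) _)
      ((continuous_actComplAt (V := V) _).add (continuous_actComplAt (V := V) _))
  | ih x => simp only [actComplAt_coe, map_add]

theorem actComplAt_mul (v : V) (y z : EnvCompl V) :
    actComplAt v (y * z) = actComplAt (actComplAt v z) y := by
  induction z using UniformSpace.Completion.induction_on with
  | hp =>
    exact isClosed_eq ((continuous_actComplAt (V := V) _).comp (continuous_const.mul continuous_id))
      ((continuous_of_discreteTopology (f := fun w : V => actComplAt w y)).comp
        (continuous_actComplAt v))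
  | ih x =>
    induction y using UniformSpace.Completion.induction_on with
    | hp =>
      exact isClosed_eq ((continuous_actComplAt (V := V) _).comp
        (continuous_id.mul continuous_const)) (continuous_actComplAt (V := V) _)
    | ih y =>
      rw [← UniformSpace.Completion.coe_mul, actComplAt_coe, actComplAt_coe, actComplAt_coe, map_mul,
        Module.End.mul_apply]

/-- Membership in an arbitrary set passes from the action of a subspace to that of its closure. -/
theorem actComplAt_mem_of_closure {S : Set V} {s : Set (EnvCompl V)} {v : V}
    (h : ∀ x ∈ s, actComplAt v x ∈ S) {z : EnvCompl V} (hz : z ∈ closure s) :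
    actComplAt v z ∈ S := by
  have hc : IsClosed (actComplAt v ⁻¹' S) := (isClosed_discrete S).preimage (continuous_actComplAt v)
  exact closure_minimal h hc hz

/-- Continuity lets the convergent series act term by term; on a fixed vector it becomes a finite
sum, namely the Borcherds identity. -/
theorem actComplAt_jacobi {i j : ℕ} {a b : V} (ha : a ∈ piece i) (hb : b ∈ piece j) (l m n : ℤ)
    (v : V) : actComplAt v (jacobi a b l m n) = 0 := by
  have h1 := (summable_jacobiTerm ha hb l m n).hasSum.map (actComplAt v) (continuous_actComplAt v)
  obtain ⟨na, hna⟩ := mode_truncated a v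
  obtain ⟨nb, hnb⟩ := mode_truncated b v
  obtain ⟨N, hN⟩ := mode_truncated a b
  -- From `K` on all three kinds of terms vanish, by truncation of `a` on `v`, of `b` on `v` and of
  -- `a` on `b`.
  set K : ℕ := max (na - m).toNat (max (nb - n).toNat (N - l).toNat) with hK
  have hterm : ∀ k : ℕ, (actComplAt v ∘ fun k => (jacobiTerm a b l m n k : EnvCompl V)) k =
      ((-1 : ℂ) ^ k * Ring.choose (l : ℂ) k) • mode a (m + l - k) (mode b (n + k) v) -
      (-1 : ℂ) ^ l • (((-1 : ℂ) ^ k * Ring.choose (l : ℂ) k) •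
        mode b (n + l - k) (mode a (m + k) v)) -
      Ring.choose (m : ℂ) k • mode (mode a (l + k) b) (m + n - k) v := by
    intro k
    rw [Function.comp_apply, actComplAt_coe, jacobiTerm]
    simp only [map_sub, map_smul, map_mul, actEnv_envι, actLie_lieMode, LinearMap.sub_apply,
      LinearMap.smul_apply, Module.End.mul_apply, smul_sub, smul_smul]
    rw [mul_comm ((-1 : ℂ) ^ l)]
  have h2 : HasSum (actComplAt v ∘ fun k => (jacobiTerm a b l m n k : EnvCompl V)) _ :=
    hasSum_sum_of_ne_finset_zero (s := Finset.range K) (fun k hk => by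
      rw [Finset.mem_range, not_lt] at hk
      rw [hterm, hna _ (by lia : na ≤ m + k), hnb _ (by lia : nb ≤ n + k),
        hN _ (by lia : N ≤ l + k), mode_zero]
      simp)
  refine (h1.unique h2).trans ?_
  rw [Finset.sum_congr rfl fun k _ => hterm k, Finset.sum_sub_distrib, Finset.sum_sub_distrib,
    ← Finset.smul_sum, sub_eq_zero]
  have h3 := borcherds_identity a b l m n v
  rw [borcherdsRHS_eq_sum a b hN m n v K (by lia)] at h3
  rw [← h3, borcherds]
  simp only [Pi.sub_apply, Pi.smul_apply]
  congr 1
  · rw [conv_eq_sum l (n₀ := nb) (fun m n hn => by rw [modeMode, hnb n hn, map_zero]) m n K (by lia)]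
    rfl
  · congr 1
    show _ = conv l (modeMode b a fun _ => v) n m 0
    rw [conv_eq_sum l (n₀ := na) (fun m n hn => by rw [modeMode, hna n hn, map_zero]) n m K (by lia)]
    rfl

theorem actComplAt_vac_relation (v : V) :
    actComplAt v ((envι V (lieMode vac (-1)) - 1 : Env V) : EnvCompl V) = 0 := by
  have h := vac_mode (V := V) (-1)
  rw [if_pos rfl] at h
  rw [actComplAt_coe, map_sub, actEnv_envι, actLie_lieMode, map_one, mode, h]
  simp

/-- Killing a fixed vector is a closed condition since `{0}` is closed in discrete `V`. It is thus
enough to treat `x r y` with `r` a defining relation. -/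
theorem actComplAt_relClosurePiece {p : ℤ} {z : EnvCompl V} (hz : z ∈ relClosurePiece V p) (v : V) :
    actComplAt v z = 0 := by
  refine actComplAt_mem_of_closure (S := {0}) (s := relPiece V p) (fun x hx => ?_)
    (show z ∈ closure (relPiece V p : Set (EnvCompl V)) from hz)
  rw [Set.mem_singleton_iff]
  have hx' : x ∈ relPiece V p := hx
  clear hx
  induction hx' using AddSubgroup.closure_induction with
  | mem x hx =>
    obtain ⟨s, q, t, x, r, y, -, -, hr, -, rfl⟩ := hx
    have h0 : ∀ w, actComplAt w r = 0 := fun w => by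
      cases hr with
      | jacobi i j a b l m n ha hb => exact actComplAt_jacobi ha hb l m n w
      | vacuum => exact actComplAt_vac_relation w
    have hz : ∀ w : EnvCompl V, actComplAt (0 : V) w = 0 := fun w => by
      have := actComplAt_add (0 : V) 0 w
      rwa [add_zero, left_eq_add] at this
    rw [actComplAt_mul, actComplAt_mul, h0, hz]
  | zero => exact map_zero _
  | add x y _ _ hx hy => rw [map_add, hx, hy, add_zero]
  | neg x _ hx => rw [map_neg, hx, neg_zero]

end Discrete

variable (V) in
/-- The action of the completion of `U` on `V`. -/
def actCompl : EnvCompl V →+* AddMonoid.End V where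
  toFun z := AddMonoidHom.mk' (fun v => actComplAt v z) fun v w => actComplAt_add v w z
  map_one' := by
    ext v
    show actComplAt v 1 = v
    rw [← UniformSpace.Completion.coe_one, actComplAt_coe, map_one, Module.End.one_apply]
  map_mul' y z := by
    ext v
    exact actComplAt_mul v y z
  map_zero' := by
    ext v
    exact map_zero (actComplAt v)
  map_add' y z := by
    ext v
    exact map_add (actComplAt v) y z

variable (V) in
/-- The action of `𝒰` on `V`. -/
def act : UnivEnv V →+* AddMonoid.End V :=
  Ideal.Quotient.lift (relIdeal V) ((actCompl V).comp (Hat V).subtype) (by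
    intro x hx
    have hx' : (x : EnvCompl V) ∈ ⨆ p : ℤ, relClosurePiece V p := hx
    refine AddSubgroup.iSup_induction (relClosurePiece V) (C := fun z => actCompl V z = 0) hx'
      (fun p z hz => ?_) (map_zero _) (fun y z hy hz => by rw [map_add, hy, hz, add_zero])
    ext v
    exact actComplAt_relClosurePiece hz v)

theorem act_envToUnivEnv (x : Env V) (v : V) : act V (envToUnivEnv V x) v = actEnv V x v :=
  actComplAt_coe v x

/-- If `𝒰_p` is the image of a closure of a subspace of `U`, then so is its action. -/
theorem act_imageInUnivEnv {M : Submodule ℂ (Env V)} {S : Set V} {v : V}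
    (h : ∀ x ∈ M, actEnv V x v ∈ S) {z : UnivEnv V}
    (hz : z ∈ imageInUnivEnv V (closureImage V M)) : act V z v ∈ S := by
  obtain ⟨y, hy, rfl⟩ := hz
  have hy' : (y : EnvCompl V) ∈ closure ((M.toAddSubgroup.map
    (UniformSpace.Completion.coeRingHom : Env V →+* EnvCompl V).toAddMonoidHom) :
      Set (EnvCompl V)) := hy
  refine actComplAt_mem_of_closure ?_ hy'
  rintro _ ⟨x, hx, rfl⟩
  have := h x hx
  rwa [← actComplAt_coe] at this

/-! ## Modes in `𝒰` -/

/-- The image of `a_[i]` in `𝒰`. -/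
def uMode (a : V) (i : ℤ) : UnivEnv V := envToUnivEnv V (envι V (lieMode a i))

variable (V) in
/-- The scalars in `𝒰`. -/
def scalar : ℂ →+* UnivEnv V := (envToUnivEnv V).comp (algebraMap ℂ (Env V))

theorem envToUnivEnv_smul (c : ℂ) (x : Env V) :
    envToUnivEnv V (c • x) = scalar V c * envToUnivEnv V x := by
  rw [Algebra.smul_def, map_mul]
  rfl

theorem envToUnivEnv_mem {M : Submodule ℂ (Env V)} {x : Env V} (hx : x ∈ M) :
    envToUnivEnv V x ∈ imageInUnivEnv V (closureImage V M) :=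
  ⟨⟨x, coe_mem_Hat V x⟩, coe_mem_closureImage hx, rfl⟩

theorem uMode_mem {k : ℕ} {a : V} (ha : a ∈ piece k) {i d : ℤ} (h : (k : ℤ) - i - 1 = d) :
    uMode a i ∈ (univGrading V).piece d :=
  h ▸ envToUnivEnv_mem (envι_lieMode_mem ha i)

theorem scalar_mem (c : ℂ) : scalar V c ∈ (univGrading V).piece 0 :=
  envToUnivEnv_mem (by
    rw [Algebra.algebraMap_eq_smul_one]
    exact Submodule.smul_mem _ _ one_mem_envPiece)

theorem lieMode_smul (c : ℂ) (a : V) (i : ℤ) : lieMode (c • a) i = c • lieMode a i := by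
  rw [lieMode, ← Finsupp.smul_single, Submodule.Quotient.mk_smul]
  rfl

theorem uMode_smul (c : ℂ) (a : V) (i : ℤ) : uMode (c • a) i = scalar V c * uMode a i := by
  rw [uMode, lieMode_smul, map_smul, envToUnivEnv_smul]
  rfl

theorem uMode_zero (i : ℤ) : uMode (0 : V) i = 0 := by
  have := uMode_smul (0 : ℂ) (0 : V) i
  rwa [zero_smul, map_zero, zero_mul] at this

theorem lieMode_Lneg (a : V) (i : ℤ) : lieMode (Lneg a) i = (-(i : ℂ)) • lieMode a (i - 1) := by
  have h : (Submodule.Quotient.mk (nabla V (Finsupp.single i a)) : FinLie V) = 0 :=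
    (Submodule.Quotient.mk_eq_zero _).2 ⟨_, rfl⟩
  rw [nabla, Finsupp.lsum_single, LinearMap.add_apply, LinearMap.comp_apply, LinearMap.smul_apply,
    Finsupp.lsingle_apply, Finsupp.lsingle_apply, Submodule.Quotient.mk_add,
    Submodule.Quotient.mk_smul] at h
  rw [neg_smul]
  exact eq_neg_of_add_eq_zero_left h

theorem uMode_Lneg (a : V) (i : ℤ) :
    uMode (Lneg a) i = scalar V (-(i : ℂ)) * uMode a (i - 1) := by
  rw [uMode, lieMode_Lneg, map_smul, envToUnivEnv_smul]
  rfl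

theorem envι_commutator (a b : V) (i j : ℤ) :
    envι V (lieMode a i) * envι V (lieMode b j) - envι V (lieMode b j) * envι V (lieMode a i) =
      envι V (∑ᶠ k : ℕ, (Ring.choose (i : ℂ) k) • lieMode (mode a k b) (i + j - k)) := by
  have h := RingQuot.mkAlgHom_rel ℂ (EnvRel.bracket a b i j)
  rw [map_sub, map_mul, map_mul] at h
  exact h

theorem uMode_commutator (a b : V) (i : ℕ) (j : ℤ) :
    uMode a i * uMode b j - uMode b j * uMode a i =
      ∑ k ∈ Finset.range (i + 1), scalar V (i.choose k) * uMode (mode a k b) (i + j - k) := by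
  rw [uMode, uMode, ← map_mul (envToUnivEnv V), ← map_mul (envToUnivEnv V),
    ← map_sub (envToUnivEnv V), envι_commutator, finsum_choose_natCast, map_sum,
    map_sum]
  exact Finset.sum_congr rfl fun k _ => by rw [map_smul, envToUnivEnv_smul]; rfl

theorem uMode_vac : uMode (vac : V) (-1) = 1 := by
  have h : envToUnivEnv V (envι V (lieMode vac (-1)) - 1) = 0 := by
    refine Ideal.Quotient.eq_zero_iff_mem.2 ?_
    show ((envι V (lieMode vac (-1)) - 1 : Env V) : EnvCompl V) ∈ ⨆ p : ℤ, relClosurePiece V p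
    refine AddSubgroup.mem_iSup_of_mem 0 (subset_closure (AddSubgroup.subset_closure
      ⟨0, 0, 0, 1, _, 1, rfl, one_mem_hatPiece, IsRelation.vacuum, one_mem_hatPiece, ?_⟩))
    rw [one_mul, mul_one]
  rwa [map_sub, map_one, sub_eq_zero] at h

theorem act_uMode (a : V) (i : ℤ) (v : V) : act V (uMode a i) v = mode a i v := by
  rw [uMode, act_envToUnivEnv, actEnv_envι, actLie_lieMode]

theorem act_scalar (c : ℂ) (v : V) : act V (scalar V c) v = c • v := by
  refine (act_envToUnivEnv _ v).trans ?_
  rw [AlgHom.commutes, Module.algebraMap_end_apply]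

theorem scalar_commute (c : ℂ) (x : UnivEnv V) : scalar V c * x = x * scalar V c := by
  obtain ⟨x, rfl⟩ := Ideal.Quotient.mk_surjective x
  have key : ∀ z : EnvCompl V, ((algebraMap ℂ (Env V) c : Env V) : EnvCompl V) * z =
      z * ((algebraMap ℂ (Env V) c : Env V) : EnvCompl V) := by
    intro z
    induction z using UniformSpace.Completion.induction_on with
    | hp => exact isClosed_eq (continuous_const.mul continuous_id) (continuous_id.mul continuous_const)
    | ih x =>
      rw [← UniformSpace.Completion.coe_mul, ← UniformSpace.Completion.coe_mul, Algebra.commutes]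
  exact congrArg (Ideal.Quotient.mk (relIdeal V)) (Subtype.ext (key x))

/-! ## The grading by `L_0` -/

variable (V) in
/-- The operator `[L_0, -]` on `U`. -/
def adLzero : Module.End ℂ (Env V) :=
  LinearMap.mulLeft ℂ (envι V (lieMode omega 1)) - LinearMap.mulRight ℂ (envι V (lieMode omega 1))

theorem adLzero_apply (x : Env V) :
    adLzero V x = envι V (lieMode omega 1) * x - x * envι V (lieMode omega 1) := rfl

theorem adLzero_lieMode {k : ℕ} {a : V} (ha : a ∈ piece k) (i : ℤ) :
    adLzero V (envι V (lieMode a i)) = (((k : ℤ) - i - 1 : ℤ) : ℂ) • envι V (lieMode a i) := by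
  have h := envι_commutator omega a ((1 : ℕ) : ℤ) i
  rw [finsum_choose_natCast, Finset.sum_range_succ, Finset.sum_range_one] at h
  have h0 : mode omega ((0 : ℕ) : ℤ) a = Lneg a := rfl
  have h1 : mode omega ((1 : ℕ) : ℤ) a = (k : ℂ) • a := L_zero k a ha
  rw [h0, h1, lieMode_Lneg, lieMode_smul, Nat.cast_one, Nat.cast_zero, sub_zero,
    show (1 : ℤ) + i - 1 = i by ring, smul_smul, smul_smul, ← add_smul, map_smul] at h
  rw [adLzero_apply, h]
  congr 1
  simp only [Nat.choose_self, Nat.choose_zero_right, Nat.cast_one]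
  push_cast
  ring

/-- `[L_0, -]` is a derivation and multiplies each homogeneous mode by its degree. -/
theorem adLzero_envPiece {d : ℤ} {x : Env V} (hx : x ∈ envPiece V d) :
    adLzero V x = (d : ℂ) • x := by
  induction hx using Submodule.span_induction with
  | mem x hx =>
    induction hx with
    | one => simp [adLzero_apply]
    | mul k a i d x ha _ ih =>
      have h := adLzero_lieMode ha i
      rw [adLzero_apply] at h ih ⊢
      set y := envι V (lieMode a i)
      set L := envι V (lieMode (omega : V) 1)
      have e : L * (y * x) - y * x * L = (L * y - y * L) * x + y * (L * x - x * L) := by noncomm_ring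
      rw [e, h, ih, smul_mul_assoc, mul_smul_comm, ← add_smul, ← Int.cast_add]
  | zero => simp
  | add x y _ _ hx hy => rw [map_add, hx, hy, smul_add]
  | smul c x _ hx => rw [map_smul, hx, smul_comm]

/-- `[L_0, x] = d x` for `x` of degree `d`. -/
theorem L_zero_commutator {d : ℤ} {x : UnivEnv V} (hx : x ∈ (univGrading V).piece d) :
    uMode omega 1 * x - x * uMode omega 1 = scalar V d * x := by
  obtain ⟨x, hx, rfl⟩ := hx
  have hcl : IsClosed {z : EnvCompl V | ((envι V (lieMode omega 1) : Env V) : EnvCompl V) * z -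
      z * ((envι V (lieMode omega 1) : Env V) : EnvCompl V) =
        ((algebraMap ℂ (Env V) d : Env V) : EnvCompl V) * z} :=
    isClosed_eq ((continuous_const.mul continuous_id).sub (continuous_id.mul continuous_const))
      (continuous_const.mul continuous_id)
  have key := closure_minimal (s := ((envPiece V d).toAddSubgroup.map
    (UniformSpace.Completion.coeRingHom : Env V →+* EnvCompl V).toAddMonoidHom :
      Set (EnvCompl V))) ?_ hcl hx
  · exact congrArg (Ideal.Quotient.mk (relIdeal V)) (Subtype.ext key)
  · rintro _ ⟨y, hy, rfl⟩
    have := adLzero_envPiece hy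
    rw [adLzero_apply, Algebra.smul_def] at this
    have h2 := congrArg (UniformSpace.Completion.coeRingHom : Env V →+* EnvCompl V) this
    rw [map_sub, map_mul, map_mul, map_mul] at h2
    exact h2

/-! ## Neighborhoods of zero -/

theorem piece_le_NL {n p : ℤ} (h : n ≤ -p) : (univGrading V).piece p ≤ (univGrading V).NL n p := by
  refine AddSubgroup.map_mono (AddSubgroup.comap_mono (closureImage_mono fun x hx => ?_))
  refine Submodule.mem_iSup_of_mem p (Submodule.mem_iSup_of_mem (by lia) ?_)
  have := Submodule.mul_mem_mul (one_mem_envPiece (V := V)) hx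
  rwa [one_mul, ← sub_self p] at this

theorem piece_le_NL_of_nonpos {n p : ℤ} (h : n ≤ 0) :
    (univGrading V).piece p ≤ (univGrading V).NL n p := by
  refine AddSubgroup.map_mono (AddSubgroup.comap_mono (closureImage_mono fun x hx => ?_))
  refine Submodule.mem_iSup_of_mem 0 (Submodule.mem_iSup_of_mem (by lia) ?_)
  have := Submodule.mul_mem_mul hx (one_mem_envPiece (V := V))
  rwa [mul_one, ← sub_zero p] at this

theorem envNLPiece_le (n p : ℤ) : envNLPiece V n p ≤ envPiece V p := by
  refine iSup₂_le fun j _ => ?_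
  have := envPiece_mul_le (V := V) (p - j) j
  rwa [sub_add_cancel] at this

theorem envNL_le_iSup (n : ℤ) : envNL V n ≤ ⨆ p : ℤ, envNLPiece V n p := by
  rw [envNL, ← iSup_envPiece, Submodule.iSup_mul]
  refine iSup_le fun i => ?_
  simp only [Submodule.mul_iSup]
  refine iSup₂_le fun j hj => le_iSup_of_le (i + j) (le_iSup₂_of_le j hj ?_)
  rw [add_sub_cancel_right]

/-- A general element of `N_L^n U` is a sum of pieces of various degrees. Eigenspaces of `[L_0, -]`
for distinct degrees are independent, so the pieces of degree other than `d` add up to zero. -/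
theorem mem_envNLPiece {n d : ℤ} {x : Env V} (hx : x ∈ envPiece V d) (hx' : x ∈ envNL V n) :
    x ∈ envNLPiece V n d := by
  have heig : ∀ p, envPiece V p ≤ Module.End.eigenspace (adLzero V) (p : ℂ) := fun p y hy =>
    Module.End.mem_eigenspace_iff.2 (adLzero_envPiece hy)
  have htop : x ∈ envNLPiece V n d ⊔ ⨆ p ≠ d, envNLPiece V n p := by
    refine (iSup_le fun p => ?_ : (⨆ p, envNLPiece V n p) ≤ _) (envNL_le_iSup n hx')
    by_cases h : p = d
    · rw [h]; exact le_sup_left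
    · exact le_sup_of_le_right (le_iSup₂_of_le p h le_rfl)
  obtain ⟨y, hy, z, hz, rfl⟩ := Submodule.mem_sup.1 htop
  have hz' : z ∈ envPiece V d := by
    have := sub_mem hx (envNLPiece_le n d hy)
    rwa [add_sub_cancel_left] at this
  have hle : (⨆ p ≠ d, envNLPiece V n p) ≤
      ⨆ (μ : ℂ) (_ : μ ≠ (d : ℂ)), Module.End.eigenspace (adLzero V) μ :=
    iSup₂_le fun p hp => le_iSup₂_of_le (p : ℂ) (by exact_mod_cast hp)
      ((envNLPiece_le n p).trans (heig p))
  have := (Module.End.eigenspaces_iSupIndep (adLzero V) (d : ℂ)).le_bot ⟨heig d hz', hle hz⟩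
  rw [Submodule.mem_bot] at this
  rwa [this, add_zero]

/-- `U_d` is dense in `Û_d`, while the closure of `N_L^n U` is an open subgroup of the completion
that meets `U` in `N_L^n U` only. -/
theorem exists_sub_mem_hatNL {d : ℤ} (n : ℤ) {z : EnvCompl V} (hz : z ∈ hatPiece V d) :
    ∃ x ∈ envPiece V d, z - (x : EnvCompl V) ∈ hatNL V n d := by
  have hdi := UniformSpace.Completion.isDenseInducing_coe (α := Env V)
  have hopen : IsOpen (envNL V n : Set (Env V)) :=
    ((envNL_basis V).openAddSubgroup n).isOpen'
  have hclosed : IsClosed (envNL V n : Set (Env V)) :=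
    ((envNL_basis V).openAddSubgroup n).isClosed
  set W : AddSubgroup (EnvCompl V) := closureImage V (envNL V n) with hW
  have hWnhds : (W : Set (EnvCompl V)) ∈ nhds 0 := by
    have := hdi.closure_image_mem_nhds (hopen.mem_nhds (zero_mem (envNL V n)))
    rwa [UniformSpace.Completion.coe_zero] at this
  have hWopen : IsOpen (W : Set (EnvCompl V)) := W.isOpen_of_mem_nhds hWnhds
  have hWmem : ∀ y : Env V, (y : EnvCompl V) ∈ W → y ∈ envNL V n := by
    intro y hy
    have : y ∈ closure (envNL V n : Set (Env V)) := by
      rw [hdi.isInducing.closure_eq_preimage_closure_image]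
      exact hy
    rwa [hclosed.closure_eq] at this
  have hz' : z ∈ closure ((envPiece V d).toAddSubgroup.map
    (UniformSpace.Completion.coeRingHom : Env V →+* EnvCompl V).toAddMonoidHom :
      Set (EnvCompl V)) := hz
  have hnb : (fun y => z - y) ⁻¹' (W : Set (EnvCompl V)) ∈ nhds z :=
    (continuous_const.sub continuous_id).continuousAt.preimage_mem_nhds (by simpa using hWnhds)
  obtain ⟨_, hxW, x, hx, rfl⟩ := mem_closure_iff_nhds.1 hz' _ hnb
  refine ⟨x, hx, ?_⟩
  have h1 : z - (x : EnvCompl V) ∈ hatPiece V d := sub_mem hz (coe_mem_closureImage hx)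
  -- For an open set `W`, `W ∩ closure S` lies in `closure (W ∩ S)`. With `S = U_d` the intersection
  -- lies in `N_L^n U_d` by `mem_envNLPiece`.
  have h2 : z - (x : EnvCompl V) ∈ closure ((W : Set (EnvCompl V)) ∩
      ((envPiece V d).toAddSubgroup.map
        (UniformSpace.Completion.coeRingHom : Env V →+* EnvCompl V).toAddMonoidHom :
          Set (EnvCompl V))) := hWopen.inter_closure ⟨hxW, h1⟩
  refine closure_mono ?_ h2
  rintro _ ⟨hy1, y, hy, rfl⟩
  exact ⟨y, mem_envNLPiece hy (hWmem y hy1), rfl⟩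

theorem exists_sub_mem_NL {d : ℤ} (n : ℤ) {z : UnivEnv V} (hz : z ∈ (univGrading V).piece d) :
    ∃ x ∈ envPiece V d, z - envToUnivEnv V x ∈ (univGrading V).NL n d := by
  obtain ⟨z, hz, rfl⟩ := hz
  obtain ⟨x, hx, hzx⟩ := exists_sub_mem_hatNL n hz
  exact ⟨x, hx, z - ⟨x, coe_mem_Hat V x⟩, hzx, rfl⟩

end VertexOperatorAlgebra

/-! ## Functoriality of the star operation -/

theorem BalTensor.induction {S X M : Type u} [AddCommGroup X] [AddCommGroup M]
    {ρ : S → X →+ X} {lam : S → M →+ M} {C : BalTensor ρ lam → Prop}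
    (tmul : ∀ x m, C (BalTensor.tmul ρ lam x m)) (zero : C 0)
    (add : ∀ s t, C s → C t → C (s + t)) (t : BalTensor ρ lam) : C t := by
  obtain ⟨t, rfl⟩ := QuotientAddGroup.mk_surjective t
  induction t using TensorProduct.induction_on with
  | zero => exact zero
  | tmul x m => exact tmul x m
  | add s t hs ht => exact add _ _ hs ht

namespace SeminormedGrading

variable {R : Type u} [Ring R] (G : SeminormedGrading R)
  {W W' : Type u} [AddCommGroup W] [Module G.Zhu W] [AddCommGroup W'] [Module G.Zhu W']

/-- The map `Φ^L(W) → Φ^L(W')` induced by a linear map `W → W'`. -/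
def mapVerma (f : W →ₗ[G.Zhu] W') (q : ℤ) : G.VermaL W q →+ G.VermaL W' q :=
  BalTensor.lift ((BalTensor.tmul _ _).compl₂ f.toAddMonoidHom) fun s x w => by
    simp only [AddMonoidHom.compl₂_apply]
    rw [BalTensor.tmul_balanced]
    congr 1
    exact (f.map_smul (G.toZhu s) w).symm

theorem mapVerma_tmul (f : W →ₗ[G.Zhu] W') (q : ℤ) (x : G.LQ q) (w : W) :
    G.mapVerma f q (BalTensor.tmul _ _ x w) = BalTensor.tmul _ _ x (f w) := rfl

theorem mapVerma_comp {W'' : Type u} [AddCommGroup W''] [Module G.Zhu W''] (g : W' →ₗ[G.Zhu] W'')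
    (f : W →ₗ[G.Zhu] W') (q : ℤ) (z : G.VermaL W q) :
    G.mapVerma (g.comp f) q z = G.mapVerma g q (G.mapVerma f q z) := by
  have : G.mapVerma (g.comp f) q = (G.mapVerma g q).comp (G.mapVerma f q) := by ext x w; rfl
  rw [this]
  rfl

theorem mapVerma_id (q : ℤ) (z : G.VermaL W q) : G.mapVerma LinearMap.id q z = z := by
  have : G.mapVerma (W := W) LinearMap.id q = AddMonoidHom.id _ := by ext x w; rfl
  rw [this]
  rfl

theorem contract_tmul_tmul (m : ℤ) (a : G.Zhu) (y : G.RQ (-m)) (x : G.LQ m) (w : W) :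
    G.contract m (BalTensor.tmul _ _ a y) (BalTensor.tmul _ _ x w : G.VermaL W m) =
      (a * G.pairing m y x) • w := rfl

theorem contract_mapVerma (f : W →ₗ[G.Zhu] W') (m : ℤ) (t : G.VermaR (-m)) (z : G.VermaL W m) :
    G.contract m t (G.mapVerma f m z) = f (G.contract m t z) := by
  have : (G.contract m).compl₂ (G.mapVerma f m) =
      (G.contract m).compr₂ f.toAddMonoidHom := by
    ext a y x w
    exact (f.map_smul _ w).symm
  exact congrArg (fun F => F t z) this

theorem star_tmul {n m : ℤ} (x : G.LQ n) (t : G.VermaR (-m)) (z : G.VermaL W m) :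
    G.star (BalTensor.tmul _ _ x t : G.MTA n (-m)) z = BalTensor.tmul _ _ x (G.contract m t z) :=
  rfl

theorem star_mapVerma (f : W →ₗ[G.Zhu] W') {n m : ℤ} (a : G.MTA n (-m)) (z : G.VermaL W m) :
    G.star a (G.mapVerma f m z) = G.mapVerma f n (G.star a z) := by
  induction a using BalTensor.induction with
  | tmul x t => rw [star_tmul, star_tmul, contract_mapVerma, mapVerma_tmul]
  | zero => simp
  | add a b ha hb => rw [map_add, map_add, AddMonoidHom.add_apply, AddMonoidHom.add_apply, ha, hb,
      map_add]

/-- Contraction with a fixed vector, as a linear map. -/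
def contractRight (m : ℤ) (z : G.VermaL W m) : G.VermaR (-m) →ₗ[G.Zhu] W where
  toFun t := G.contract m t z
  map_add' t t' := by rw [map_add]; rfl
  map_smul' a t := G.contract_smul m a t z

theorem star_eq_mapVerma {n m : ℤ} (a : G.MTA n (-m)) (z : G.VermaL W m) :
    G.star a z = G.mapVerma (G.contractRight m z) n a := by
  have : (G.star (W := W) (n := n) (m := m)).flip z = G.mapVerma (G.contractRight m z) n := by
    ext x t; rfl
  exact congrArg (fun F => F a) this

/-- Associativity is naturality of `contract` along the linear map "contract with `z`". -/
theorem contract_contract {m k : ℤ} (s : G.VermaR (-k)) (y : G.MTA k (-m)) (z : G.VermaL W m) :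
    G.contract m (G.contract k s y) z = G.contract k s (G.star y z) := by
  rw [star_eq_mapVerma, contract_mapVerma]
  rfl

theorem star_lact {p n m : ℤ} (u : G.piece p) (a : G.MTA n (-m)) (z : G.VermaL W m) :
    G.star (G.lact u n a) z = G.lact u n (G.star a z) := by
  induction a using BalTensor.induction with
  | tmul x t => rfl
  | zero => simp
  | add a b ha hb => rw [map_add, map_add, AddMonoidHom.add_apply, ha, hb, map_add,
      AddMonoidHom.add_apply, map_add]

/-- The right action of `u` on `Φ^R(A)` as a linear map. -/
def ractLin {p : ℤ} (u : G.piece p) (q : ℤ) : G.VermaR q →ₗ[G.Zhu] G.VermaR (q + p) where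
  toFun := G.ractVermaR u q
  map_add' := map_add _
  map_smul' a t := G.ractVermaR_smul u q a t

theorem ract_eq_mapVerma {p : ℤ} (u : G.piece p) (n q : ℤ) :
    G.ract u n q = G.mapVerma (G.ractLin u q) n := by
  ext x t; rfl

theorem star_ract {p n m q : ℤ} (u : G.piece p) (a : G.MTA n (-m)) (b : G.MTA m q) :
    G.star a (G.ract u m q b) = G.ract u n q (G.star a b) := by
  rw [ract_eq_mapVerma, ract_eq_mapVerma, star_mapVerma]

/-- Left multiplication by the identity is injective. -/
theorem lact_one_injective {p : ℤ} (hp : p = 0) (u : G.piece p) (hu : (u : R) = 1) (q : ℤ) :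
    Function.Injective (G.lact (W := W) u q) := by
  -- `p + q` and `q` are equal but not definitionally so, hence a transport map `g`; it is the left
  -- inverse sought.
  have hcast : ∀ k, ∀ _ : k = q, ∃ g : G.VermaL W k →+ G.VermaL W q,
      ∀ (x : R) (hx : x ∈ G.piece k) (hx' : x ∈ G.piece q) (w : W),
        g (BalTensor.tmul _ _ (QuotientAddGroup.mk ⟨x, hx⟩) w) =
          BalTensor.tmul _ _ (QuotientAddGroup.mk ⟨x, hx'⟩) w := by
    rintro k rfl
    exact ⟨AddMonoidHom.id _, fun x hx hx' w => rfl⟩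
  obtain ⟨g, hg⟩ := hcast (p + q) (by rw [hp, zero_add])
  refine Function.LeftInverse.injective (g := g) fun z => ?_
  induction z using BalTensor.induction with
  | tmul x w =>
    induction x using QuotientAddGroup.induction_on with
    | H x =>
      have h1 : G.lact u q (BalTensor.tmul _ _ (QuotientAddGroup.mk x) w : G.VermaL W q) =
          BalTensor.tmul _ _ (QuotientAddGroup.mk ⟨x, by rw [hp, zero_add]; exact x.2⟩) w := by
        show BalTensor.tmul _ _ (QuotientAddGroup.mk (G.mulHom rfl u x)) w = _
        congr 3
        refine Subtype.ext ?_
        show (u : R) * x = x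
        rw [hu, one_mul]
      rw [h1]
      exact hg _ _ _ _
  | zero => simp
  | add a b ha hb => rw [map_add, map_add, ha, hb]

/-- Right multiplication by the identity is injective. -/
theorem ract_one_injective {p : ℤ} (hp : p = 0) (u : G.piece p) (hu : (u : R) = 1) (n q : ℤ) :
    Function.Injective (G.ract u n q) := by
  have hcast : ∀ k, ∀ _ : k = q, ∃ g : G.VermaR k →ₗ[G.Zhu] G.VermaR q,
      ∀ (x : R) (hx : x ∈ G.piece k) (hx' : x ∈ G.piece q) (a : G.Zhu),
        g (BalTensor.tmul _ _ a (QuotientAddGroup.mk ⟨x, hx⟩)) =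
          BalTensor.tmul _ _ a (QuotientAddGroup.mk ⟨x, hx'⟩) := by
    rintro k rfl
    exact ⟨LinearMap.id, fun x hx hx' w => rfl⟩
  obtain ⟨g, hg⟩ := hcast (q + p) (by rw [hp, add_zero])
  have hgr : g.comp (G.ractLin u q) = LinearMap.id := by
    refine LinearMap.ext fun z => ?_
    induction z using BalTensor.induction with
    | tmul a x =>
      induction x using QuotientAddGroup.induction_on with
      | H x =>
        have h1 : G.ractLin u q (BalTensor.tmul _ _ a (QuotientAddGroup.mk x) : G.VermaR q) =
            BalTensor.tmul _ _ a (QuotientAddGroup.mk ⟨x, by rw [hp, add_zero]; exact x.2⟩) := by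
          show BalTensor.tmul _ _ a (QuotientAddGroup.mk ((G.mulHom rfl).flip u x)) = _
          congr 2
          refine Subtype.ext ?_
          show (x : R) * u = x
          rw [hu, mul_one]
        rw [LinearMap.comp_apply, h1]
        exact hg _ _ _ _
    | zero => simp
    | add a b ha hb => rw [map_add, map_add, ha, hb]
  refine Function.LeftInverse.injective (g := G.mapVerma g n) fun z => ?_
  rw [ract_eq_mapVerma, ← mapVerma_comp, hgr, mapVerma_id]

/-! ## The actions on `Φ^L(A)` -/

/-- `a ↦ a w`. -/
def smulRightLin (w : W) : G.Zhu →ₗ[G.Zhu] W := LinearMap.toSpanSingleton G.Zhu W w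

/-- `x ⊗ w` is the image of `x ⊗ 1` under `A → W`, `a ↦ a w`, and ⋆ is natural in `W`. -/
theorem star_eq_of_zhu {n m : ℤ} {a b : G.MTA n (-m)}
    (h : ∀ z : G.VermaL G.Zhu m, G.star a z = G.star b z) (z : G.VermaL W m) :
    G.star a z = G.star b z := by
  induction z using BalTensor.induction with
  | tmul x w =>
    have : (BalTensor.tmul _ _ x w : G.VermaL W m) =
        G.mapVerma (G.smulRightLin w) m (BalTensor.tmul _ _ x (1 : G.Zhu)) := by
      rw [mapVerma_tmul, smulRightLin, LinearMap.toSpanSingleton_apply, one_smul]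
    rw [this, star_mapVerma, star_mapVerma, h]
  | zero => simp
  | add s t hs ht => rw [map_add, map_add, hs, ht]

theorem star_eq_self_of_zhu {m : ℤ} {e : G.MTA m (-m)}
    (h : ∀ z : G.VermaL G.Zhu m, G.star e z = z) (z : G.VermaL W m) : G.star e z = z := by
  induction z using BalTensor.induction with
  | tmul x w =>
    have : (BalTensor.tmul _ _ x w : G.VermaL W m) =
        G.mapVerma (G.smulRightLin w) m (BalTensor.tmul _ _ x (1 : G.Zhu)) := by
      rw [mapVerma_tmul, smulRightLin, LinearMap.toSpanSingleton_apply, one_smul]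
    rw [this, star_mapVerma, h]
  | zero => simp
  | add s t hs ht => rw [map_add, hs, ht]

/-- `A` is a retract of `Φ^R(A)_0`. -/
theorem star_zhu_eq_self_of_zero {m k : ℤ} (hk : k = 0) {e : G.MTA m (-m)}
    (h : ∀ z : G.MTA m (-k), G.star e z = z) (z : G.VermaL G.Zhu m) : G.star e z = z := by
  subst hk
  have h1 : (1 : R) ∈ G.piece (-0) := by rw [neg_zero]; exact G.one_mem
  -- `f` contracts with `1 ⊗ 1` and `g` sends `a` to `a ⊗ 1`; `f ∘ g` is the identity because `1 ⊛ 1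
  -- = 1`.
  let f : G.VermaR (-0) →ₗ[G.Zhu] G.Zhu := G.contractRight 0
    (BalTensor.tmul _ _ (QuotientAddGroup.mk ⟨1, G.one_mem⟩) (1 : G.Zhu))
  let g : G.Zhu →ₗ[G.Zhu] G.VermaR (-0) :=
    G.smulRightLin (BalTensor.tmul _ _ (1 : G.Zhu) (QuotientAddGroup.mk ⟨1, h1⟩))
  have hfg : f.comp g = LinearMap.id := by
    refine LinearMap.ext fun a => ?_
    change G.contract (W := G.Zhu) 0
      (a • (BalTensor.tmul _ _ (1 : G.Zhu) (QuotientAddGroup.mk ⟨1, h1⟩) : G.VermaR (-0)))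
      (BalTensor.tmul _ _ (QuotientAddGroup.mk ⟨1, G.one_mem⟩) (1 : G.Zhu)) = a
    rw [contract_smul, contract_tmul_tmul]
    have : G.pairing 0 (QuotientAddGroup.mk ⟨1, h1⟩) (QuotientAddGroup.mk ⟨1, G.one_mem⟩) = 1 := by
      show G.toZhu (G.mulHom _ ⟨1, h1⟩ ⟨1, G.one_mem⟩) = 1
      rw [← map_one G.toZhu]
      exact congrArg G.toZhu (Subtype.ext (one_mul (1 : R)))
    rw [this, mul_one, smul_eq_mul, smul_eq_mul, mul_one, mul_one]
  have hz : z = G.mapVerma f m (G.mapVerma g m z) := by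
    rw [← mapVerma_comp, hfg, mapVerma_id]
  rw [hz, star_mapVerma, h]

/-! ## Elements of `Φ^R(A)` and `Φ^L(A)` -/

/-- Left multiplication by `r ∈ R_0`, as an endomorphism of `(R / N_R^1 R)_q`. -/
def lmulEnd (q : ℤ) (r : G.zeroRing) : AddMonoid.End (G.RQ q) := G.lmulRQ q r

theorem lmulEnd_ext {q : ℤ} {f g : AddMonoid.End (G.RQ q)}
    (h : ∀ x : G.piece q, f (QuotientAddGroup.mk x) = g (QuotientAddGroup.mk x)) : f = g := by
  refine AddMonoidHom.ext fun x => ?_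
  induction x using QuotientAddGroup.induction_on with
  | H x => exact h x

/-- The action of `A` on `(R / N_R^1 R)_q`. -/
def zhuRQ (q : ℤ) : G.Zhu →+* AddMonoid.End (G.RQ q) :=
  Ideal.Quotient.lift G.zhuIdeal
    { toFun := G.lmulEnd q
      map_one' := G.lmulEnd_ext fun x =>
        congrArg QuotientAddGroup.mk (Subtype.ext (one_mul (x : R)))
      map_mul' := fun r s => G.lmulEnd_ext fun x =>
        congrArg QuotientAddGroup.mk (Subtype.ext (mul_assoc (r : R) s x))
      map_zero' := G.lmulEnd_ext fun x =>
        congrArg QuotientAddGroup.mk (Subtype.ext (zero_mul (x : R)))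
      map_add' := fun r s => G.lmulEnd_ext fun x =>
        congrArg QuotientAddGroup.mk (Subtype.ext (add_mul (r : R) s x)) }
    fun r hr => G.lmulEnd_ext fun x => by
      refine (QuotientAddGroup.eq_zero_iff _).2 ?_
      have := G.NL_mul (q := q) (y := (x : R)) hr x.2
      rw [zero_add] at this
      exact this

/-- `Φ^R(A)_q → (R / N_R^1 R)_q`. -/
def toRQ (q : ℤ) : G.VermaR q →+ G.RQ q :=
  BalTensor.lift (G.zhuRQ q).toAddMonoidHom fun s a y =>
    congrArg (fun F => F y) (map_mul (G.zhuRQ q) a (G.toZhu s))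

theorem toRQ_smul_tmul (q : ℤ) {s : R} (hs : s ∈ G.piece 0) {x : R} (hx : x ∈ G.piece q)
    (hsx : s * x ∈ G.piece q) :
    G.toRQ q (G.toZhu ⟨s, hs⟩ • BalTensor.tmul _ _ (1 : G.Zhu) (QuotientAddGroup.mk ⟨x, hx⟩)) =
      QuotientAddGroup.mk ⟨s * x, hsx⟩ := by
  rw [smul_tmul, mul_one]
  rfl

/-- `A` is a quotient of `R_0`, so its elements can be moved across the tensor sign. -/
theorem exists_tmul_one (q : ℤ) (t : G.VermaR q) :
    ∃ x : G.RQ q, t = BalTensor.tmul _ _ (1 : G.Zhu) x := by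
  induction t using BalTensor.induction with
  | tmul a y =>
    obtain ⟨s, rfl⟩ := Ideal.Quotient.mk_surjective a
    refine ⟨G.lmulRQ q s y, ?_⟩
    rw [← BalTensor.tmul_balanced]
    show _ = BalTensor.tmul _ _ (1 * G.toZhu s) y
    rw [one_mul]
    rfl
  | zero => exact ⟨0, (map_zero _).symm⟩
  | add s t hs ht =>
    obtain ⟨x, rfl⟩ := hs
    obtain ⟨y, rfl⟩ := ht
    exact ⟨x + y, (map_add _ x y).symm⟩

/-- Right multiplication by `r ∈ R_0`, as an endomorphism of `(R / N_L^1 R)_q`. -/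
def rmulEnd (q : ℤ) (r : G.zeroRing) : (AddMonoid.End (G.LQ q))ᵐᵒᵖ :=
  MulOpposite.op (show AddMonoid.End (G.LQ q) from G.rmulLQ q r)

theorem rmulEnd_ext {q : ℤ} {f g : (AddMonoid.End (G.LQ q))ᵐᵒᵖ}
    (h : ∀ x : G.piece q, f.unop (QuotientAddGroup.mk x) = g.unop (QuotientAddGroup.mk x)) :
    f = g := by
  refine MulOpposite.unop_injective (AddMonoidHom.ext fun x => ?_)
  induction x using QuotientAddGroup.induction_on with
  | H x => exact h x

/-- The right action of `A` on `(R / N_L^1 R)_q`. -/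
def zhuLQ (q : ℤ) : G.Zhu →+* (AddMonoid.End (G.LQ q))ᵐᵒᵖ :=
  Ideal.Quotient.lift G.zhuIdeal
    { toFun := G.rmulEnd q
      map_one' := G.rmulEnd_ext fun x => by
        rw [MulOpposite.unop_one]
        exact congrArg QuotientAddGroup.mk (Subtype.ext (mul_one (x : R)))
      map_mul' := fun r s => G.rmulEnd_ext fun x => by
        rw [MulOpposite.unop_mul]
        exact congrArg QuotientAddGroup.mk (Subtype.ext (mul_assoc (x : R) r s).symm)
      map_zero' := G.rmulEnd_ext fun x => by
        rw [MulOpposite.unop_zero]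
        exact congrArg QuotientAddGroup.mk (Subtype.ext (mul_zero (x : R)))
      map_add' := fun r s => G.rmulEnd_ext fun x => by
        rw [MulOpposite.unop_add]
        exact congrArg QuotientAddGroup.mk (Subtype.ext (mul_add (x : R) r s)) }
    fun r hr => G.rmulEnd_ext fun x => by
      refine Eq.trans ?_ (congrArg (fun f : AddMonoid.End (G.LQ q) => f (QuotientAddGroup.mk x))
        (MulOpposite.unop_zero (α := AddMonoid.End (G.LQ q)))).symm
      refine (QuotientAddGroup.eq_zero_iff _).2 ?_
      have := G.mul_NL (p := q) x.2 hr
      rw [add_zero] at this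
      exact this

/-- `Φ^L(A)_q → (R / N_L^1 R)_q`. -/
def toLQ (q : ℤ) : G.VermaL G.Zhu q →+ G.LQ q :=
  BalTensor.lift
    (AddMonoidHom.flip (AddMonoidHom.mk' (fun a => (G.zhuLQ q a).unop) fun a b => by
      rw [map_add]; rfl))
    fun s x a => by
      have h : G.zhuLQ q (G.toZhu s • a) = G.zhuLQ q (G.toZhu s) * G.zhuLQ q a := map_mul _ _ _
      show (G.zhuLQ q a).unop (G.rmulLQ q s x) = (G.zhuLQ q (G.toZhu s • a)).unop x
      rw [h, MulOpposite.unop_mul]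
      rfl

theorem toLQ_tmul (q : ℤ) {x : R} (hx : x ∈ G.piece q) {s : R} (hs : s ∈ G.piece 0)
    (hxs : x * s ∈ G.piece q) :
    G.toLQ q (BalTensor.tmul _ _ (QuotientAddGroup.mk ⟨x, hx⟩) (G.toZhu ⟨s, hs⟩)) =
      QuotientAddGroup.mk ⟨x * s, hxs⟩ := rfl

theorem toLQ_tmul_one (q : ℤ) (x : G.LQ q) :
    G.toLQ q (BalTensor.tmul _ _ x (1 : G.Zhu)) = x := by
  show (G.zhuLQ q 1).unop x = x
  rw [map_one]
  rfl

/-! ### Unities of `𝔄_m` in terms of products in `R` -/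

theorem pairing_mk {m : ℤ} {y x : R} (hy : y ∈ G.piece (-m)) (hx : x ∈ G.piece m)
    (hyx : y * x ∈ G.piece 0) :
    G.pairing m (QuotientAddGroup.mk ⟨y, hy⟩) (QuotientAddGroup.mk ⟨x, hx⟩) =
      G.toZhu ⟨y * x, hyx⟩ := rfl

theorem toZhu_eq_zero {x : R} (hx : x ∈ G.piece 0) : G.toZhu ⟨x, hx⟩ = 0 ↔ x ∈ G.NL 1 0 :=
  Ideal.Quotient.eq_zero_iff_mem

theorem neg_mul_mem {m : ℤ} {y x : R} (hy : y ∈ G.piece (-m)) (hx : x ∈ G.piece m) :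
    y * x ∈ G.piece 0 := by
  have := G.mul_mem hy hx
  rwa [neg_add_cancel] at this

/-- If `e` is a right unity of `𝔄_m` and `x ∈ R_{-m}` is right orthogonal to `R_m`, then
`R_{-m} R_m x ⊆ N_R^1 R_{-m}`. -/
theorem mul_mul_mem_NR {m : ℤ} {e : G.MTA m (-m)} (he : ∀ a : G.MTA m (-m), G.star a e = a)
    {x : R} (hx : x ∈ G.piece (-m)) (hx' : ∀ p ∈ G.piece m, x * p ∈ G.NL 1 0)
    {y p : R} (hy : y ∈ G.piece (-m)) (hp : p ∈ G.piece m) : y * p * x ∈ G.NR 1 (-m) := by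
  set t : G.VermaR (-m) := BalTensor.tmul _ _ (1 : G.Zhu) (QuotientAddGroup.mk ⟨x, hx⟩) with ht
  have h0 : ∀ z : G.VermaL (G.VermaR (-m)) m, G.contract m t z = 0 := by
    intro z
    induction z using BalTensor.induction with
    | tmul q w =>
      induction q using QuotientAddGroup.induction_on with
      | H q =>
        rw [ht, contract_tmul_tmul, G.pairing_mk hx q.2 (G.neg_mul_mem hx q.2),
          (G.toZhu_eq_zero _).2 (hx' q q.2), mul_zero, zero_smul]
    | zero => exact map_zero _
    | add a b ha hb => rw [map_add, ha, hb, add_zero]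
  -- `p ⊗ t = (p ⊗ t) ⋆ e = p ⊗ (t contracted with e)`, and `t` contracts everything to zero by
  -- orthogonality of `x`.
  have h1 : (BalTensor.tmul _ _ (QuotientAddGroup.mk ⟨p, hp⟩) t : G.MTA m (-m)) = 0 := by
    rw [← he (BalTensor.tmul _ _ (QuotientAddGroup.mk ⟨p, hp⟩) t), star_tmul, h0, map_zero]
  -- Contracting `p ⊗ t = 0` with `1 ⊗ y` gives `[y p] t = 0`; `toRQ` then reads this off in `R /
  -- N_R^1 R`.
  have h2 : G.toZhu ⟨y * p, G.neg_mul_mem hy hp⟩ • t = 0 := by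
    have := G.contract_tmul_tmul m 1 (QuotientAddGroup.mk ⟨y, hy⟩) (QuotientAddGroup.mk ⟨p, hp⟩) t
    rw [h1, map_zero, one_mul, G.pairing_mk hy hp (G.neg_mul_mem hy hp)] at this
    exact this.symm
  have hm : y * p * x ∈ G.piece (-m) := by
    have := G.mul_mem (G.neg_mul_mem hy hp) hx
    rwa [zero_add] at this
  have h3 := congrArg (G.toRQ (-m)) h2
  rw [ht, G.toRQ_smul_tmul (-m) (G.neg_mul_mem hy hp) hx hm, map_zero] at h3
  have h4 := (QuotientAddGroup.eq_zero_iff (⟨y * p * x, hm⟩ : G.piece (-m))).1 h3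
  exact h4

/-- A criterion for `e` to act as the identity on `Φ^R(A)_{-m}`. -/
theorem contract_eq_self {m : ℤ} {e : G.MTA m (-m)}
    (he : ∀ z : G.VermaL G.Zhu m, G.star e z = z)
    (hX : ∀ x ∈ G.piece (-m), (∀ p ∈ G.piece m, x * p ∈ G.NL 1 0) → x ∈ G.NR 1 (-m))
    (t : G.VermaR (-m)) : G.contract m t e = t := by
  rw [← sub_eq_zero]
  -- The difference pairs to zero with `Φ^L(A)_m`, on which `e` is the identity. Written as `1 ⊗ x`,
  -- it therefore has `x` orthogonal to `R_m`.
  have h0 : ∀ z : G.VermaL G.Zhu m, G.contract m (G.contract m t e - t) z = 0 := fun z => by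
    rw [map_sub, AddMonoidHom.sub_apply, contract_contract, he, sub_self]
  obtain ⟨x, hx⟩ := G.exists_tmul_one (-m) (G.contract m t e - t)
  rw [hx] at h0 ⊢
  induction x using QuotientAddGroup.induction_on with
  | H x =>
    have : (QuotientAddGroup.mk x : G.RQ (-m)) = 0 := by
      refine (QuotientAddGroup.eq_zero_iff _).2 (hX x x.2 fun p hp => ?_)
      have := h0 (BalTensor.tmul _ _ (QuotientAddGroup.mk ⟨p, hp⟩) 1)
      rw [contract_tmul_tmul, one_mul, smul_eq_mul, mul_one,
        G.pairing_mk x.2 hp (G.neg_mul_mem x.2 hp), G.toZhu_eq_zero] at this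
      exact this
    rw [this, map_zero]

/-- If `e` acts as the identity on `Φ^L(A)_n`, then every element of `R_n` is, modulo `N_L^1 R_n`,
a sum of multiples of elements of `R_{-n} p`. -/
theorem mk_mem_closure {n : ℤ} {e : G.MTA n (-n)} (he : ∀ z : G.VermaL G.Zhu n, G.star e z = z)
    (p : G.piece n) : (QuotientAddGroup.mk p : G.LQ n) ∈
      AddSubgroup.closure {z : G.LQ n | ∃ (x : G.piece n) (y : G.piece (-n)) (w : G.piece n),
        (w : R) = x * (y * p) ∧ z = QuotientAddGroup.mk w} := by
  -- Replace `p ⊗ 1` by `e ⋆ (p ⊗ 1)` and expand `e` into terms `x ⊗ 1 ⊗ y`, each contributing `x (y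
  -- p)`; from here on nothing about `e` is needed.
  rw [← G.toLQ_tmul_one n (QuotientAddGroup.mk p), ← he (BalTensor.tmul _ _ (QuotientAddGroup.mk p) 1)]
  generalize e = a
  induction a using BalTensor.induction with
  | tmul x t =>
    obtain ⟨y, rfl⟩ := G.exists_tmul_one (-n) t
    induction x using QuotientAddGroup.induction_on with
    | H x =>
      induction y using QuotientAddGroup.induction_on with
      | H y =>
        have hw : (x : R) * (y * p) ∈ G.piece n := by
          have := G.mul_mem x.2 (G.neg_mul_mem y.2 p.2)
          rwa [add_zero] at this
        refine AddSubgroup.subset_closure ⟨x, y, ⟨_, hw⟩, rfl, ?_⟩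
        rw [star_tmul, contract_tmul_tmul, one_mul, smul_eq_mul, mul_one,
          G.pairing_mk y.2 p.2 (G.neg_mul_mem y.2 p.2), G.toLQ_tmul n x.2 _ hw]
  | zero =>
    rw [map_zero, AddMonoidHom.zero_apply, map_zero]
    exact zero_mem _
  | add a b ha hb =>
    rw [map_add, AddMonoidHom.add_apply, map_add]
    exact add_mem ha hb

end SeminormedGrading

namespace VertexOperatorAlgebra

variable {V : Type u} [AddCommGroup V] [Module ℂ V] [VertexOperatorAlgebra V]

/-! ## Monomials of given length -/

variable (V) in
/-- Products of `ℓ` homogeneous elements `a_[i]` whose degrees add up to `d`. -/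
inductive IsMonomialOfLength : ℕ → ℤ → Env V → Prop
  | one : IsMonomialOfLength 0 0 1
  | mul (ℓ k : ℕ) (a : V) (i d : ℤ) (x : Env V) : a ∈ piece k → IsMonomialOfLength ℓ d x →
      IsMonomialOfLength (ℓ + 1) ((k : ℤ) - i - 1 + d) (envι V (lieMode a i) * x)

theorem IsMonomial.exists_length {d : ℤ} {x : Env V} (hx : IsMonomial V d x) :
    ∃ ℓ, IsMonomialOfLength V ℓ d x := by
  induction hx with
  | one => exact ⟨0, .one⟩
  | mul k a i d x ha _ ih =>
    obtain ⟨ℓ, h⟩ := ih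
    exact ⟨ℓ + 1, .mul ℓ k a i d x ha h⟩

theorem IsMonomialOfLength.mem_envPiece {ℓ : ℕ} {d : ℤ} {x : Env V}
    (hx : IsMonomialOfLength V ℓ d x) : x ∈ envPiece V d := by
  induction hx with
  | one => exact one_mem_envPiece
  | mul ℓ k a i d x ha _ ih => exact mul_mem_envPiece (envι_lieMode_mem ha i) ih

variable (V) in
/-- The span of the monomials of length `ℓ` and degree `d`. -/
def lengthPiece (ℓ : ℕ) (d : ℤ) : Submodule ℂ (Env V) :=
  Submodule.span ℂ {x | IsMonomialOfLength V ℓ d x}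

theorem envι_mul_mem_lengthPiece {ℓ : ℕ} {d e : ℤ} {y : FinLie V} (hy : y ∈ finLiePiece V e)
    {x : Env V} (hx : x ∈ lengthPiece V ℓ d) : envι V y * x ∈ lengthPiece V (ℓ + 1) (e + d) := by
  induction hy using Submodule.span_induction with
  | mem y hy =>
    obtain ⟨k, a, i, ha, rfl, rfl⟩ := hy
    induction hx using Submodule.span_induction with
    | mem x hx => exact Submodule.subset_span (.mul ℓ k a i d x ha hx)
    | zero => rw [mul_zero]; exact zero_mem _
    | add x y _ _ hx hy => rw [mul_add]; exact add_mem hx hy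
    | smul c x _ hx => rw [mul_smul_comm]; exact Submodule.smul_mem _ _ hx
  | zero => rw [map_zero, zero_mul]; exact zero_mem _
  | add y z _ _ hy hz => rw [map_add, add_mul]; exact add_mem hy hz
  | smul c y _ hy => rw [map_smul, smul_mul_assoc]; exact Submodule.smul_mem _ _ hy

theorem lieMode_mem_finLiePiece {k : ℤ} {a : V} (ha : a ∈ pieceInt V k) {i d : ℤ}
    (h : k - i - 1 = d) : lieMode a i ∈ finLiePiece V d := by
  rcases lt_or_ge k 0 with hk | hk
  · rw [pieceInt_neg hk, Submodule.mem_bot] at ha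
    rw [ha, lieMode, Finsupp.single_zero, Submodule.Quotient.mk_zero]
    exact zero_mem _
  · obtain ⟨k, rfl⟩ := Int.eq_ofNat_of_zero_le hk
    exact Submodule.subset_span ⟨k, a, i, by rwa [← pieceInt_natCast], h, rfl⟩

/-- By the Leibniz rule the commutator replaces one factor at a time by a bracket, which is again a
combination of single modes; so the length does not grow. -/
theorem envι_commutator_mem {k : ℕ} {a : V} (ha : a ∈ piece k) (i : ℤ) {ℓ : ℕ} {d : ℤ} {x : Env V}
    (hx : IsMonomialOfLength V ℓ d x) : envι V (lieMode a i) * x - x * envι V (lieMode a i) ∈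
      lengthPiece V ℓ ((k : ℤ) - i - 1 + d) := by
  induction hx with
  | one => rw [mul_one, one_mul, sub_self]; exact zero_mem _
  | mul ℓ k' b j d x hb hx ih =>
    have e : envι V (lieMode a i) * (envι V (lieMode b j) * x) -
        envι V (lieMode b j) * x * envι V (lieMode a i) =
        (envι V (lieMode a i) * envι V (lieMode b j) -
          envι V (lieMode b j) * envι V (lieMode a i)) * x +
        envι V (lieMode b j) * (envι V (lieMode a i) * x - x * envι V (lieMode a i)) := by
      noncomm_ring
    rw [e, envι_commutator]
    have h1 : ∑ᶠ s : ℕ, (Ring.choose (i : ℂ) s) • lieMode (mode a s b) (i + j - s) ∈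
        finLiePiece V (((k : ℤ) - i - 1) + ((k' : ℤ) - j - 1)) := by
      rw [finsum_eq_sum _ (finite_support_commutator a b i j)]
      refine Submodule.sum_mem _ fun s _ => Submodule.smul_mem _ _ (lieMode_mem_finLiePiece
        (mode_mem_pieceInt ha s (piece_le_pieceInt k' hb)) ?_)
      ring
    have h2 := envι_mul_mem_lengthPiece h1 (Submodule.subset_span hx)
    have h3 := envι_mul_mem_lengthPiece
      (lieMode_mem_finLiePiece (piece_le_pieceInt k' hb) (i := j) rfl) ih
    rw [add_assoc] at h2
    rw [add_left_comm] at h3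
    exact add_mem h2 h3

/-! ## Commutators of Virasoro modes -/

/-- `[L_n, a_[k-1-n]] = ∑_i (n+1 choose i) (L_{i-1} a)_[k-i]`. -/
theorem L_commutator (a : V) (k n : ℕ) :
    uMode omega ((n : ℤ) + 1) * uMode a ((k : ℤ) - 1 - n) -
      uMode a ((k : ℤ) - 1 - n) * uMode omega ((n : ℤ) + 1) =
      ∑ i ∈ Finset.range n, scalar V ((n + 1).choose (i + 2)) *
          uMode (mode omega ((i : ℤ) + 2) a) ((k : ℤ) - 2 - i) +
        scalar V (n + 1) * uMode (mode omega 1 a) ((k : ℤ) - 1) -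
        scalar V k * uMode a ((k : ℤ) - 1) := by
  have h := uMode_commutator omega a (n + 1) ((k : ℤ) - 1 - n)
  rw [Nat.cast_add, Nat.cast_one] at h
  rw [h, Finset.sum_range_succ', Finset.sum_range_succ', sub_eq_add_neg _ (scalar V k * _)]
  refine congrArg₂ (· + ·) (congrArg₂ (· + ·) (Finset.sum_congr rfl fun i _ => ?_) ?_) ?_
  · congr 2
    push_cast
    ring
  · simp only [zero_add, Nat.cast_one, Nat.choose_one_right, Nat.cast_add]
    congr 2
    ring
  · have h0 : mode omega ((0 : ℕ) : ℤ) a = Lneg a := rfl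
    rw [h0, uMode_Lneg, Nat.choose_zero_right, Nat.cast_one, map_one, one_mul, Nat.cast_zero,
      sub_zero, ← neg_mul, ← map_neg]
    congr 3
    · push_cast; ring
    · ring

/-- The only higher product that contributes is `ω_(3) ω = (c/2) 1`, and `1_[-1] = 1` in `𝒰` turns
it into a scalar. -/
theorem L_commutator_omega (n : ℕ) :
    uMode (omega : V) ((n : ℤ) + 1) * uMode omega (1 - (n : ℤ)) -
      uMode omega (1 - (n : ℤ)) * uMode omega ((n : ℤ) + 1) =
      scalar V (2 * n) * uMode omega 1 +
        scalar V (((n : ℂ) ^ 3 - n) / 12 * centralCharge V) := by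
  have h := L_commutator (omega : V) 2 n
  rw [show ((2 : ℕ) : ℤ) - 1 - n = 1 - n by push_cast; ring, omega_mode_one_omega, uMode_smul,
    show ((2 : ℕ) : ℤ) - 1 = 1 by norm_num] at h
  have hsum : ∑ i ∈ Finset.range n, scalar V ((n + 1).choose (i + 2)) *
      uMode (mode omega ((i : ℤ) + 2) (omega : V)) (((2 : ℕ) : ℤ) - 2 - i) =
      scalar V (((n : ℂ) ^ 3 - n) / 12 * centralCharge V) := by
    have hz : ∀ i : ℕ, i ≠ 1 → scalar V ((n + 1).choose (i + 2)) *
        uMode (mode omega ((i : ℤ) + 2) (omega : V)) (((2 : ℕ) : ℤ) - 2 - i) = 0 := fun i hi => by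
      rw [omega_mode_omega_eq_zero (by lia) (by lia), uMode_zero, mul_zero]
    rcases lt_or_ge 1 n with hn | hn
    · rw [Finset.sum_eq_single_of_mem 1 (Finset.mem_range.2 hn) fun i _ hi => hz i hi,
        show ((1 : ℕ) : ℤ) + 2 = 3 by norm_num, omega_mode_three_omega, uMode_smul,
        show ((2 : ℕ) : ℤ) - 2 - (1 : ℕ) = -1 by norm_num, uMode_vac, mul_one, ← map_mul]
      congr 1
      rw [show ((n + 1).choose (1 + 2) : ℂ) = ((n : ℂ) ^ 3 - n) / 6 by
        have : ((n + 1).choose 3 : ℂ) = ((n : ℂ) + 1) * (n + 1 - 1) * (n + 1 - 2) / 6 := by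
          have h2 := Nat.cast_choose_two ℂ
          have : ∀ n : ℕ, (n.choose 3 : ℂ) = (n : ℂ) * (n - 1) * (n - 2) / 6 := fun n => by
            induction n with
            | zero => simp
            | succ n ih => rw [Nat.choose_succ_succ, Nat.cast_add, ih, h2]; push_cast; ring
          rw [this]; push_cast; ring
        rw [this]; ring]
      ring
    · rw [Finset.sum_eq_zero fun i hi => hz i (by rw [Finset.mem_range] at hi; lia)]
      interval_cases n <;> simp
  rw [h, hsum, ← mul_assoc, ← map_mul, add_comm _ (scalar V _ * _), add_sub_right_comm, ← sub_mul,
    ← map_sub]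
  congr 3
  push_cast
  ring

/-! ## Elements of negative degree that are orthogonal to positive ones -/

theorem zero_mul_NR {m : ℤ} {s z : UnivEnv V} (hs : s ∈ (univGrading V).piece 0) (hz : z ∈ (univGrading V).NR 1 (-m)) :
    s * z ∈ (univGrading V).NR 1 (-m) := by
  have := (univGrading V).mul_NL hs hz
  rwa [zero_add] at this

theorem NL_mul_mem_NR {m : ℤ} {r x : UnivEnv V} (hr : r ∈ (univGrading V).NL 1 0) (hx : x ∈ (univGrading V).piece (-m)) :
    r * x ∈ (univGrading V).NR 1 (-m) := by
  have := (univGrading V).NL_mul hr hx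
  rwa [zero_add] at this

theorem NR_mul {m n d : ℤ} (h : -m + d = -n) {z u : UnivEnv V} (hz : z ∈ (univGrading V).NR 1 (-m))
    (hu : u ∈ (univGrading V).piece d) : z * u ∈ (univGrading V).NR 1 (-n) := by
  have := (univGrading V).NL_mul hz hu
  rwa [h, sub_sub, h] at this

theorem scalar_mul_mem_iff {m : ℤ} {c : ℂ} (hc : c ≠ 0) {z : UnivEnv V} :
    scalar V c * z ∈ (univGrading V).NR 1 (-m) ↔ z ∈ (univGrading V).NR 1 (-m) := by
  refine ⟨fun h => ?_, fun h => zero_mul_NR (scalar_mem c) h⟩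
  have := zero_mul_NR (scalar_mem c⁻¹) h
  rwa [← mul_assoc, ← map_mul, inv_mul_cancel₀ hc, map_one, one_mul] at this

/-- `x ∈ 𝒰_{-m}` is orthogonal to `𝒰_m`. -/
def Orth (m : ℤ) (x : UnivEnv V) : Prop :=
  x ∈ (univGrading V).piece (-m) ∧ ∀ p ∈ (univGrading V).piece m, x * p ∈ (univGrading V).NL 1 0

/-- As `u 𝒰_n ⊆ 𝒰_m`, orthogonality passes to `x u`; with `u = L_k` it moves `x` from degree `-m` to
degree `-(m+k)`. -/
theorem Orth.mul {m n d : ℤ} (h : -m + d = -n) {x u : UnivEnv V} (hx : Orth m x)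
    (hu : u ∈ (univGrading V).piece d) : Orth n (x * u) := by
  refine ⟨h ▸ (univGrading V).mul_mem hx.1 hu, fun p hp => ?_⟩
  rw [mul_assoc]
  refine hx.2 _ ?_
  have := (univGrading V).mul_mem hu hp
  rwa [show d + n = m by lia] at this

variable (V) in
/-- `𝒰_{-n} 𝒰_n` kills the elements of `𝒰_{-n}` that are orthogonal to `𝒰_n`. -/
def OrthKill (n : ℤ) : Prop := ∀ x : UnivEnv V, Orth n x → ∀ y ∈ (univGrading V).piece (-n),
  ∀ p ∈ (univGrading V).piece n, y * p * x ∈ (univGrading V).NR 1 (-n)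

theorem L_mem (n : ℤ) : uMode (omega : V) (n + 1) ∈ (univGrading V).piece (-n) :=
  uMode_mem omega_mem (by push_cast; ring)

theorem L_neg_mem (n : ℤ) : uMode (omega : V) (1 - n) ∈ (univGrading V).piece n :=
  uMode_mem omega_mem (by push_cast; ring)

/-- If `𝒰_{-n} 𝒰_n` kills `x` modulo `N_R^1`, then so does `[L_n, p]` for `p ∈ 𝒰_n`. -/
theorem commutator_kill {n : ℤ} (hn : 1 ≤ n) {m : ℤ} {x : UnivEnv V} (hx : x ∈ (univGrading V).piece (-m))
    (h : ∀ y ∈ (univGrading V).piece (-n), ∀ p ∈ (univGrading V).piece n, y * p * x ∈ (univGrading V).NR 1 (-m))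
    {p : UnivEnv V} (hp : p ∈ (univGrading V).piece n) :
    (uMode omega (n + 1) * p - p * uMode omega (n + 1)) * x ∈ (univGrading V).NR 1 (-m) := by
  rw [sub_mul]
  -- In `p L_n` the right factor has negative degree, so the product lies in `N_L^1 𝒰_0`, which
  -- sends `x` into `N_R^1`.
  refine sub_mem (h _ (L_mem n) p hp) (NL_mul_mem_NR ?_ hx)
  have := (univGrading V).mul_NL hp (piece_le_NL (n := 1) (by lia) (L_mem (V := V) n))
  rwa [add_neg_cancel] at this

/-- `x L_k L_{-k}` modulo `N_R^1`, for `k > m`. -/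
theorem mul_L_mul_L_neg {m k : ℕ} (hk : m < k) {x : UnivEnv V} (hx : x ∈ (univGrading V).piece (-(m : ℤ))) :
    x * uMode omega ((k : ℤ) + 1) * uMode omega (1 - (k : ℤ)) -
      (scalar V (2 * k) * (uMode omega 1 * x) +
        scalar V (2 * k * m + ((k : ℂ) ^ 3 - k) / 12 * centralCharge V) * x) ∈
      (univGrading V).NR 1 (-(m : ℤ)) := by
  have h0 := L_zero_commutator hx
  have h1 := L_commutator_omega (V := V) k
  have e : x * uMode omega ((k : ℤ) + 1) * uMode omega (1 - (k : ℤ)) -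
      (scalar V (2 * k) * (uMode omega 1 * x) +
        scalar V (2 * k * m + ((k : ℂ) ^ 3 - k) / 12 * centralCharge V) * x) =
      x * uMode omega (1 - (k : ℤ)) * uMode omega ((k : ℤ) + 1) := by
    have h2 : x * uMode omega ((k : ℤ) + 1) * uMode omega (1 - (k : ℤ)) =
        x * uMode omega (1 - (k : ℤ)) * uMode omega ((k : ℤ) + 1) +
        x * (scalar V (2 * k) * uMode omega 1 +
          scalar V (((k : ℂ) ^ 3 - k) / 12 * centralCharge V)) := by
      rw [← h1]
      noncomm_ring
    have h3 : uMode omega 1 * x = x * uMode omega 1 - scalar V m * x := by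
      rw [sub_eq_iff_eq_add] at h0
      rw [h0, Int.cast_neg, map_neg, Int.cast_natCast]
      noncomm_ring
    rw [h2, h3, mul_add, ← mul_assoc x, ← scalar_commute, ← scalar_commute, map_add, map_mul _ _ (m : ℂ)]
    noncomm_ring
  rw [e]
  -- `x L_{-k}` has positive degree `k - m`, hence already lies in `N_R^1`; this is where `k > m` is
  -- needed.
  have hpos : x * uMode omega (1 - (k : ℤ)) ∈ (univGrading V).NR 1 (-((m : ℤ) - k)) := by
    refine piece_le_NL_of_nonpos (by lia) ?_
    have := (univGrading V).mul_mem hx (L_neg_mem (V := V) k)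
    rwa [show -(m : ℤ) + k = -((m : ℤ) - k) by ring] at this
  exact NR_mul (by ring) hpos (L_mem k)

/-- If `n = m + k` with `k > m`, then `𝒰_{-n} 𝒰_n` kills `x L_k L_{-k}`. -/
theorem OrthKill.shift {m k : ℕ} (h : OrthKill V ((m + k : ℕ) : ℤ)) {x : UnivEnv V}
    (hx : Orth (m : ℤ) x) {y p : UnivEnv V} (hy : y ∈ (univGrading V).piece (-((m + k : ℕ) : ℤ)))
    (hp : p ∈ (univGrading V).piece ((m + k : ℕ) : ℤ)) :
    y * p * (x * uMode omega ((k : ℤ) + 1) * uMode omega (1 - (k : ℤ))) ∈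
      (univGrading V).NR 1 (-(m : ℤ)) := by
  have h1 := h _ (hx.mul (n := ((m + k : ℕ) : ℤ)) (by push_cast; ring) (L_mem (V := V) k)) y hy p hp
  have h2 := NR_mul (n := m) (by push_cast; ring) h1 (L_neg_mem (V := V) k)
  rwa [mul_assoc] at h2

/-! ## Elements orthogonal to `𝒰_m`: vanishing of the central charge -/

instance : Module ℂ (UnivEnv V) := Module.compHom (UnivEnv V) (scalar V)

theorem scalar_mul (c : ℂ) (x : UnivEnv V) : scalar V c * x = c • x := rfl

theorem mul_smul_univEnv (c : ℂ) (x y : UnivEnv V) : x * c • y = c • (x * y) := by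
  rw [← scalar_mul, ← scalar_mul, ← mul_assoc, ← scalar_commute, mul_assoc]

theorem smul_mul_univEnv (c : ℂ) (x y : UnivEnv V) : c • x * y = c • (x * y) :=
  mul_assoc _ _ _

theorem smul_cancel {m : ℤ} {c : ℂ} {x : UnivEnv V} (hx : x ∉ (univGrading V).NR 1 (-m))
    (h : scalar V c * x ∈ (univGrading V).NR 1 (-m)) : c = 0 := by
  by_contra hc
  exact hx ((scalar_mul_mem_iff hc).1 h)

/-- `[L_m, L_{-m}] = 2m L_0 + (m³ - m) c / 12` kills `x`; divide by `2m`. -/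
theorem L_zero_mul_sub_mem {m : ℕ} (hm : 1 ≤ m) (h : OrthKill V m) {x : UnivEnv V}
    (hx : Orth (m : ℤ) x) : uMode omega 1 * x -
      scalar V (-(((m : ℂ) ^ 2 - 1) / 24 * centralCharge V)) * x ∈
        (univGrading V).NR 1 (-(m : ℤ)) := by
  have hm0 : (m : ℂ) ≠ 0 := by exact_mod_cast (by lia : m ≠ 0)
  have h1 := commutator_kill (by exact_mod_cast hm) hx.1 (h x hx) (L_neg_mem (V := V) m)
  rw [L_commutator_omega] at h1
  refine (scalar_mul_mem_iff (c := 2 * m) (by simpa using hm0)).1 ?_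
  convert h1 using 1
  simp only [add_mul _ _ x, scalar_mul, smul_mul_univEnv]
  module

/-- `x L_k L_{-k}` is a multiple of `x` modulo `N_R^1`. -/
theorem mul_L_mul_L_neg_sub_mem {m k : ℕ} (hm : 1 ≤ m) (h : OrthKill V m) (hk : m < k)
    {x : UnivEnv V} (hx : Orth (m : ℤ) x) :
    x * uMode omega ((k : ℤ) + 1) * uMode omega (1 - (k : ℤ)) -
      scalar V (k * (2 * m + centralCharge V * ((k : ℂ) ^ 2 - (m : ℂ) ^ 2) / 12)) * x ∈
        (univGrading V).NR 1 (-(m : ℤ)) := by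
  have h1 := mul_L_mul_L_neg hk hx.1
  have h2 := zero_mul_NR (scalar_mem (2 * k)) (L_zero_mul_sub_mem hm h hx)
  convert add_mem h1 h2 using 1
  simp only [scalar_mul]
  module

/-- If `k > m` and `x L_k L_{-k}` is a nonzero multiple of `x`, then `𝒰_{-m-k} 𝒰_{m+k}` kills
`x` modulo `N_R^1`. -/
theorem kill_of_ne_zero {m k : ℕ} (hm : 1 ≤ m) (h : ∀ n : ℕ, OrthKill V n) (hk : m < k)
    {x : UnivEnv V} (hx : Orth (m : ℤ) x)
    (hne : 2 * m + centralCharge V * ((k : ℂ) ^ 2 - (m : ℂ) ^ 2) / 12 ≠ 0)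
    {y p : UnivEnv V} (hy : y ∈ (univGrading V).piece (-((m + k : ℕ) : ℤ)))
    (hp : p ∈ (univGrading V).piece ((m + k : ℕ) : ℤ)) :
    y * p * x ∈ (univGrading V).NR 1 (-(m : ℤ)) := by
  have hk0 : (k : ℂ) ≠ 0 := by exact_mod_cast (by lia : k ≠ 0)
  have h1 := zero_mul_NR ((univGrading V).neg_mul_mem hy hp)
    (mul_L_mul_L_neg_sub_mem hm (h m) hk hx)
  have h2 := (h (m + k)).shift hx hy hp
  refine (scalar_mul_mem_iff (mul_ne_zero hk0 hne)).1 ?_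
  have h3 := sub_mem h2 h1
  rwa [mul_sub (y * p), sub_sub_cancel, scalar_mul, mul_smul_univEnv] at h3

/-- Let `c ≠ 0`. If for some `k > m` the factor `2m + c (k² - m²) / 12` were nonzero, `[L_{m+k},
L_{-m-k}]` would also kill `x`, forcing a second, different eigenvalue of `L_0`. So the factor
vanishes for every `k > m`, which is impossible. -/
theorem centralCharge_eq_zero {m : ℕ} (hm : 1 ≤ m) (h : ∀ n : ℕ, OrthKill V n)
    {x : UnivEnv V} (hx : Orth (m : ℤ) x) (hxK : x ∉ (univGrading V).NR 1 (-(m : ℤ))) :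
    centralCharge V = 0 := by
  by_contra hc
  have key : ∀ k : ℕ, m < k →
      2 * (m : ℂ) + centralCharge V * ((k : ℂ) ^ 2 - (m : ℂ) ^ 2) / 12 = 0 := by
    intro k hk
    by_contra hne
    have h1 := commutator_kill (by lia) hx.1
      (fun y hy p hp => kill_of_ne_zero hm h hk hx hne hy hp) (L_neg_mem (V := V) ((m + k : ℕ) : ℤ))
    rw [L_commutator_omega] at h1
    have h2 := zero_mul_NR (scalar_mem (2 * ((m + k : ℕ) : ℂ))) (L_zero_mul_sub_mem hm (h m) hx)
    -- The constant is `2(m+k)` times the difference of the two values of `L_0`, that is of `((m+k)²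
    -- - 1) c / 24` and `(m² - 1) c / 24`.
    have h3 := smul_cancel (c := centralCharge V * ((m + k : ℕ) : ℂ) / 12 * (k * (2 * m + k))) hxK (by
      convert sub_mem h1 h2 using 1
      simp only [add_mul _ _ x, scalar_mul, smul_mul_univEnv]
      push_cast
      module)
    have e1 : ((m + k : ℕ) : ℂ) ≠ 0 := by exact_mod_cast (by lia : m + k ≠ 0)
    have e2 : (k : ℂ) * (2 * m + k) ≠ 0 := by
      exact_mod_cast mul_ne_zero (by lia : k ≠ 0) (by lia : 2 * m + k ≠ 0)
    exact mul_ne_zero (div_ne_zero (mul_ne_zero hc e1) (by norm_num)) e2 h3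
  -- Two consecutive values of `k` suffice: the factors differ by `c (2m + 3) / 12`.
  have h1 := key (m + 1) (by lia)
  have h2 := key (m + 2) (by lia)
  have h3 : centralCharge V * ((2 * m + 3 : ℕ) : ℂ) = 0 := by
    push_cast at h1 h2 ⊢
    linear_combination 12 * (h2 - h1)
  exact mul_ne_zero hc (by exact_mod_cast (by lia : 2 * m + 3 ≠ 0)) h3

theorem kill_of_lt {m : ℕ} (hm : 1 ≤ m) (h : ∀ n : ℕ, OrthKill V n)
    {x : UnivEnv V} (hx : Orth (m : ℤ) x) (hxK : x ∉ (univGrading V).NR 1 (-(m : ℤ)))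
    {n : ℕ} (hn : 2 * m < n) {y p : UnivEnv V} (hy : y ∈ (univGrading V).piece (-(n : ℤ)))
    (hp : p ∈ (univGrading V).piece (n : ℤ)) : y * p * x ∈ (univGrading V).NR 1 (-(m : ℤ)) := by
  obtain ⟨k, rfl⟩ := Nat.exists_eq_add_of_le (by lia : m ≤ n)
  refine kill_of_ne_zero hm h (by lia) hx ?_ hy hp
  rw [centralCharge_eq_zero hm h hx hxK, zero_mul, zero_div, add_zero]
  exact_mod_cast (by lia : 2 * m ≠ 0)

/-! ## Elements orthogonal to `𝒰_m`: the action of `𝒰_0` -/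

/-- This is the nonvanishing determinant when the zero mode is eliminated between the relations for
`n` and `n + 1`. Equality would amount to `n (k + 2) = n - k`. -/
theorem choose_succ_ne {n k : ℕ} (hk : k + 1 ≤ n) :
    (n + 1) * (n + 1).choose (k + 2) ≠ n * (n + 2).choose (k + 2) := by
  intro h
  have h1 := Nat.choose_succ_right_eq (n + 1) (k + 1)
  have h2 : (n + 2).choose (k + 2) = (n + 1).choose (k + 1) + (n + 1).choose (k + 2) :=
    Nat.choose_succ_succ _ _
  have h3 : 0 < (n + 1).choose (k + 1) := Nat.choose_pos (by lia)
  have h4 : (n + 1).choose (k + 2) = n * (n + 1).choose (k + 1) := by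
    rw [h2] at h
    linarith
  rw [h4, mul_comm n, mul_assoc] at h1
  have h5 := Nat.eq_of_mul_eq_mul_left h3 h1
  have : n ≤ n * (k + 1 + 1) := Nat.le_mul_of_pos_right n (by lia)
  have : n + 1 - (k + 1) = n - k := by lia
  nlinarith [Nat.sub_le n k, Nat.zero_le (n * k)]

theorem mode_omega_mem_pieceInt {k : ℕ} {a : V} (ha : a ∈ piece (k + 1)) (i : ℕ) :
    mode omega ((i : ℤ) + 2) a ∈ pieceInt V ((k : ℤ) - i) := by
  have := mode_mem_pieceInt omega_mem ((i : ℤ) + 2) (piece_le_pieceInt _ ha)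
  rwa [show ((2 : ℕ) : ℤ) - (i + 2) - 1 + ((k + 1 : ℕ) : ℤ) = k - i by push_cast; ring] at this

/-- Expand `[L_n, a_[k-n]] x`. Terms with `i < k` are zero modes of lower weight and die by
induction; `i = k` yields the scalar `μ`; `i > k` vanishes for degree reasons. The `L_0` and
`L_{-1}` terms leave `(n+1)(k+1) - (k+1) = n(k+1)` times the zero mode. -/
theorem zero_mode_relation {m : ℕ} {x : UnivEnv V} (hx : x ∈ (univGrading V).piece (-(m : ℤ)))
    {n k : ℕ} (hkn : k + 1 ≤ n) (hkill : ∀ y ∈ (univGrading V).piece (-(n : ℤ)),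
      ∀ p ∈ (univGrading V).piece (n : ℤ), y * p * x ∈ (univGrading V).NR 1 (-(m : ℤ)))
    (ih : ∀ j < k, ∀ a ∈ piece (V := V) (j + 1), uMode a j * x ∈ (univGrading V).NR 1 (-(m : ℤ)))
    {a : V} (ha : a ∈ piece (k + 1)) {μ : ℂ} (hμ : mode omega ((k : ℤ) + 2) a = μ • vac) :
    scalar V (n * (k + 1)) * (uMode a k * x) + scalar V ((n + 1).choose (k + 2) * μ) * x ∈
      (univGrading V).NR 1 (-(m : ℤ)) := by
  have h1 := commutator_kill (by lia) hx hkill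
    (p := uMode a (((k + 1 : ℕ) : ℤ) - 1 - n)) (uMode_mem ha (by ring))
  have h0 : mode omega 1 a = ((k + 1 : ℕ) : ℂ) • a := L_zero _ a ha
  rw [L_commutator, h0, uMode_smul, sub_mul, add_mul, Finset.sum_mul] at h1
  have h2 : ∑ i ∈ Finset.range n, (scalar V ((n + 1).choose (i + 2)) *
      uMode (mode omega ((i : ℤ) + 2) a) (((k + 1 : ℕ) : ℤ) - 2 - i) * x -
        if i = k then scalar V ((n + 1).choose (k + 2) * μ) * x else 0) ∈
      (univGrading V).NR 1 (-(m : ℤ)) := by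
    refine sum_mem fun i _ => ?_
    rcases lt_trichotomy i k with hik | rfl | hik
    · rw [if_neg hik.ne, sub_zero, mul_assoc]
      refine zero_mul_NR (scalar_mem _) ?_
      obtain ⟨j, rfl⟩ := Nat.exists_eq_add_of_lt hik
      have := ih j (by lia) (mode omega ((i : ℤ) + 2) a) (by
        rw [← pieceInt_natCast]
        have := mode_omega_mem_pieceInt ha i
        rwa [show ((i + j + 1 : ℕ) : ℤ) - i = ((j + 1 : ℕ) : ℤ) by push_cast; ring] at this)
      rwa [show ((i + j + 1 + 1 : ℕ) : ℤ) - 2 - i = (j : ℤ) by push_cast; ring]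
    · rw [if_pos rfl, hμ, uMode_smul,
        show ((i + 1 : ℕ) : ℤ) - 2 - i = -1 by push_cast; ring, uMode_vac, mul_one, ← map_mul,
        sub_self]
      exact zero_mem _
    · have := mode_omega_mem_pieceInt ha i
      rw [pieceInt_neg (by lia), Submodule.mem_bot] at this
      rw [if_neg hik.ne', sub_zero, this, uMode_zero, mul_zero, zero_mul]
      exact zero_mem _
  rw [Finset.sum_sub_distrib, Finset.sum_ite_eq' _ k, if_pos (Finset.mem_range.2 (by lia))] at h2
  convert sub_mem h1 h2 using 1
  have e : ((k + 1 : ℕ) : ℤ) - 1 = k := by push_cast; ring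
  have e2 : scalar V ((n : ℂ) * (k + 1)) = scalar V (n + 1) * scalar V ((k + 1 : ℕ) : ℂ) -
      scalar V ((k + 1 : ℕ) : ℂ) := by
    rw [← map_mul, ← map_sub]
    congr 1
    push_cast
    ring
  rw [e, e2]
  noncomm_ring

/-- Eliminating the zero mode between two consecutive `n` gives `μ x ≡ 0`, so `μ = 0`; either
relation then kills the zero mode. -/
theorem zero_mode_mul_mem {m : ℕ} {x : UnivEnv V} (hx : x ∈ (univGrading V).piece (-(m : ℤ)))
    (hxK : x ∉ (univGrading V).NR 1 (-(m : ℤ)))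
    {N : ℕ} (hkill : ∀ n : ℕ, N ≤ n → ∀ y ∈ (univGrading V).piece (-(n : ℤ)),
      ∀ p ∈ (univGrading V).piece (n : ℤ), y * p * x ∈ (univGrading V).NR 1 (-(m : ℤ)))
    (k : ℕ) : ∀ a ∈ piece (V := V) (k + 1), uMode a k * x ∈ (univGrading V).NR 1 (-(m : ℤ)) := by
  induction k using Nat.strong_induction_on with
  | _ k ih =>
  intro a ha
  obtain ⟨μ, hμ⟩ := exists_eq_smul_vac (by simpa using mode_omega_mem_pieceInt ha k)
  obtain ⟨n, hn, hkn⟩ : ∃ n, N ≤ n ∧ k + 1 ≤ n := ⟨_, le_max_left _ _, le_max_right _ _⟩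
  have h1 := zero_mode_relation hx hkn (hkill n hn) ih ha hμ
  have h2 := zero_mode_relation hx (hkn.trans n.le_succ) (hkill (n + 1) (hn.trans n.le_succ)) ih ha hμ
  have hμ0 : μ = 0 := by
    have h3 := smul_cancel (c := (((n + 1) * (n + 1).choose (k + 2) : ℕ) -
        ((n * (n + 2).choose (k + 2) : ℕ) : ℂ)) * μ) hxK (by
      convert sub_mem (zero_mul_NR (scalar_mem ((n : ℂ) + 1)) h1)
        (zero_mul_NR (scalar_mem (n : ℂ)) h2) using 1
      simp only [scalar_mul]
      push_cast
      module)
    refine (mul_eq_zero.1 h3).resolve_left (sub_ne_zero.2 (Nat.cast_injective.ne (choose_succ_ne hkn)))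
  rw [hμ0, mul_zero, map_zero, zero_mul, add_zero] at h1
  have hne : (n : ℂ) * (k + 1) ≠ 0 := by
    exact mul_ne_zero (Nat.cast_ne_zero.2 (by lia)) (Nat.cast_add_one_ne_zero k)
  exact (scalar_mul_mem_iff hne).1 h1

/-! ### Comparison of the actions of `𝒰_0` on `x` and on the vacuum -/

/-- `r ∈ 𝒰_0` acts on `𝟏` and, modulo `N_R^1`, on `x` by the same scalar. -/
def SameScalar (m : ℤ) (x r : UnivEnv V) : Prop :=
  ∃ μ : ℂ, act V r vac = μ • vac ∧ (r - scalar V μ) * x ∈ (univGrading V).NR 1 (-m)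

theorem act_smul (r : UnivEnv V) (c : ℂ) (v : V) : act V r (c • v) = c • act V r v := by
  rw [← act_scalar, ← act_scalar]
  change (act V r * act V (scalar V c)) v = (act V (scalar V c) * act V r) v
  rw [← map_mul, ← map_mul, scalar_commute]

namespace SameScalar

variable {m : ℤ} {x r s : UnivEnv V}

theorem scalar (c : ℂ) : SameScalar m x (scalar V c) :=
  ⟨c, act_scalar c vac, by rw [sub_self, zero_mul]; exact zero_mem _⟩

theorem add (hr : SameScalar m x r) (hs : SameScalar m x s) : SameScalar m x (r + s) := by
  obtain ⟨μ, h1, h2⟩ := hr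
  obtain ⟨ν, h3, h4⟩ := hs
  refine ⟨μ + ν, ?_, ?_⟩
  · rw [map_add, add_smul, ← h1, ← h3]
    rfl
  · rw [map_add, add_sub_add_comm, add_mul]
    exact add_mem h2 h4

theorem mul (hr0 : r ∈ (univGrading V).piece 0) (hr : SameScalar m x r)
    (hs : SameScalar m x s) : SameScalar m x (r * s) := by
  obtain ⟨μ, h1, h2⟩ := hr
  obtain ⟨ν, h3, h4⟩ := hs
  refine ⟨μ * ν, ?_, ?_⟩
  · rw [map_mul]
    change act V r (act V s vac) = _
    rw [h3, act_smul, h1, smul_smul, mul_comm]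
  · convert add_mem (zero_mul_NR hr0 h4) (zero_mul_NR (scalar_mem ν) h2) using 1
    rw [← mul_assoc, ← mul_assoc, ← add_mul, mul_sub, mul_sub, mul_comm μ, map_mul,
      scalar_commute ν r]
    noncomm_ring

end SameScalar

theorem envNLPiece_le_envNL (n p : ℤ) : envNLPiece V n p ≤ envNL V n :=
  iSup₂_le fun j hj => mul_le_mul' le_top (le_iSup₂_of_le j hj le_rfl)

theorem act_NL_vac {p : ℤ} {z : UnivEnv V} (hz : z ∈ (univGrading V).NL 1 p) :
    act V z vac = 0 := by
  have := act_imageInUnivEnv (S := {(0 : V)}) (v := vac) (fun y hy =>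
    actEnv_envNL_eq_zero (by norm_num) (envNLPiece_le_envNL 1 p hy) vac_mem_pieceInt) hz
  exact this

theorem sameScalar_NL {m : ℤ} {x r : UnivEnv V} (hx : x ∈ (univGrading V).piece (-m))
    (hr : r ∈ (univGrading V).NL 1 0) : SameScalar m x r := by
  refine ⟨0, ?_, ?_⟩
  · rw [act_NL_vac hr, zero_smul]
  · rw [map_zero, sub_zero]
    exact NL_mul_mem_NR hr hx

theorem sameScalar_span {m : ℤ} {x : UnivEnv V} {S : Set (Env V)}
    (h : ∀ y ∈ S, SameScalar m x (envToUnivEnv V y)) {y : Env V} (hy : y ∈ Submodule.span ℂ S) :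
    SameScalar m x (envToUnivEnv V y) := by
  induction hy using Submodule.span_induction with
  | mem y hy => exact h y hy
  | zero => rw [map_zero, ← map_zero (scalar V)]; exact .scalar 0
  | add y z _ _ hy hz => rw [map_add]; exact hy.add hz
  | smul c y _ hy => rw [envToUnivEnv_smul]; exact .mul (scalar_mem c) (.scalar c) hy

/-- Induction on the length, by the degree `d` of the monomial behind the first factor. If `d < 0`
the product lies in `N_L^1`, which kills both vectors. If `d = 0` the first factor is a zero mode
and scalars multiply. If `d > 0` the first factor has negative degree: move it to the far right,
where the product lies in `N_L^1`, at the cost of a commutator of smaller length. -/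
theorem sameScalar_monomial {m : ℤ} {x : UnivEnv V} (hx : x ∈ (univGrading V).piece (-m))
    (ho : ∀ k : ℕ, ∀ a ∈ piece (V := V) (k + 1), uMode a k * x ∈ (univGrading V).NR 1 (-m))
    (ℓ : ℕ) : ∀ y : Env V, IsMonomialOfLength V ℓ 0 y → SameScalar m x (envToUnivEnv V y) := by
  induction ℓ with
  | zero =>
    intro y hy
    have : y = 1 := by
      generalize hℓ : 0 = ℓ at hy
      generalize (0 : ℤ) = d at hy
      cases hy
      · rfl
      · lia
    rw [this, map_one, ← map_one (scalar V)]
    exact .scalar 1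
  | succ ℓ ih =>
    intro y hy
    generalize hd : (0 : ℤ) = d at hy
    cases hy with
    | mul _ k a i d y ha hy =>
    have hE : envToUnivEnv V y ∈ (univGrading V).piece d := envToUnivEnv_mem hy.mem_envPiece
    rw [map_mul]
    change SameScalar m x (uMode a i * envToUnivEnv V y)
    rcases lt_trichotomy d 0 with hneg | rfl | hpos
    · refine sameScalar_NL hx ?_
      have := (univGrading V).mul_NL (uMode_mem ha (i := i) rfl) (piece_le_NL (n := 1) (by lia) hE)
      rwa [← hd] at this
    · refine .mul (uMode_mem ha (by lia)) ?_ (ih y hy)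
      rcases k with _ | k
      · obtain ⟨μ, rfl⟩ := exists_eq_smul_vac (piece_le_pieceInt 0 ha)
        rw [show i = -1 by push_cast at hd; lia, uMode_smul, uMode_vac, mul_one]
        exact .scalar μ
      · obtain rfl : i = k := by push_cast at hd; lia
        refine ⟨0, ?_, ?_⟩
        · rw [act_uMode, zero_smul]
          exact mode_nonneg_vac a k (by lia)
        · rw [map_zero, sub_zero]
          exact ho k a ha
    · have h1 := envι_commutator_mem ha i hy
      rw [← hd] at h1
      have h2 := sameScalar_span ih h1
      have h3 : envToUnivEnv V y * uMode a i ∈ (univGrading V).NL 1 0 := by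
        have := (univGrading V).mul_NL hE (piece_le_NL (n := 1) (by lia)
          (uMode_mem ha (i := i) (d := (k : ℤ) - i - 1) rfl))
        rwa [add_comm, ← hd] at this
      have h4 := h2.add (sameScalar_NL hx h3)
      rw [map_sub, map_mul, map_mul] at h4
      change SameScalar m x (uMode a i * envToUnivEnv V y - envToUnivEnv V y * uMode a i +
        envToUnivEnv V y * uMode a i) at h4
      rwa [sub_add_cancel] at h4

/-- Modulo `N_L^1`, which kills both vectors, `r` may be replaced by a combination of monomials of
`U_0`. -/
theorem sameScalar_piece_zero {m : ℤ} {x : UnivEnv V} (hx : x ∈ (univGrading V).piece (-m))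
    (ho : ∀ k : ℕ, ∀ a ∈ piece (V := V) (k + 1), uMode a k * x ∈ (univGrading V).NR 1 (-m))
    {r : UnivEnv V} (hr : r ∈ (univGrading V).piece 0) : SameScalar m x r := by
  obtain ⟨y, hy, hry⟩ := exists_sub_mem_NL 1 hr
  have h1 : SameScalar m x (envToUnivEnv V y) := sameScalar_span (fun z hz => by
    obtain ⟨ℓ, hℓ⟩ := IsMonomial.exists_length hz
    exact sameScalar_monomial hx ho ℓ z hℓ) hy
  have := (sameScalar_NL hx hry).add h1
  rwa [sub_add_cancel] at this

/-! ## Elements orthogonal to `𝒰_m` vanish -/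

/-- Evaluation on the vacuum, `(𝒰 / N_L^1 𝒰)_n → V`. -/
def actVac (n : ℤ) : (univGrading V).LQ n →+ V :=
  QuotientAddGroup.lift _
    (AddMonoidHom.mk' (fun w : (univGrading V).piece n => act V (w : UnivEnv V) vac) fun w w' => by
      rw [AddSubgroup.coe_add, map_add]
      rfl)
    fun _ hw => act_NL_vac hw

/-- If each `𝒰_{-n} 𝒰_n` kills the elements of `𝒰_{-n}` orthogonal to `𝒰_n`, and each `𝒰_n` is
generated, modulo `N_L^1`, by the traces of its elements, then there are no nonzero such elements. -/
theorem Orth.mem_NR {m : ℕ} (h : ∀ n : ℕ, OrthKill V n)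
    (hgen : ∀ (n : ℕ) (p : (univGrading V).piece n), (QuotientAddGroup.mk p : (univGrading V).LQ n) ∈
      AddSubgroup.closure {z : (univGrading V).LQ n |
        ∃ (x : (univGrading V).piece n) (y : (univGrading V).piece (-n))
          (w : (univGrading V).piece n),
          (w : UnivEnv V) = x * (y * p) ∧ z = QuotientAddGroup.mk w})
    {x : UnivEnv V} (hx : Orth (m : ℤ) x) : x ∈ (univGrading V).NR 1 (-(m : ℤ)) := by
  rcases Nat.eq_zero_or_pos m with rfl | hm
  -- In degree `0` the two neighborhoods coincide, and orthogonality to `1` is the claim.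
  · have := hx.2 1 (univGrading V).one_mem
    rwa [mul_one] at this
  by_contra hxK
  have hkill : ∀ n : ℕ, 2 * m + 1 ≤ n → ∀ y ∈ (univGrading V).piece (-(n : ℤ)),
      ∀ p ∈ (univGrading V).piece (n : ℤ), y * p * x ∈ (univGrading V).NR 1 (-(m : ℤ)) :=
    fun n hn y hy p hp => kill_of_lt hm h hx hxK hn hy hp
  have ho := zero_mode_mul_mem hx.1 hxK hkill
  have hvac : ∀ p : (univGrading V).piece ((2 * m + 1 : ℕ) : ℤ),
      act V (p : UnivEnv V) vac = 0 := by
    intro p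
    have h0 : ∀ z ∈ AddSubgroup.closure {z : (univGrading V).LQ ((2 * m + 1 : ℕ) : ℤ) |
        ∃ (x : (univGrading V).piece ((2 * m + 1 : ℕ) : ℤ))
          (y : (univGrading V).piece (-((2 * m + 1 : ℕ) : ℤ)))
          (w : (univGrading V).piece ((2 * m + 1 : ℕ) : ℤ)),
          (w : UnivEnv V) = x * (y * p) ∧ z = QuotientAddGroup.mk w},
        z ∈ (actVac (V := V) ((2 * m + 1 : ℕ) : ℤ)).ker := by
      intro z hz
      refine (AddSubgroup.closure_le _).2 ?_ hz
      rintro _ ⟨x', y, w, hw, rfl⟩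
      -- `y p` kills `x` and also acts on it by `μ`; as `x ∉ N_R^1`, `μ = 0`, so `y p` kills the
      -- vacuum.
      obtain ⟨μ, h1, h2⟩ := sameScalar_piece_zero hx.1 ho ((univGrading V).neg_mul_mem y.2 p.2)
      have h3 := smul_cancel (c := μ) hxK (by
        have := sub_mem (hkill _ le_rfl y y.2 p p.2) h2
        rwa [sub_mul, sub_sub_cancel] at this)
      change act V (w : UnivEnv V) vac = 0
      rw [hw, map_mul]
      change act V x' (act V (y * p) vac) = 0
      rw [h1, h3, zero_smul, map_zero]
    exact h0 _ (hgen (2 * m + 1) p)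
  -- `L_{-n} 1 = 0` with `n = 2m + 1 ≥ 3` forces `ω = 0`. Then `L_0` is zero in `𝒰`, while `[L_0, x]
  -- = -m x` with `m > 0`.
  have h1 := hvac ⟨_, L_neg_mem ((2 * m + 1 : ℕ) : ℤ)⟩
  rw [act_uMode] at h1
  have h2 : (omega : V) = 0 := omega_eq_zero_of_mode_vac (by lia) h1
  have h3 := L_zero_commutator hx.1
  rw [h2, uMode_zero, zero_mul, mul_zero, sub_zero] at h3
  have h4 := smul_cancel (c := ((-(m : ℤ) : ℤ) : ℂ)) hxK (by rw [← h3]; exact zero_mem _)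
  have h5 : (-(m : ℤ)) = 0 := by exact_mod_cast h4
  lia

end VertexOperatorAlgebra

/-! ### Formal consequences for the operation ⋆ -/

namespace SeminormedGrading

variable {R : Type u} [Ring R] (G : SeminormedGrading R)

theorem star_eq_self_of_contract {m : ℤ} {e : G.MTA m (-m)} (h : ∀ t, G.contract m t e = t)
    {n : ℤ} (a : G.MTA n (-m)) : G.star a e = a := by
  induction a using BalTensor.induction with
  | tmul x t => rw [star_tmul, h]
  | zero => rw [map_zero, AddMonoidHom.zero_apply]
  | add a b ha hb => rw [map_add, AddMonoidHom.add_apply, ha, hb]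

theorem star_eq_of_lact_one {p : ℤ} (hp : p = 0) (u : G.piece p) (hu : (u : R) = 1) {n m q : ℤ}
    (a : G.MTA n (-m)) (b : G.MTA m q) (d : G.MTA n q)
    (h : G.star (G.lact u n a) b = G.lact u n d) : G.star a b = d := by
  rw [star_lact] at h
  exact G.lact_one_injective hp u hu n h

theorem star_eq_of_ract_one {p : ℤ} (hp : p = 0) (u : G.piece p) (hu : (u : R) = 1) {n m q : ℤ}
    (a : G.MTA n (-m)) (b : G.MTA m q) (d : G.MTA n q)
    (h : G.star a (G.ract u m q b) = G.ract u n q d) : G.star a b = d := by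
  rw [star_ract] at h
  exact G.ract_one_injective hp u hu n q h

/-- Elements that agree on `Φ^L(A)` agree on every `Φ^L(W)`, hence on `𝔄_m` itself, where ⋆ with the
right unity recovers them. -/
theorem star_injective {m : ℤ} {e : G.MTA m (-m)} (he : ∀ a : G.MTA m (-m), G.star a e = a) :
    Function.Injective (G.star (W := G.Zhu) (n := m) (m := m)) := fun a b hab => by
  rw [← he a, ← he b]
  exact G.star_eq_of_zhu (fun z => congrArg (fun f => f z) hab) e

end SeminormedGrading

namespace VertexOperatorAlgebra

variable {V : Type u} [AddCommGroup V] [Module ℂ V] [VertexOperatorAlgebra V]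

/-! ## Unities of the mode transition algebras -/

theorem vac_mem_finLiePiece : lieMode (vac : V) (-1) ∈ finLiePiece V ((0 : ℕ) : ℤ) :=
  lieMode_mem_finLiePiece vac_mem_pieceInt (by norm_num)

theorem coe_ofLie_vac : (ofLie ⟨lieMode (vac : V) (-1), vac_mem_finLiePiece⟩ : UnivEnv V) = 1 :=
  uMode_vac

/-- If the right unities `e_n` of the `𝔄_n` act as the identity on `Φ^L(A)_n`, then they act as the
identity on `Φ^R(A)_{-n}`. -/
theorem contract_unity {e : ∀ d : ℕ, ModeTransition V d (-d)}
    (he : ∀ (d : ℕ) (a : ModeTransition V d (-d)), (univGrading V).star a (e d) = a)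
    (he' : ∀ (d : ℕ) (z : Verma V (ZhuAlgebra V) d), (univGrading V).star (e d) z = z)
    (m : ℕ) (t : (univGrading V).VermaR (-(m : ℤ))) : (univGrading V).contract m t (e m) = t := by
  refine (univGrading V).contract_eq_self (he' m) (fun x hx hx' => ?_) t
  exact Orth.mem_NR
    (fun n x hx y hy p hp => (univGrading V).mul_mul_mem_NR (he n) hx.1 hx.2 hy hp)
    (fun n p => (univGrading V).mk_mem_closure (he' n) p) ⟨hx, hx'⟩

theorem star_zhu_of_starEnd {d : ℕ} {e : ModeTransition V d (-d)}
    (h : starEnd (ZhuAlgebra V) d e = 1) (z : (univGrading V).VermaL (univGrading V).Zhu d) :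
    (univGrading V).star e z = z :=
  DFunLike.congr_fun h z

end VertexOperatorAlgebra

end

/-! ### The equivalences -/

theorem mainTheorem10 (V : Type u) [AddCommGroup V] [Module ℂ V] [VertexOperatorAlgebra V]
    (I : ∀ d : ℕ, VertexOperatorAlgebra.ModeTransition V d (-d))
    (hI : ∀ d : ℕ, VertexOperatorAlgebra.IsUnity (I d)) :
    List.TFAE [
      ∀ (d n m : ℕ) (x : VertexOperatorAlgebra.finLiePiece V d)
        (a : VertexOperatorAlgebra.ModeTransition V n (-m)),
        VertexOperatorAlgebra.star (VertexOperatorAlgebra.lieSmul x (I n)) a =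
            VertexOperatorAlgebra.lieSmul x a ∧
          VertexOperatorAlgebra.star a (VertexOperatorAlgebra.smulLie (I m) x) =
            VertexOperatorAlgebra.smulLie a x,
      ∀ (n m : ℕ) (a : VertexOperatorAlgebra.ModeTransition V n (-m)),
        VertexOperatorAlgebra.star (I n) a = a ∧ VertexOperatorAlgebra.star a (I m) = a,
      ∀ d : ℕ, VertexOperatorAlgebra.starEnd (VertexOperatorAlgebra.ZhuAlgebra V) d (I d) = 1,
      ∀ d : ℕ, VertexOperatorAlgebra.starEnd (VertexOperatorAlgebra.ZhuAlgebra V) d (I d) = 1 ∧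
        Function.Injective
          (VertexOperatorAlgebra.starEnd (V := V) (VertexOperatorAlgebra.ZhuAlgebra V) d),
      ∀ (d : ℕ) (M : Type u) [AddCommGroup M] [Module (VertexOperatorAlgebra.ZhuAlgebra V) M],
        VertexOperatorAlgebra.starEnd M d (I d) = 1] := by
  tfae_have 2 → 1 := fun h d n m x a => by
    refine ⟨?_, ?_⟩
    · refine ((VertexOperatorAlgebra.univGrading V).star_lact _ _ _).trans ?_
      exact congrArg _ (h n m a).1
    · refine ((VertexOperatorAlgebra.univGrading V).star_ract _ _ _).trans ?_
      exact congrArg _ (h n m a).2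
  -- Take `d = 0` and `u = 1_[-1]`, whose image in `𝒰` is `1`.
  tfae_have 1 → 2 := fun h n m a =>
    ⟨(VertexOperatorAlgebra.univGrading V).star_eq_of_lact_one Int.natCast_zero _
        VertexOperatorAlgebra.coe_ofLie_vac (I n) a a
        (h 0 n m ⟨_, VertexOperatorAlgebra.vac_mem_finLiePiece⟩ a).1,
      (VertexOperatorAlgebra.univGrading V).star_eq_of_ract_one Int.natCast_zero _
        VertexOperatorAlgebra.coe_ofLie_vac a (I m) a
        (h 0 n m ⟨_, VertexOperatorAlgebra.vac_mem_finLiePiece⟩ a).2⟩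
  -- Only `m = 0` is needed, `A` being a retract of `Φ^R(A)_0`.
  tfae_have 2 → 3 := fun h d => AddMonoidHom.ext fun z =>
    (VertexOperatorAlgebra.univGrading V).star_zhu_eq_self_of_zero Int.natCast_zero
      (fun z => (h d 0 z).1) z
  tfae_have 3 → 5 := fun h d M _ _ => AddMonoidHom.ext fun z =>
    (VertexOperatorAlgebra.univGrading V).star_eq_self_of_zhu
      (fun z => congrArg (fun f => f z) (h d)) z
  tfae_have 5 → 3 := fun h d => h d _
  tfae_have 3 → 4 := fun h d =>
    ⟨h d, (VertexOperatorAlgebra.univGrading V).star_injective fun a => (hI d a).2⟩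
  tfae_have 4 → 3 := fun h d => (h d).1
  -- The left identity is the case `W = Φ^R(A)_{-m}` of the action on `Φ^L(W)_n`; the right identity
  -- is the deep half and uses condition 3 in all degrees.
  tfae_have 3 → 2 := fun h n m a =>
    ⟨(VertexOperatorAlgebra.univGrading V).star_eq_self_of_zhu
        (fun z => VertexOperatorAlgebra.star_zhu_of_starEnd (h n) z) a,
      (VertexOperatorAlgebra.univGrading V).star_eq_self_of_contract
        (VertexOperatorAlgebra.contract_unity (e := I) (fun d a => (hI d a).2)
          (fun d z => VertexOperatorAlgebra.star_zhu_of_starEnd (h d) z) m) a⟩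
  tfae_finish
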